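/- Let $d\ge 1$, let $\Omega\subset\mathbb R^d$ be compact, $Y$ a real Hilbert space, $\alpha>0$, and let $\mathcal M$ be the space of Radon measures on $\Omega$ (the dual of $C(\Omega)$, with the dual norm). Let $\kappa:\Omega\to Y$ be Hölder continuous, let $F:Y\to[0,\infty)$ be strictly convex and continuously differentiable with Lipschitz gradient, and put $$J(u)=F(Ku)+\alpha\|u\|,\quad Ku=\int_\Omega\kappa\,du,\quad r_J(u)=J(u)-\min_{\mathcal M}J,\quad p_u(x)=-(\kappa(x),\nabla F(Ku))_Y,$$ $$\varphi(u,v)=\langle p_u,v-u\rangle+\alpha\|u\|-\alpha\|v\|.$$ A sparse measure $u$ is a finite combination of Dirac measures; $\mathcal A_u$ denotes its support, and $B_r(x)$ an open ball. **Assumptions.** Let $\bar u\neq0$ be a minimizer of $J$ with $\bar p=p_{\bar u}$, and let $\gamma,\theta,R'>0$ and $0<\sigma'<\alpha$ be such that: $(\nabla F(y_1)-\nabla F(y_2),y_1-y_2)_Y\ge\gamma\|y_1-y_2\|^2$ on a neighbourhood of $K\bar u$; the set $\{x\in\Omega:|\bar p(x)|=\alpha=\|\bar p\|_{C(\Omega)}\}=\{\bar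 x^1,\dots,\bar x^{\bar N}\}$ is finite, lies in $\operatorname{int}\Omega$ and equals $\operatorname{supp}\bar u$, so that $\bar u=\sum_j\bar\lambda^j\delta_{\bar x^j}$ with all $\bar\lambda^j\ne0$; the vectors $\kappa(\bar x^1),\dots,\kappa(\bar x^{\bar N})$ are linearly independent; with $\Omega_r=\bigcup_jB_r(\bar x^j)$ we have $\Omega_{R'}\subset\operatorname{int}\Omega$, $\kappa\in C^2(\overline{\Omega_{R'}};Y)$ and $|\bar p|\le\alpha-\sigma'$ on $\Omega\setminus\overline{\Omega_{R'}}$; the balls $B_{2R'}(\bar x^j)$ are pairwise disjoint; and $-\operatorname{sign}(\bar p(\bar x^j))\nabla^2\bar p(\bar x^j)\ge\theta\,\mathrm{Id}$ for all $j$. **Admissible radii.** Call $(R,\sigma)$ admissible if for some $\Delta>0$ every $u\in\mathcal M$ with $r_J(u)\le\Delta$ satisfies the following. For every $j$ and all $x\in B_R(\bar x^j)$, $\operatorname{sign}p_u(x)=\operatorname{sign}\bar p(\bar x^j)=\operatorname{sign}\bar\lambda^j$ and $-\operatorname{sign}(p_u(x))\nabla^2p_u(x)\ge\frac\theta4\mathrm{Id}$;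 $|p_u|$ has a unique local maximizer $\hat x$ on $B_R(\bar x^j)$, with $\frac\theta8\|\hat x-x\|^2\le|p_u(\hat x)|-|p_u(x)|\le2R\|\nabla p_u(x)\|$ for all $x\in B_R(\bar x^j)$; and $|p_u|\le\alpha-\sigma/2$ on $\Omega\setminus\overline{\Omega_R}$. **Constants.** Let $L,C_K,C_{K'}>0$ be such that $\nabla F$ is $L$-Lipschitz, $\|\kappa\|\le C_K$ on $\Omega$, and $\|\kappa\|\le C_{K'}$, $\|D\kappa\|\le C_{K'}$ on $\Omega_{R'}$. Let $u_0$ be sparse and let $M>0$ be such that $J(v)\le J(u_0)$ implies $\|v\|\le M$. Let $\varepsilon_1>0$ with $r_J(u_0)\le2M\varepsilon_1$, and $\Psi_1>0$. Put $C=4LM^2C_K^2$, $\bar\mu=\frac12\min_j|\bar\lambda^j|$, $$\tilde C=2C_{K'}\Big(2M\sqrt{\tfrac R\theta}+\tfrac{2MC_{K'}L}{\theta\sqrt\gamma}+\sqrt{\tfrac M\theta}\Big),\qquad \zeta=1-\frac{\bar\mu}{8M}\min\Big\{1,\frac{\bar\mu}{4ML\tilde C^2}\Big\}.$$ **Algorithm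 LPDAP.** It uses the following subroutines. * *DropStep*$(u)$: let $u^{\rm drop}$ be $u$ with all atoms removed at points $x\in\mathcal A_u$ with $\operatorname{sign}p_u(x)\ne\operatorname{sign}u(\{x\})$ or $|p_u(x)|\le\alpha-\sigma/2$. Return $u^{\rm drop}$ if $J(u^{\rm drop})\le J(u)$, otherwise $u$. * *CoefficientStep*$(u,\Psi)$: for positive measures $w,v$ on $\mathcal A_u$ let $v^u_w=\sum_{x\in\mathcal A_u}\operatorname{sign}(u(\{x\}))w(\{x\})\delta_x$, $K^uw=Kv^u_w$, $J^u(w)=F(K^uw)+\alpha\|w\|$, $p^u_w(x)=-\operatorname{sign}(u(\{x\}))(\kappa(x),\nabla F(K^uw))_Y$ and $\Phi^u(w)=\max_{v\ge0,\ \operatorname{supp}v\subset\mathcal A_u,\ \|v\|\le M}\big[\langle p^u_w,v-w\rangle+\alpha\|w\|-\alpha\|v\|\big]$. Find a positive measure $w$ on $\mathcal A_u$ with $J^u(w)\le J^u(|u|)$ and $\Phi^u(w)\le\Psi$; return $v^u_w$ and $w$. * *LSIStep*$(u)$: start with $\mathcal A=\mathcal A_u$, $\mathcal B=\emptyset$.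 While $\mathcal A\ne\emptyset$, choose $x\in\operatorname{argmax}_{\mathcal A}|p_u|$; if there is a point $y\in B_{2R}(x)\cap\operatorname{int}\Omega$ at which $p_u$ is differentiable, with $|p_u(y)|>\alpha-\sigma/2$, $\|\nabla p_u(y)\|\le\max_{v\in\mathcal M,\ \operatorname{supp}v\subset\mathcal A_u,\ \|v\|\le M}\varphi(u,v)$ and $|p_u(y)|-\max_{\mathcal A_u\cap B_{2R}(x)}|p_u|\ge2R\|\nabla p_u(y)\|$, add one such $y$ to $\mathcal B$; replace $\mathcal A$ by $\mathcal A\setminus B_{2R}(x)$. Then put $\tilde v=\sum_{x\in\mathcal B}u(B_{2R}(x))\delta_x$, let $\hat x$ maximize $|p_u(x)|-\max_{\mathcal A_u\cap B_{2R}(x)}|p_u|$ over $\mathcal B$, $\hat\mu=|u(B_{2R}(\hat x))|$ (if $\mathcal B=\emptyset$, any $\hat\mu\ge0$), $\tilde\eta=\min\{1,\hat\mu/(4ML\tilde C^2)\}$, and return $(1-\tilde\eta)u+\tilde\eta\tilde v$. * *LGCGStep*$(u,\varepsilon)$: let $v_u(x)=M\operatorname{sign}(p_u(x))\delta_x$.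 If some $v\in\{0\}\cup\{v_u(x):x\in\Omega\}$ has $\varphi(u,v)\ge M\varepsilon$, take such a $v$, $\eta=\min\{1,M\varepsilon/C\}$, $\varepsilon_+=\varepsilon$. Otherwise take $v=0$ if $\|p_u\|_{C(\Omega)}<\alpha$ and $v=v_u(\hat x)$ with $\hat x\in\operatorname{argmax}_\Omega|p_u|$ if not, $\eta=\min\{1,\varphi(u,v)/C\}$, $\varepsilon_+=\varphi(u,v)/(2M)$. Return $(1-\eta)u+\eta v$, $v$, $\varepsilon_+$. Set $u_{1-}=\mathrm{DropStep}(u_0)$ and $s=0$. For $k=1,2,\dots$: (i) $(u_{k,s},w)=\mathrm{CoefficientStep}(u_{k-},\Psi_k)$, $\tilde u=\mathrm{LSIStep}(u_{k,s})$, $(\hat u,v,\varepsilon_{k+1})=\mathrm{LGCGStep}(u_{k,s},\varepsilon_k)$; (ii) terminate if $\varepsilon_{k+1}=0$; (iii) if $\Phi^{u_{k-}}(w)>\varphi(u_{k,s},v)/2$, halve $\Psi_k$, increase $s$ by one and return to (i) with the same $k$ (a recompute step); (iv) otherwise put $\Psi_{k+1}=\Psi_k$, let $u_{k+}$ be one of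 $\tilde u,\hat u$ with the smaller value of $J$, set $u_{(k+1)-}=\mathrm{DropStep}(u_{k+})$, and pass to $k+1$ with the same $s$. Thus $s$ counts all recompute steps so far. **Claim.** There is $\tilde R\in(0,R']$ such that for every $R\in(0,\tilde R)$ some $(R,\sigma)$ with $0<\sigma\le\sigma'$ is admissible. Moreover, for every admissible $(R,\sigma)$ with $0<R<R'$, $0<\sigma\le\sigma'$, and all further data as above, $\zeta\in(0,1)$, and for every non-terminating run of LPDAP, with any admissible choices in the subroutines, there is $n_0$ such that $$r_J(u_{k,s})\le\zeta^{\frac13(k+s)}\qquad\text{for all pairs }(k,s)\text{ occurring in the run with }k+s\ge n_0.$$ -/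

import Mathlib

open Set Filter Topology Metric
open scoped NNReal InnerProductSpace

noncomputable section

/-- Data of the problem `min_u F (K u) + α ‖u‖`, together with the standing assumptions on the
kernel `κ` and on the functional `F`. The kernel is only ever used on the compact set `Ω`
(and its derivatives only in the interior of `Ω`). -/
structure SparseProblem (d : ℕ) (Y : Type*) [NormedAddCommGroup Y] [InnerProductSpace ℝ Y]
    [CompleteSpace Y] where
  /-- the compact domain -/
  Ω : Set (EuclideanSpace ℝ (Fin d))
  isCompact_Ω : IsCompact Ω
  /-- the kernel -/
  κ : EuclideanSpace ℝ (Fin d) → Y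
  holder_κ : ∃ ν C : ℝ≥0, 0 < ν ∧ HolderOnWith C ν κ Ω
  /-- the smooth part of the objective -/
  F : Y → ℝ
  F_nonneg : ∀ y, 0 ≤ F y
  strictConvex_F : StrictConvexOn ℝ univ F
  contDiff_F : ContDiff ℝ 1 F
  lipschitz_gradient_F : ∃ L : ℝ, 0 < L ∧
    ∀ y₁ y₂, ‖gradient F y₁ - gradient F y₂‖ ≤ L * ‖y₁ - y₂‖
  /-- the regularization parameter -/
  α : ℝ
  α_pos : 0 < α

/-- The parameters `γ, θ, R, σ, L, C_K, C_{K'}` and the norm bound `M`. -/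
structure LPDAPParams where
  γ : ℝ
  θ : ℝ
  R : ℝ
  σ : ℝ
  L : ℝ
  CK : ℝ
  CK' : ℝ
  M : ℝ

/-- `f ∈ C^n(closure U)`: `f` is `n` times continuously differentiable on the open set `U` and all
derivatives up to order `n` extend continuously to `closure U`. -/
def ContDiffClosure {E G : Type*} [NormedAddCommGroup E] [NormedSpace ℝ E]
    [NormedAddCommGroup G] [NormedSpace ℝ G] (n : ℕ) (f : E → G) (U : Set E) : Prop :=
  ContDiffOn ℝ n f U ∧
    ∀ m : ℕ, m ≤ n → ∃ g : E → (E [×m]→L[ℝ] G),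
      ContinuousOn g (closure U) ∧ EqOn (iteratedFDeriv ℝ m f) g U

namespace SparseProblem

variable {d : ℕ} {Y : Type*} [NormedAddCommGroup Y] [InnerProductSpace ℝ Y] [CompleteSpace Y]

instance instCompactSpaceΩ (P : SparseProblem d Y) : CompactSpace P.Ω :=
  isCompact_iff_compactSpace.mp P.isCompact_Ω

lemma continuousOn_κ (P : SparseProblem d Y) : ContinuousOn P.κ P.Ω := by
  obtain ⟨ν, C, hν, h⟩ := P.holder_κ
  exact h.continuousOn hν

/-- Radon measures on `Ω`: the topological dual of `C(Ω)` with the dual norm. -/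
abbrev Meas (P : SparseProblem d Y) : Type := StrongDual ℝ C(P.Ω, ℝ)

/-- Sparse measures `∑ λ^j δ_{x^j}`, represented by their finitely supported coefficient
function `x ↦ u {x}`; the finite support of that function is the support `𝒜_u` of the measure. -/
abbrev Sparse (P : SparseProblem d Y) : Type := P.Ω →₀ ℝ

/-- The Dirac measure at `x`. -/
def dirac (P : SparseProblem d Y) (x : P.Ω) : P.Meas := ContinuousMap.evalCLM ℝ x

/-- The measure `∑ u(x) δ_x` of a sparse coefficient function. -/
def toMeas (P : SparseProblem d Y) : P.Sparse →ₗ[ℝ] P.Meas := Finsupp.linearCombination ℝ P.dirac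

/-- The kernel as a continuous function on `Ω`. -/
def κC (P : SparseProblem d Y) : C(P.Ω, Y) :=
  ⟨fun x => P.κ x, continuousOn_iff_continuous_domRestrict.mp P.continuousOn_κ⟩

/-- The operator `K_* : Y → C(Ω)`, `(K_* y)(x) = (κ(x), y)`. -/
def Kstar (P : SparseProblem d Y) : Y →L[ℝ] C(P.Ω, ℝ) :=
  LinearMap.mkContinuous
    { toFun := fun y => ⟨fun x => ⟪P.κC x, y⟫_ℝ, by fun_prop⟩
      map_add' := fun y z => by ext x; simp [inner_add_right]
      map_smul' := fun c y => by ext x; simp [inner_smul_right] }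
    ‖P.κC‖
    (fun y => by
      refine (ContinuousMap.norm_le _ (by positivity)).mpr fun x => ?_
      exact (norm_inner_le_norm _ _).trans
        (mul_le_mul_of_nonneg_right (P.κC.norm_coe_le_norm x) (norm_nonneg _)))

/-- `K u = ∫ κ du`, the element of `Y` with `(K u, y) = ∫ (κ(x), y) du(x)` for all `y`. -/
def K (P : SparseProblem d Y) (u : P.Meas) : Y :=
  (InnerProductSpace.toDual ℝ Y).symm (u.comp P.Kstar)

lemma inner_K (P : SparseProblem d Y) (u : P.Meas) (y : Y) : ⟪P.K u, y⟫_ℝ = u (P.Kstar y) := by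
  simp [K]

lemma K_toMeas (P : SparseProblem d Y) (u : P.Sparse) :
    P.K (P.toMeas u) = u.sum fun x a => a • P.κ x := by
  refine ext_inner_right ℝ fun y => ?_
  rw [inner_K, toMeas, Finsupp.linearCombination_apply, Finsupp.sum, Finsupp.sum, sum_inner]
  simp only [inner_smul_left]
  simp [dirac, Kstar]
  rfl

/-- The objective `J(u) = F(K u) + α ‖u‖`. -/
def J (P : SparseProblem d Y) (u : P.Meas) : ℝ := P.F (P.K u) + P.α * ‖u‖

/-- The residual `r_J(u) = J(u) - min J`. -/
def res (P : SparseProblem d Y) (u : P.Meas) : ℝ := P.J u - ⨅ v : P.Meas, P.J v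

/-- The dual variable `p_u = - K_* ∇F(K u)` as an element of `C(Ω)`. -/
def pC (P : SparseProblem d Y) (u : P.Meas) : C(P.Ω, ℝ) := -P.Kstar (gradient P.F (P.K u))

/-- The dual variable as a function of a Euclidean variable (meaningful on `Ω`); used for
derivatives in the interior of `Ω`. -/
def p (P : SparseProblem d Y) (u : P.Meas) (x : EuclideanSpace ℝ (Fin d)) : ℝ :=
  -⟪P.κ x, gradient P.F (P.K u)⟫_ℝ

lemma pC_apply (P : SparseProblem d Y) (u : P.Meas) (x : P.Ω) : P.pC u x = P.p u x := rfl

/-- `φ(u, v) = ⟨p_u, v - u⟩ + α ‖u‖ - α ‖v‖`. -/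
def gap (P : SparseProblem d Y) (u v : P.Meas) : ℝ :=
  (v - u) (P.pC u) + P.α * ‖u‖ - P.α * ‖v‖

/-- `Φ_{𝒜_u}(u)`, the maximum of `φ(u, v)` over measures `v` supported in `𝒜_u` with
`‖v‖ ≤ M`. -/
def supportGap (P : SparseProblem d Y) (M : ℝ) (u : P.Sparse) : ℝ :=
  sSup {t | ∃ v : P.Sparse, v.support ⊆ u.support ∧ ‖P.toMeas v‖ ≤ M ∧
    t = P.gap (P.toMeas u) (P.toMeas v)}

/-! ### Structural assumptions -/

/-- `Ω_r`, the union of the open balls of radius `r` around the support points of `ubar`. -/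
def nbhd (P : SparseProblem d Y) (ubar : P.Sparse) (r : ℝ) : Set (EuclideanSpace ℝ (Fin d)) :=
  ⋃ x ∈ ubar.support, ball (x : EuclideanSpace ℝ (Fin d)) r

/-- `ubar` is a minimizer and the structural (second order) assumptions hold with constants
`γ, θ, R', σ'`. A measure whose support is a finite set is a sparse measure with nonzero
coefficients on that set, so that the minimizer is represented by its coefficient function. -/
structure Nondegenerate (P : SparseProblem d Y) (ubar : P.Sparse) (γ θ R' σ' : ℝ) : Prop where
  isMin : ∀ v : P.Meas, P.J (P.toMeas ubar) ≤ P.J v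
  γ_pos : 0 < γ
  strongConvex : ∃ N ∈ 𝓝 (P.K (P.toMeas ubar)), ∀ y₁ ∈ N, ∀ y₂ ∈ N,
    γ * ‖y₁ - y₂‖ ^ 2 ≤ ⟪gradient P.F y₁ - gradient P.F y₂, y₁ - y₂⟫_ℝ
  support_eq : (ubar.support : Set P.Ω) =
    {x : P.Ω | |P.p (P.toMeas ubar) x| = P.α ∧ ‖P.pC (P.toMeas ubar)‖ = P.α}
  support_interior : ∀ x ∈ ubar.support, (x : EuclideanSpace ℝ (Fin d)) ∈ interior P.Ω
  linearIndependent : LinearIndependent ℝ (fun x : ubar.support => P.κ (x : P.Ω))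
  R'_pos : 0 < R'
  σ'_pos : 0 < σ'
  σ'_lt : σ' < P.α
  nbhd_subset : P.nbhd ubar R' ⊆ interior P.Ω
  contDiff_κ : ContDiffClosure 2 P.κ (P.nbhd ubar R')
  p_le : ∀ x ∈ P.Ω \ closure (P.nbhd ubar R'), |P.p (P.toMeas ubar) x| ≤ P.α - σ'
  disjoint_balls : ∀ x ∈ ubar.support, ∀ y ∈ ubar.support, x ≠ y →
    Disjoint (ball (x : EuclideanSpace ℝ (Fin d)) (2 * R'))
      (ball (y : EuclideanSpace ℝ (Fin d)) (2 * R'))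
  θ_pos : 0 < θ
  curvature : ∀ x ∈ ubar.support, ∀ h : EuclideanSpace ℝ (Fin d),
    θ * ‖h‖ ^ 2 ≤ -(Real.sign (P.p (P.toMeas ubar) x)) *
      fderiv ℝ (fderiv ℝ (P.p (P.toMeas ubar))) (x : EuclideanSpace ℝ (Fin d)) h h

/-- The radius `R` and the parameter `σ` are compatible: on some sublevel set `{r_J ≤ Δ}`, `Δ > 0`,
every dual variable has, on each ball `B_R(x̄)`, constant sign, a unique local maximizer of its
absolute value, curvature and quadratic growth, and it is at most `α - σ/2` off `Ω_R`. -/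
def AdmissibleRadius (P : SparseProblem d Y) (ubar : P.Sparse) (θ R σ : ℝ) : Prop :=
  ∃ Δ : ℝ, 0 < Δ ∧ ∀ u : P.Meas, P.res u ≤ Δ →
    (∀ xb ∈ ubar.support,
      (∀ x ∈ ball (xb : EuclideanSpace ℝ (Fin d)) R,
        Real.sign (P.p u x) = Real.sign (P.p (P.toMeas ubar) xb) ∧
        Real.sign (P.p u x) = Real.sign (ubar xb)) ∧
      (∃ xh ∈ ball (xb : EuclideanSpace ℝ (Fin d)) R,
        IsLocalMax (fun x => |P.p u x|) xh ∧
        (∀ x ∈ ball (xb : EuclideanSpace ℝ (Fin d)) R,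
          IsLocalMax (fun x => |P.p u x|) x → x = xh) ∧
        (∀ x ∈ ball (xb : EuclideanSpace ℝ (Fin d)) R,
          |P.p u xh| - |P.p u x| ≤ 2 * R * ‖gradient (P.p u) x‖) ∧
        (∀ x ∈ ball (xb : EuclideanSpace ℝ (Fin d)) R,
          θ / 8 * ‖xh - x‖ ^ 2 ≤ |P.p u xh| - |P.p u x|)) ∧
      (∀ x ∈ ball (xb : EuclideanSpace ℝ (Fin d)) R, ∀ h : EuclideanSpace ℝ (Fin d),
        θ / 4 * ‖h‖ ^ 2 ≤ -(Real.sign (P.p u x)) * fderiv ℝ (fderiv ℝ (P.p u)) x h h)) ∧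
    (∀ x ∈ P.Ω \ closure (P.nbhd ubar R), |P.p u x| ≤ P.α - σ / 2)

/-- The Lipschitz and norm bounds required of `L`, `C_K` and `C_{K'}`. -/
structure Bounds (P : SparseProblem d Y) (ubar : P.Sparse) (R' L CK CK' : ℝ) : Prop where
  L_pos : 0 < L
  CK_pos : 0 < CK
  CK'_pos : 0 < CK'
  lipschitz : ∀ y₁ y₂, ‖gradient P.F y₁ - gradient P.F y₂‖ ≤ L * ‖y₁ - y₂‖
  norm_κ : ∀ x ∈ P.Ω, ‖P.κ x‖ ≤ CK
  norm_κ' : ∀ x ∈ P.nbhd ubar R', ‖P.κ x‖ ≤ CK'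
  norm_fderiv_κ : ∀ x ∈ P.nbhd ubar R', ‖fderiv ℝ P.κ x‖ ≤ CK'

/-! ### The subroutines -/

section Algorithm

variable (P : SparseProblem d Y) (q : LPDAPParams)

/-- The set `𝒟_u` of support points removed by a drop step. -/
def dropSet (u : P.Sparse) : Set P.Ω :=
  {x | x ∈ u.support ∧ (Real.sign (P.p (P.toMeas u) x) ≠ Real.sign (u x) ∨
    |P.p (P.toMeas u) x| ≤ P.α - q.σ / 2)}

open Classical in
/-- The restriction of `u` to the complement of `𝒟_u`. -/
def dropMeasure (u : P.Sparse) : P.Sparse := u.filter fun x => x ∉ P.dropSet q u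

open Classical in
/-- `DropStep`. -/
def dropStep (u : P.Sparse) : P.Sparse :=
  if P.J (P.toMeas (P.dropMeasure q u)) ≤ P.J (P.toMeas u) then P.dropMeasure q u else u

/-- `w ∈ 𝓜₊(𝒜_u)`. -/
def IsPosOn (u w : P.Sparse) : Prop := w.support ⊆ u.support ∧ ∀ x, 0 ≤ w x

/-- `K^u w = ∑_{x ∈ 𝒜_u} sign(u{x}) w{x} κ(x)`. -/
def coefK (u w : P.Sparse) : Y := ∑ x ∈ u.support, (Real.sign (u x) * w x) • P.κ x

/-- `J^u(w) = F(K^u w) + α ‖w‖`. -/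
def coefJ (u w : P.Sparse) : ℝ := P.F (P.coefK u w) + P.α * ‖P.toMeas w‖

/-- The dual variable `p^u_w = - K^u_* ∇F(K^u w)` of the sign-constrained problem. -/
def coefP (u w : P.Sparse) (x : P.Ω) : ℝ :=
  -(Real.sign (u x) * ⟪P.κ x, gradient P.F (P.coefK u w)⟫_ℝ)

/-- `φ^u(w, v) = ⟨p^u_w, v - w⟩ + α ‖w‖ - α ‖v‖`. -/
def coefGapFun (u w v : P.Sparse) : ℝ :=
  (∑ x ∈ u.support, P.coefP u w x * (v x - w x)) + P.α * ‖P.toMeas w‖ - P.α * ‖P.toMeas v‖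

/-- `Φ^u(w)`, the maximum of `φ^u(w, v)` over `v ∈ 𝓜₊(𝒜_u)` with `‖v‖ ≤ M`. -/
def coefGap (u w : P.Sparse) : ℝ :=
  sSup {t | ∃ v : P.Sparse, P.IsPosOn u v ∧ ‖P.toMeas v‖ ≤ q.M ∧ t = P.coefGapFun u w v}

/-- `v^u_w = ∑_{x ∈ 𝒜_u} sign(u{x}) w{x} δ_x`. -/
def signed (u w : P.Sparse) : P.Sparse :=
  ∑ x ∈ u.support, Finsupp.single x (Real.sign (u x) * w x)

/-- `(uplus, w)` is a possible output of `CoefficientStep (u, Ψ)`. -/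
def IsCoefficientStep (u : P.Sparse) (Ψ : ℝ) (uplus w : P.Sparse) : Prop :=
  P.IsPosOn u w ∧ P.coefJ u w ≤ P.coefJ u (u.mapRange (fun t : ℝ => |t|) abs_zero) ∧
    P.coefGap q u w ≤ Ψ ∧ uplus = P.signed u w

/-- `max |p_u|` over `𝒜_u ∩ B_{2R}(x)`. -/
def nearMax (u : P.Sparse) (x : P.Ω) : ℝ :=
  sSup ((fun z : P.Ω => |P.p (P.toMeas u) z|) '' {z | z ∈ u.support ∧ dist z x < 2 * q.R})

/-- `y` is an admissible point `x_LSI` for the center `x`. -/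
def IsLSIPoint (u : P.Sparse) (x y : P.Ω) : Prop :=
  dist y x < 2 * q.R ∧
  (y : EuclideanSpace ℝ (Fin d)) ∈ interior P.Ω ∧
  DifferentiableAt ℝ (P.p (P.toMeas u)) (y : EuclideanSpace ℝ (Fin d)) ∧
  P.α - q.σ / 2 < |P.p (P.toMeas u) y| ∧
  ‖gradient (P.p (P.toMeas u)) (y : EuclideanSpace ℝ (Fin d))‖ ≤ P.supportGap q.M u ∧
  2 * q.R * ‖gradient (P.p (P.toMeas u)) (y : EuclideanSpace ℝ (Fin d))‖ ≤
    |P.p (P.toMeas u) y| - P.nearMax q u x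

open Classical in
/-- `LSILoop u A B`: starting from the working set `A`, the loop of the local support improver
may collect the set `B` of improved points. -/
inductive LSILoop (u : P.Sparse) : Finset P.Ω → Finset P.Ω → Prop
  | done : LSILoop u ∅ ∅
  | found (A B : Finset P.Ω) (x y : P.Ω) (hx : x ∈ A)
      (hmax : ∀ z ∈ A, |P.p (P.toMeas u) z| ≤ |P.p (P.toMeas u) x|)
      (hy : P.IsLSIPoint q u x y)
      (hB : LSILoop u (A.filter fun z => ¬ dist z x < 2 * q.R) B) : LSILoop u A (insert y B)
  | skip (A B : Finset P.Ω) (x : P.Ω) (hx : x ∈ A)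
      (hmax : ∀ z ∈ A, |P.p (P.toMeas u) z| ≤ |P.p (P.toMeas u) x|)
      (hy : ∀ y, ¬ P.IsLSIPoint q u x y)
      (hB : LSILoop u (A.filter fun z => ¬ dist z x < 2 * q.R) B) : LSILoop u A B

open Classical in
/-- `u(B_{2R}(x))`. -/
def ballMass (u : P.Sparse) (x : P.Ω) : ℝ :=
  ∑ z ∈ u.support.filter (fun z => dist z x < 2 * q.R), u z

/-- The lumped measure `∑_{x ∈ B} u(B_{2R}(x)) δ_x`. -/
def lumped (u : P.Sparse) (B : Finset P.Ω) : P.Sparse :=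
  ∑ x ∈ B, Finsupp.single x (P.ballMass q u x)

end Algorithm

end SparseProblem

/-- `C̃ = 2 C_{K'} (2 M √(R/θ) + 2 M C_{K'} L / (θ √γ) + √(M/θ))`. -/
def LPDAPParams.Ctilde (q : LPDAPParams) : ℝ :=
  2 * q.CK' * (2 * q.M * √(q.R / q.θ) + 2 * q.M * q.CK' * q.L / (q.θ * √q.γ) + √(q.M / q.θ))

/-- `C = 4 L M² C_K²`. -/
def LPDAPParams.C (q : LPDAPParams) : ℝ := 4 * q.L * q.M ^ 2 * q.CK ^ 2

/-- The contraction factor `ζ = 1 - μ̄/(8M) · min {1, μ̄/(4 M L C̃²)}`. -/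
def LPDAPParams.zeta (q : LPDAPParams) (μbar : ℝ) : ℝ :=
  1 - μbar / (8 * q.M) * min 1 (μbar / (4 * q.M * q.L * q.Ctilde ^ 2))

namespace SparseProblem

variable {d : ℕ} {Y : Type*} [NormedAddCommGroup Y] [InnerProductSpace ℝ Y] [CompleteSpace Y]

/-- `μ̄ = (1/2) min_j |λ̄^j|`. -/
def muBar (P : SparseProblem d Y) (ubar : P.Sparse) : ℝ :=
  1 / 2 * ⨅ x : ubar.support, |ubar (x : P.Ω)|

section Algorithm

variable (P : SparseProblem d Y) (q : LPDAPParams)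

/-- `uplus` is a possible output of `LSIStep u`. If no improved point was found, the factor `μhat`
is not determined by the procedure and may be any nonnegative number. -/
def IsLSIStep (u uplus : P.Sparse) : Prop :=
  ∃ (B : Finset P.Ω) (μhat η : ℝ),
    P.LSILoop q u u.support B ∧ 0 ≤ μhat ∧
    (B.Nonempty → ∃ x ∈ B,
      (∀ y ∈ B, |P.p (P.toMeas u) y| - P.nearMax q u y ≤
        |P.p (P.toMeas u) x| - P.nearMax q u x) ∧
      μhat = |P.ballMass q u x|) ∧
    η = min 1 (μhat / (16 * q.M * q.L * q.CK' ^ 2 *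
      (2 * q.M * √(q.R / q.θ) + 2 * q.M * q.CK' * q.L / (q.θ * √q.γ) + √(q.M / q.θ)) ^ 2)) ∧
    uplus = (1 - η) • u + η • P.lumped q u B

/-- `v_u(x) = M sign(p_u(x)) δ_x`. -/
def vDir (u : P.Sparse) (x : P.Ω) : P.Sparse :=
  Finsupp.single x (q.M * Real.sign (P.p (P.toMeas u) x))

/-- `v` is a lazy solution for `u` at tolerance `ε`. -/
def IsLazy (u : P.Sparse) (ε : ℝ) (v : P.Sparse) : Prop :=
  (v = 0 ∨ ∃ x, v = P.vDir q u x) ∧ q.M * ε ≤ P.gap (P.toMeas u) (P.toMeas v)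

/-- `v` is an exact update direction for `u`. -/
def IsExact (u v : P.Sparse) : Prop :=
  (‖P.pC (P.toMeas u)‖ < P.α ∧ v = 0) ∨
  (P.α ≤ ‖P.pC (P.toMeas u)‖ ∧ ∃ xh : P.Ω,
    (∀ x : P.Ω, |P.p (P.toMeas u) x| ≤ |P.p (P.toMeas u) xh|) ∧ v = P.vDir q u xh)

/-- `(uplus, v, εplus)` is a possible output of `LGCGStep (u, ε, C)`: a lazy call if a lazy solution
exists, an exact call otherwise. -/
def IsLGCGStep (u : P.Sparse) (ε C : ℝ) (uplus v : P.Sparse) (εplus : ℝ) : Prop :=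
  ∃ η : ℝ, uplus = (1 - η) • u + η • v ∧
    ((P.IsLazy q u ε v ∧ η = min 1 (q.M * ε / C) ∧ εplus = ε) ∨
     ((∀ v', ¬ P.IsLazy q u ε v') ∧ P.IsExact q u v ∧
        η = min 1 (P.gap (P.toMeas u) (P.toMeas v) / C) ∧
        εplus = P.gap (P.toMeas u) (P.toMeas v) / (2 * q.M)))

end Algorithm

/-- The variables of `LPDAP` during one pass through the body of its loop. -/
structure Stage (P : SparseProblem d Y) where
  /-- the outer iteration counter -/
  k : ℕ
  /-- the total number of recompute steps so far -/
  s : ℕ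
  /-- `u_{k-}` -/
  uminus : P.Sparse
  /-- `ε_k` -/
  ε : ℝ
  /-- the current value of `Ψ_k` -/
  Ψ : ℝ
  /-- `u_{k,s}` -/
  u : P.Sparse
  /-- `w_{k,s}` -/
  w : P.Sparse
  /-- `ũ_{k+}` -/
  utilde : P.Sparse
  /-- `û_{k+}` -/
  uhat : P.Sparse
  /-- `v_k` -/
  v : P.Sparse
  /-- `ε_{k+1}` as returned by the `LGCG` step -/
  εnext : ℝ

/-- `T` is an infinite (never terminating) run of `LPDAP`, listed by consecutive passes through the
loop body; each pass is followed either by a recompute step (same `k`, next `s`) or by the next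
outer iteration (next `k`, same `s`). -/
structure IsLPDAPRun (P : SparseProblem d Y) (q : LPDAPParams) (u₀ : P.Sparse) (ε₁ Ψ₁ : ℝ)
    (T : ℕ → P.Stage) : Prop where
  k_zero : (T 0).k = 1
  s_zero : (T 0).s = 0
  uminus_zero : (T 0).uminus = P.dropStep q u₀
  ε_zero : (T 0).ε = ε₁
  Ψ_zero : (T 0).Ψ = Ψ₁
  coefficient : ∀ n, P.IsCoefficientStep q (T n).uminus (T n).Ψ (T n).u (T n).w
  lsi : ∀ n, P.IsLSIStep q (T n).u (T n).utilde
  lgcg : ∀ n, P.IsLGCGStep q (T n).u (T n).ε q.C (T n).uhat (T n).v (T n).εnext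
  not_terminated : ∀ n, (T n).εnext ≠ 0
  recompute : ∀ n,
    P.gap (P.toMeas (T n).u) (P.toMeas (T n).v) / 2 < P.coefGap q (T n).uminus (T n).w →
      (T (n + 1)).k = (T n).k ∧ (T (n + 1)).s = (T n).s + 1 ∧
      (T (n + 1)).uminus = (T n).uminus ∧ (T (n + 1)).ε = (T n).ε ∧
      (T (n + 1)).Ψ = (T n).Ψ / 2
  advance : ∀ n,
    P.coefGap q (T n).uminus (T n).w ≤ P.gap (P.toMeas (T n).u) (P.toMeas (T n).v) / 2 →
      (T (n + 1)).k = (T n).k + 1 ∧ (T (n + 1)).s = (T n).s ∧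
      (T (n + 1)).ε = (T n).εnext ∧ (T (n + 1)).Ψ = (T n).Ψ ∧
      ∃ uplus : P.Sparse, (uplus = (T n).utilde ∨ uplus = (T n).uhat) ∧
        P.J (P.toMeas uplus) ≤ P.J (P.toMeas (T n).utilde) ∧
        P.J (P.toMeas uplus) ≤ P.J (P.toMeas (T n).uhat) ∧
        (T (n + 1)).uminus = P.dropStep q uplus

end SparseProblem

end

/-!
A small residual `r_J(u)` forces the atoms of `u` into clusters around the `x̄^j`. For clustered
measures the local support improver contracts the residual by `ζ`, and the conditional gradient
step ensures that this regime is reached.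

*Localization.* The residual `r_J(u)` is the Bregman distance of `F` between `K u` and `K ū` plus
the complementarity defect `α ‖u‖ - ⟨p̄, u⟩`, both nonnegative. Local strong convexity turns a
small Bregman distance into closeness of `K u` to `K ū`, hence of `p_u` to `p̄` (uniformly) and,
near the `x̄^j`, of the second derivatives. So `p_u` has the sign of `p̄` and half of its
curvature there, which gives the admissible radii (`Nondegenerate.exists_admissibleRadius`). The
defect bounds the mass of `u` away from the `x̄^j`; therefore a drop step at small residual is
accepted and leaves only atoms in the balls `B_R(x̄^j)` with the signs of the `λ̄^j`
(`Nondegenerate.exists_clustered_dropStep`). Linear independence of the `κ(x̄^j)` then shows that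
the mass in each cluster is at least `μ̄` (`Nondegenerate.exists_muBar_le_clusterMass`).

*Contraction by the local support improver.* For a clustered measure the loop picks exactly one
point in each cluster, and `ṽ` is the push-forward of `u` that moves each cluster to its point.
Let `Φ` be the maximal gap. If the gap over measures on the support of `u` is at most `Φ / 2`,
then the cluster in which `|p_u|` attains its maximum gains at least `Φ / (4 M)`, so
`φ(u, ṽ) ≥ μ̂ Φ / (4 M)`. On the other hand `‖K ṽ - K u‖ ≤ C̃ √Φ`: the chosen point is within
`√(8 R Φ / θ)` of the local maximizer by the gradient bound and quadratic growth, and the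
displacements of the atoms are summed by the Cauchy-Schwarz inequality against the defect of `u`
(`Nondegenerate.exists_lumping_bound`). Admissibility grants quadratic growth with constant
`θ / 8` only; near the `x̄^j` the curvature of `p_u` yields `θ / 4`, and the mass further out is
of the order of the residual, which the middle term of `C̃` absorbs. The descent lemma for the
step length `η̃` gives the factor `ζ` (`Nondegenerate.exists_lsi_contraction`).

*Global phase and recompute steps.* The conditional gradient step always decreases the residual by
an amount depending only on the residual (`Nondegenerate.lgcg_estimates`), so it becomes small
whenever `k` is unbounded. A recompute step happens only if the gap is less than twice the
tolerance `Ψ`, so that the residual is at most a multiple of the halved tolerance, that is, of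
`2⁻ˢ` (`IsLPDAPRun.res_recompute_le`). Since `ζ ≥ 1 / 2`, the residual is bounded by multiples of
`ζ ^ k` and of `ζ ^ s`, hence of `ζ ^ ((k + s) / 2)`, and the exponent `(k + s) / 3` leaves room
for the constant (`rate_of_recursion`).
-/

/-! ### One-dimensional Taylor estimates and the smooth part of the objective -/

/-- If `g'` grows at most linearly with slope `c`, then `g` lies below the corresponding
parabola. -/
lemma le_parabola_of_hasDerivAt {g g' : ℝ → ℝ} {c : ℝ}
    (hg : ∀ t ∈ Icc (0 : ℝ) 1, HasDerivAt g (g' t) t)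
    (hg' : ∀ t ∈ Ioo (0 : ℝ) 1, g' t ≤ g' 0 + c * t) : g 1 ≤ g 0 + g' 0 + c / 2 := by
  have hd : ∀ t ∈ Icc (0 : ℝ) 1, HasDerivAt (fun t => g t - g' 0 * t - c / 2 * t ^ 2)
      (g' t - g' 0 - c * t) t := fun t ht => by
    have := ((hg t ht).sub ((hasDerivAt_id t).const_mul (g' 0))).sub
      ((hasDerivAt_pow 2 t).const_mul (c / 2))
    exact this.congr_deriv (by norm_num; ring)
  have hanti : AntitoneOn (fun t => g t - g' 0 * t - c / 2 * t ^ 2) (Icc 0 1) := by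
    refine antitoneOn_of_deriv_nonpos (convex_Icc 0 1)
      (fun t ht => (hd t ht).continuousAt.continuousWithinAt) ?_ ?_
    · intro t ht
      rw [interior_Icc] at ht
      exact (hd t (Ioo_subset_Icc_self ht)).differentiableAt.differentiableWithinAt
    · intro t ht
      rw [interior_Icc] at ht
      rw [(hd t (Ioo_subset_Icc_self ht)).deriv]
      linarith [hg' t ht]
  have := hanti (left_mem_Icc.2 zero_le_one) (right_mem_Icc.2 zero_le_one) zero_le_one
  norm_num at this
  linarith

section Gradient

variable {Y : Type*} [NormedAddCommGroup Y] [InnerProductSpace ℝ Y] [CompleteSpace Y]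

lemma hasDerivAt_comp_segment {F : Y → ℝ} (hF : Differentiable ℝ F) (y d : Y) (t : ℝ) :
    HasDerivAt (fun t : ℝ => F (y + t • d)) ⟪gradient F (y + t • d), d⟫_ℝ t := by
  have h1 : HasDerivAt (fun t : ℝ => y + t • d) d t := by
    simpa using ((hasDerivAt_id t).smul_const d).const_add y
  have h2 := ((hF (y + t • d)).hasFDerivAt).comp_hasDerivAt t h1
  rwa [← inner_gradient_left] at h2

lemma ConvexOn.add_inner_gradient_le {F : Y → ℝ} (hc : ConvexOn ℝ univ F)
    (hF : Differentiable ℝ F) (y₁ y₂ : Y) : F y₁ + ⟪gradient F y₁, y₂ - y₁⟫_ℝ ≤ F y₂ := by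
  have hconv : ConvexOn ℝ univ (fun t : ℝ => F (y₁ + t • (y₂ - y₁))) := by
    have := hc.comp_affineMap (AffineMap.lineMap y₁ y₂ : ℝ →ᵃ[ℝ] Y)
    simpa [Function.comp_def, AffineMap.lineMap_apply, add_comm] using this
  have := hconv.le_slope_of_hasDerivAt (mem_univ 0) (mem_univ 1) zero_lt_one
    (hasDerivAt_comp_segment hF y₁ (y₂ - y₁) 0)
  simp [slope, -inner_gradient_left] at this
  linarith

/-- The descent lemma for a function with Lipschitz gradient. -/
lemma le_add_inner_gradient_add_sq {F : Y → ℝ} (hF : Differentiable ℝ F) {L : ℝ}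
    (hL : ∀ y₁ y₂, ‖gradient F y₁ - gradient F y₂‖ ≤ L * ‖y₁ - y₂‖) (y d : Y) :
    F (y + d) ≤ F y + ⟪gradient F y, d⟫_ℝ + L / 2 * ‖d‖ ^ 2 := by
  have := le_parabola_of_hasDerivAt (g := fun t : ℝ => F (y + t • d))
    (g' := fun t => ⟪gradient F (y + t • d), d⟫_ℝ) (c := L * ‖d‖ ^ 2)
    (fun t _ => hasDerivAt_comp_segment hF y d t) (fun t ht => by
      have h1 : ⟪gradient F (y + t • d) - gradient F y, d⟫_ℝ ≤ L * ‖t • d‖ * ‖d‖ := by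
        refine (real_inner_le_norm _ _).trans (mul_le_mul_of_nonneg_right ?_ (norm_nonneg _))
        simpa using hL (y + t • d) y
      rw [norm_smul, Real.norm_of_nonneg ht.1.le, inner_sub_left] at h1
      simp only [zero_smul, add_zero]
      nlinarith)
  simp [-inner_gradient_left] at this
  linarith

/-- A gradient that is strongly monotone on a ball yields quadratic growth of the Bregman distance
at its centre. -/
lemma add_sq_le_of_strongMonotone {F : Y → ℝ} (hF : Differentiable ℝ F) {γ ρ : ℝ} {y d : Y}
    (hγ : ∀ y₁ ∈ ball y ρ, ∀ y₂ ∈ ball y ρ,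
      γ * ‖y₁ - y₂‖ ^ 2 ≤ ⟪gradient F y₁ - gradient F y₂, y₁ - y₂⟫_ℝ) (hd : ‖d‖ < ρ) :
    F y + ⟪gradient F y, d⟫_ℝ + γ / 2 * ‖d‖ ^ 2 ≤ F (y + d) := by
  have := le_parabola_of_hasDerivAt (g := fun t : ℝ => -F (y + t • d))
    (g' := fun t => -⟪gradient F (y + t • d), d⟫_ℝ) (c := -(γ * ‖d‖ ^ 2))
    (fun t _ => (hasDerivAt_comp_segment hF y d t).neg) (fun t ht => by
      have hm : y + t • d ∈ ball y ρ := by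
        rw [mem_ball, dist_eq_norm, add_sub_cancel_left, norm_smul, Real.norm_of_nonneg ht.1.le]
        nlinarith [ht.2, norm_nonneg d, ht.1]
      have h1 := hγ _ hm y (mem_ball_self ((norm_nonneg d).trans_lt hd))
      rw [add_sub_cancel_left, inner_smul_right, norm_smul, Real.norm_of_nonneg ht.1.le,
        inner_sub_left] at h1
      simp only [zero_smul, add_zero]
      have h2 : γ * t * ‖d‖ ^ 2 ≤ ⟪gradient F (y + t • d), d⟫_ℝ - ⟪gradient F y, d⟫_ℝ := by
        refine le_of_mul_le_mul_left ?_ ht.1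
        linarith
      linarith)
  simp [-inner_gradient_left] at this
  linarith

/-- Small Bregman distance to a point of strong monotonicity forces norm proximity; by convexity
this is not restricted to a neighbourhood of that point. -/
lemma norm_lt_of_bregman_lt {F : Y → ℝ} (hc : ConvexOn ℝ univ F) (hF : Differentiable ℝ F)
    {γ ρ r : ℝ} {y d : Y} (hγ0 : 0 ≤ γ)
    (hγ : ∀ y₁ ∈ ball y ρ, ∀ y₂ ∈ ball y ρ,
      γ * ‖y₁ - y₂‖ ^ 2 ≤ ⟪gradient F y₁ - gradient F y₂, y₁ - y₂⟫_ℝ) (hr : 0 < r) (hrρ : r < ρ)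
    (h : F (y + d) - F y - ⟪gradient F y, d⟫_ℝ < γ / 2 * r ^ 2) : ‖d‖ < r := by
  by_contra! hrd
  have hd : 0 < ‖d‖ := hr.trans_le hrd
  set t := r / ‖d‖ with ht
  have ht0 : 0 < t := by positivity
  have ht1 : t ≤ 1 := (div_le_one hd).2 hrd
  have hn : ‖t • d‖ = r := by
    rw [norm_smul, Real.norm_of_nonneg ht0.le, ht]; field_simp
  have h1 := add_sq_le_of_strongMonotone hF hγ (d := t • d) (by rw [hn]; exact hrρ)
  have h2 := hc.2 (mem_univ y) (mem_univ (y + d)) (sub_nonneg.2 ht1) ht0.le (by ring)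
  have h3 : (1 - t) • y + t • (y + d) = y + t • d := by
    rw [smul_add, ← add_assoc, ← add_smul]; simp
  rw [h3] at h2
  rw [hn, inner_smul_right] at h1
  simp only [smul_eq_mul] at h2
  have h4 : γ / 2 * r ^ 2 ≤ t * (F (y + d) - F y - ⟪gradient F y, d⟫_ℝ) := by linarith
  have h5 : 0 ≤ γ / 2 * r ^ 2 := by positivity
  nlinarith

end Gradient

/-! ### Measures, the operator `K` and the objective -/

lemma mul_sign_eq_abs (t : ℝ) : t * Real.sign t = |t| := by
  rcases lt_trichotomy t 0 with h | rfl | h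
  · simp [Real.sign_of_neg h, abs_of_neg h]
  · simp
  · simp [Real.sign_of_pos h, abs_of_pos h]

namespace SparseProblem

variable {d : ℕ} {Y : Type*} [NormedAddCommGroup Y] [InnerProductSpace ℝ Y] [CompleteSpace Y]

section Basic

variable (P : SparseProblem d Y)

lemma differentiable_F : Differentiable ℝ P.F := P.contDiff_F.differentiable one_ne_zero

lemma convexOn_F : ConvexOn ℝ univ P.F := P.strictConvex_F.convexOn

lemma apply_pC (u v : P.Meas) : v (P.pC u) = -⟪P.K v, gradient P.F (P.K u)⟫_ℝ := by
  rw [pC, map_neg, inner_K]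

lemma K_add (u v : P.Meas) : P.K (u + v) = P.K u + P.K v := by
  simp [K, ContinuousLinearMap.add_comp]

lemma K_sub (u v : P.Meas) : P.K (u - v) = P.K u - P.K v := by
  simp [K, ContinuousLinearMap.sub_comp]

lemma K_smul (c : ℝ) (u : P.Meas) : P.K (c • u) = c • P.K u := by
  simp [K, ContinuousLinearMap.smul_comp]

lemma toMeas_apply (u : P.Sparse) (f : C(P.Ω, ℝ)) :
    P.toMeas u f = ∑ x ∈ u.support, u x * f x := by
  rw [toMeas, Finsupp.linearCombination_apply, Finsupp.sum, _root_.sum_apply]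
  rfl

lemma toMeas_apply_pC (u : P.Sparse) (v : P.Meas) :
    P.toMeas u (P.pC v) = ∑ x ∈ u.support, u x * P.p v x := by
  rw [toMeas_apply]; rfl

/-- The dual norm of a sparse measure is its total variation; the extremal test function is a
Tietze extension of the signs of the coefficients. -/
lemma norm_toMeas (u : P.Sparse) : ‖P.toMeas u‖ = ∑ x ∈ u.support, |u x| := by
  apply le_antisymm
  · refine ContinuousLinearMap.opNorm_le_bound _ (Finset.sum_nonneg fun _ _ => abs_nonneg _)
      fun f => ?_
    rw [toMeas_apply, Real.norm_eq_abs, Finset.sum_mul]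
    refine (Finset.abs_sum_le_sum_abs _ _).trans (Finset.sum_le_sum fun x _ => ?_)
    rw [abs_mul]
    exact mul_le_mul_of_nonneg_left (f.norm_coe_le_norm x) (abs_nonneg _)
  · have hfin : IsClosed (u.support : Set P.Ω) := u.support.finite_toSet.isClosed
    let s : BoundedContinuousFunction (u.support : Set P.Ω) ℝ :=
      BoundedContinuousFunction.mkOfCompact
        ⟨fun x => Real.sign (u x), continuous_of_discreteTopology⟩
    obtain ⟨g, hg, hgs⟩ := BoundedContinuousFunction.exists_norm_eq_domRestrict_eq_of_closed s hfin
    have hs : ‖s‖ ≤ 1 := by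
      refine (BoundedContinuousFunction.norm_le zero_le_one).2 fun x => ?_
      change |Real.sign (u x)| ≤ 1
      rcases Real.sign_apply_eq (u x) with h | h | h <;> simp [h]
    have hgx : ∀ x ∈ u.support, g x = Real.sign (u x) := fun x hx =>
      congrArg (fun f => f ⟨x, hx⟩) hgs
    have h1 := (P.toMeas u).le_opNorm g.toContinuousMap
    have h2 : ‖g.toContinuousMap‖ ≤ 1 := by
      refine (ContinuousMap.norm_le _ zero_le_one).2 fun x => ?_
      exact (g.norm_coe_le_norm x).trans (hg.trans_le hs)
    have h3 : P.toMeas u g.toContinuousMap = ∑ x ∈ u.support, |u x| := by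
      rw [toMeas_apply]
      refine Finset.sum_congr rfl fun x hx => ?_
      change u x * g x = _
      rw [hgx x hx, mul_sign_eq_abs]
    rw [h3] at h1
    refine (le_abs_self _).trans (h1.trans ?_)
    exact mul_le_of_le_one_right (norm_nonneg _) h2

/-- Stated for the operator norm because the `NormSMulClass` instance is not found on `P.Meas`. -/
lemma norm_smul_le (c : ℝ) (v : P.Meas) : ‖c • v‖ ≤ |c| * ‖v‖ := by
  refine ContinuousLinearMap.opNorm_le_bound _ (by positivity) fun f => ?_
  rw [smul_apply, smul_eq_mul, norm_mul, mul_assoc]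
  exact mul_le_mul_of_nonneg_left (v.le_opNorm f) (abs_nonneg c)

lemma abs_p_le_norm_pC (u : P.Meas) (x : P.Ω) : |P.p u x| ≤ ‖P.pC u‖ :=
  (P.pC u).norm_coe_le_norm x

lemma apply_le_norm_mul (u : P.Meas) (f : C(P.Ω, ℝ)) : u f ≤ ‖u‖ * ‖f‖ :=
  (le_abs_self _).trans (u.le_opNorm f)

lemma norm_K_le {C : ℝ} (hC : 0 ≤ C) (h : ∀ x ∈ P.Ω, ‖P.κ x‖ ≤ C) (u : P.Meas) :
    ‖P.K u‖ ≤ C * ‖u‖ := by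
  by_contra! hlt
  have h0 : 0 < ‖P.K u‖ := (by positivity : 0 ≤ C * ‖u‖).trans_lt hlt
  have h1 : ‖P.K u‖ ^ 2 = u (P.Kstar (P.K u)) := by
    rw [← inner_K, real_inner_self_eq_norm_sq]
  have h2 : ‖P.Kstar (P.K u)‖ ≤ C * ‖P.K u‖ := by
    refine (ContinuousMap.norm_le _ (by positivity)).2 fun x => ?_
    exact (norm_inner_le_norm (𝕜 := ℝ) _ _).trans
      (mul_le_mul_of_nonneg_right (h x x.2) (norm_nonneg _))
  have h3 := P.apply_le_norm_mul u (P.Kstar (P.K u))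
  nlinarith [norm_nonneg u, mul_le_mul_of_nonneg_left h2 (norm_nonneg u)]

lemma abs_p_sub_p_le {L C : ℝ} (hL : ∀ y₁ y₂, ‖gradient P.F y₁ - gradient P.F y₂‖ ≤ L * ‖y₁ - y₂‖)
    {x : EuclideanSpace ℝ (Fin d)} (hx : ‖P.κ x‖ ≤ C) (u v : P.Meas) :
    |P.p u x - P.p v x| ≤ C * (L * ‖P.K u - P.K v‖) := by
  have : P.p u x - P.p v x = -⟪P.κ x, gradient P.F (P.K u) - gradient P.F (P.K v)⟫_ℝ := by
    simp only [p, inner_sub_right]; ring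
  rw [this, abs_neg]
  exact (abs_real_inner_le_norm _ _).trans
    (mul_le_mul hx (hL _ _) (norm_nonneg _) ((norm_nonneg _).trans hx))

lemma exists_norm_κ_le : ∃ C, 0 < C ∧ ∀ x ∈ P.Ω, ‖P.κ x‖ ≤ C :=
  ⟨‖P.κC‖ + 1, by positivity, fun x hx =>
    (P.κC.norm_coe_le_norm ⟨x, hx⟩).trans (le_add_of_nonneg_right zero_le_one)⟩

/-- The gap at `u` bounds the decrease of the objective towards any other measure, by convexity
of `F`. -/
lemma J_sub_le_gap (u v : P.Meas) : P.J u - P.J v ≤ P.gap u v := by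
  have := P.convexOn_F.add_inner_gradient_le P.differentiable_F (P.K u) (P.K v)
  rw [J, J, gap, apply_pC, K_sub]
  rw [real_inner_comm] at this
  linarith

/-- The objective along the segment from `u` towards `v`. -/
lemma J_segment_le {L : ℝ}
    (hL : ∀ y₁ y₂, ‖gradient P.F y₁ - gradient P.F y₂‖ ≤ L * ‖y₁ - y₂‖) (u v : P.Meas)
    {η : ℝ} (h0 : 0 ≤ η) (h1 : η ≤ 1) :
    P.J ((1 - η) • u + η • v) ≤
      P.J u - η * P.gap u v + η ^ 2 * (L / 2) * ‖P.K v - P.K u‖ ^ 2 := by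
  have hd := le_add_inner_gradient_add_sq P.differentiable_F hL (P.K u) (η • (P.K v - P.K u))
  have hK : P.K ((1 - η) • u + η • v) = P.K u + η • (P.K v - P.K u) := by
    rw [K_add, K_smul, K_smul]; module
  have hn : ‖(1 - η) • u + η • v‖ ≤ (1 - η) * ‖u‖ + η * ‖v‖ := by
    have h2 := P.norm_smul_le (1 - η) u
    have h3 := P.norm_smul_le η v
    rw [abs_of_nonneg (sub_nonneg.2 h1)] at h2
    rw [abs_of_nonneg h0] at h3
    exact (norm_add_le ((1 - η) • u) (η • v)).trans (add_le_add h2 h3)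
  have hn' := mul_le_mul_of_nonneg_left hn P.α_pos.le
  rw [inner_smul_right, norm_smul, Real.norm_of_nonneg h0, real_inner_comm] at hd
  rw [J, J, gap, apply_pC, K_sub, hK]
  linarith

end Basic

section Minimizer

variable {P : SparseProblem d Y} {ubar : P.Sparse} {γ θ R' σ' : ℝ}

lemma Nondegenerate.res_eq (hP : P.Nondegenerate ubar γ θ R' σ') (u : P.Meas) :
    P.res u = P.J u - P.J (P.toMeas ubar) := by
  have : ⨅ v : P.Meas, P.J v = P.J (P.toMeas ubar) :=
    le_antisymm (ciInf_le ⟨_, by rintro _ ⟨v, rfl⟩; exact hP.isMin v⟩ _) (le_ciInf hP.isMin)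
  rw [res, this]

lemma Nondegenerate.res_nonneg (hP : P.Nondegenerate ubar γ θ R' σ') (u : P.Meas) :
    0 ≤ P.res u := by
  rw [hP.res_eq]; exact sub_nonneg.2 (hP.isMin u)

lemma Nondegenerate.res_le_gap (hP : P.Nondegenerate ubar γ θ R' σ') (u : P.Meas) :
    P.res u ≤ P.gap u (P.toMeas ubar) := by
  rw [hP.res_eq]; exact P.J_sub_le_gap _ _

/-- First order optimality of the minimizer. -/
lemma Nondegenerate.gap_nonpos (hP : P.Nondegenerate ubar γ θ R' σ') (v : P.Meas) :
    P.gap (P.toMeas ubar) v ≤ 0 := by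
  obtain ⟨L, hL0, hL⟩ := P.lipschitz_gradient_F
  by_contra! h
  set g := P.gap (P.toMeas ubar) v
  set B := L / 2 * ‖P.K v - P.K (P.toMeas ubar)‖ ^ 2 with hB
  have hB0 : 0 ≤ B := by positivity
  -- the step length minimizing the quadratic upper bound, up to constants
  set η := min 1 (g / (2 * (B + 1))) with hη
  have hη0 : 0 < η := lt_min one_pos (by positivity)
  have hη1 : η ≤ 1 := min_le_left _ _
  have hηg : η * (2 * (B + 1)) ≤ g := by
    rw [← le_div_iff₀ (by positivity)]; exact min_le_right _ _
  have h1 := P.J_segment_le hL (P.toMeas ubar) v hη0.le hη1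
  have h2 := hP.isMin ((1 - η) • P.toMeas ubar + η • v)
  have h3 : η * g ≤ η * (η * B) := by nlinarith
  have h4 := le_of_mul_le_mul_left h3 hη0
  nlinarith

/-- Optimality tested with the multiples `0` and `2 • ubar` of the minimizer. -/
lemma Nondegenerate.apply_pC_self (hP : P.Nondegenerate ubar γ θ R' σ') :
    P.toMeas ubar (P.pC (P.toMeas ubar)) = P.α * ‖P.toMeas ubar‖ := by
  have h1 := hP.gap_nonpos 0
  have h2 := hP.gap_nonpos ((2 : ℝ) • P.toMeas ubar)
  have h3 : ‖(0 : P.Meas)‖ = 0 := ContinuousLinearMap.opNorm_zero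
  have h4 := mul_le_mul_of_nonneg_left (P.norm_smul_le 2 (P.toMeas ubar)) P.α_pos.le
  rw [abs_two] at h4
  simp only [gap, sub_apply, smul_apply, zero_apply, smul_eq_mul, h3] at h1 h2
  linarith

lemma Nondegenerate.norm_pC (hP : P.Nondegenerate ubar γ θ R' σ') (h0 : ubar ≠ 0) :
    ‖P.pC (P.toMeas ubar)‖ = P.α := by
  obtain ⟨x, hx⟩ := Finsupp.support_nonempty_iff.2 h0
  have : x ∈ (ubar.support : Set P.Ω) := hx
  rw [hP.support_eq] at this
  exact this.2

lemma Nondegenerate.abs_p_support (hP : P.Nondegenerate ubar γ θ R' σ') {x : P.Ω}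
    (hx : x ∈ ubar.support) : |P.p (P.toMeas ubar) x| = P.α := by
  have : x ∈ (ubar.support : Set P.Ω) := hx
  rw [hP.support_eq] at this
  exact this.1

lemma Nondegenerate.abs_p_lt (hP : P.Nondegenerate ubar γ θ R' σ') (h0 : ubar ≠ 0) {x : P.Ω}
    (hx : x ∉ ubar.support) : |P.p (P.toMeas ubar) x| < P.α := by
  refine lt_of_le_of_ne ((P.abs_p_le_norm_pC _ x).trans_eq (hP.norm_pC h0)) fun h => hx ?_
  have : x ∈ (ubar.support : Set P.Ω) := by
    rw [hP.support_eq]; exact ⟨h, hP.norm_pC h0⟩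
  exact this

/-- The residual splits into the Bregman distance of `F` and the complementarity defect. -/
lemma Nondegenerate.res_eq_add (hP : P.Nondegenerate ubar γ θ R' σ') (u : P.Meas) :
    P.res u = (P.F (P.K u) - P.F (P.K (P.toMeas ubar)) -
        ⟪gradient P.F (P.K (P.toMeas ubar)), P.K u - P.K (P.toMeas ubar)⟫_ℝ) +
      (P.α * ‖u‖ - u (P.pC (P.toMeas ubar))) := by
  have h := hP.apply_pC_self
  rw [hP.res_eq, J, J]
  rw [apply_pC] at h ⊢
  rw [inner_sub_right, real_inner_comm (P.K u), real_inner_comm (P.K (P.toMeas ubar))]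
  linarith

lemma Nondegenerate.defect_le_res (hP : P.Nondegenerate ubar γ θ R' σ') (u : P.Meas) :
    P.α * ‖u‖ - u (P.pC (P.toMeas ubar)) ≤ P.res u := by
  have := P.convexOn_F.add_inner_gradient_le P.differentiable_F (P.K (P.toMeas ubar)) (P.K u)
  rw [hP.res_eq_add]; linarith

lemma Nondegenerate.sum_defect_le_res (hP : P.Nondegenerate ubar γ θ R' σ') (u : P.Sparse) :
    ∑ x ∈ u.support, (P.α * |u x| - u x * P.p (P.toMeas ubar) x) ≤ P.res (P.toMeas u) := by
  have := hP.defect_le_res (P.toMeas u)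
  rwa [norm_toMeas, toMeas_apply_pC, Finset.mul_sum, ← Finset.sum_sub_distrib] at this

/-- Small residuals force `K u` to be close to `K ubar`. -/
lemma Nondegenerate.exists_norm_K_sub_lt (hP : P.Nondegenerate ubar γ θ R' σ') (h0 : ubar ≠ 0)
    {ε : ℝ} (hε : 0 < ε) :
    ∃ Δ : ℝ, 0 < Δ ∧ ∀ u : P.Meas, P.res u ≤ Δ → ‖P.K u - P.K (P.toMeas ubar)‖ < ε := by
  obtain ⟨N, hN, hγ⟩ := hP.strongConvex
  obtain ⟨ρ, hρ, hball⟩ := Metric.mem_nhds_iff.1 hN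
  have hγ0 := hP.γ_pos
  set r := min ε (ρ / 2) with hr
  have hr0 : 0 < r := lt_min hε (by positivity)
  refine ⟨γ / 4 * r ^ 2, by positivity, fun u hu => ?_⟩
  refine lt_of_lt_of_le ?_ (min_le_left ε (ρ / 2))
  refine norm_lt_of_bregman_lt P.convexOn_F P.differentiable_F hγ0.le
    (fun y₁ h₁ y₂ h₂ => hγ y₁ (hball h₁) y₂ (hball h₂)) hr0
    ((min_le_right _ _).trans_lt (by linarith)) ?_
  have h1 := hP.res_eq_add u
  have h2 := P.apply_le_norm_mul u (P.pC (P.toMeas ubar))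
  rw [hP.norm_pC h0] at h2
  rw [add_sub_cancel]
  have : 0 < γ * r ^ 2 := by positivity
  linarith

/-- Small residuals force `p_u` to be uniformly close to the optimal dual variable. -/
lemma Nondegenerate.exists_abs_p_sub_lt (hP : P.Nondegenerate ubar γ θ R' σ') (h0 : ubar ≠ 0)
    {ε : ℝ} (hε : 0 < ε) :
    ∃ Δ : ℝ, 0 < Δ ∧ ∀ u : P.Meas, P.res u ≤ Δ → ∀ x ∈ P.Ω,
      |P.p u x - P.p (P.toMeas ubar) x| < ε := by
  obtain ⟨L, hL0, hL⟩ := P.lipschitz_gradient_F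
  obtain ⟨C, hC0, hC⟩ := P.exists_norm_κ_le
  obtain ⟨Δ, hΔ, h⟩ := hP.exists_norm_K_sub_lt h0 (ε := ε / (C * L)) (by positivity)
  refine ⟨Δ, hΔ, fun u hu x hx => (P.abs_p_sub_p_le hL (hC x hx) _ _).trans_lt ?_⟩
  have := h u hu
  rw [lt_div_iff₀ (by positivity)] at this
  linarith

lemma Nondegenerate.defect_nonneg (hP : P.Nondegenerate ubar γ θ R' σ') (h0 : ubar ≠ 0)
    (x : P.Ω) (a : ℝ) : 0 ≤ P.α * |a| - a * P.p (P.toMeas ubar) x := by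
  have h1 := (P.abs_p_le_norm_pC (P.toMeas ubar) x).trans_eq (hP.norm_pC h0)
  have h2 := le_abs_self (a * P.p (P.toMeas ubar) x)
  rw [abs_mul] at h2
  nlinarith [abs_nonneg a]

/-- The complementarity defect of the minimizer vanishes atom by atom. -/
lemma Nondegenerate.sign_p (hP : P.Nondegenerate ubar γ θ R' σ') (h0 : ubar ≠ 0) {x : P.Ω}
    (hx : x ∈ ubar.support) : Real.sign (P.p (P.toMeas ubar) x) = Real.sign (ubar x) := by
  have h1 := hP.sum_defect_le_res ubar
  have h2 : P.res (P.toMeas ubar) = 0 := by rw [hP.res_eq, sub_self]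
  have h3 := (Finset.single_le_sum (fun z _ => hP.defect_nonneg h0 z (ubar z)) hx).trans
    (h1.trans_eq h2)
  have h4 : 0 < |ubar x| := abs_pos.2 (Finsupp.mem_support_iff.1 hx)
  have h5 : 0 < ubar x * P.p (P.toMeas ubar) x := by nlinarith [P.α_pos]
  rcases pos_and_pos_or_neg_and_neg_of_mul_pos h5 with ⟨ha, hb⟩ | ⟨ha, hb⟩
  · rw [Real.sign_of_pos ha, Real.sign_of_pos hb]
  · rw [Real.sign_of_neg ha, Real.sign_of_neg hb]

end Minimizer

end SparseProblem

/-! ### Existence of admissible radii -/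

/-- Second order Taylor estimate on a ball for a function whose signed Hessian `s • D²f` is bounded
above by `-m`. -/
lemma mul_le_taylor_of_hessian_le {E : Type*} [NormedAddCommGroup E] [NormedSpace ℝ E]
    {f : E → ℝ} {c x y : E} {r m s : ℝ} (hf : ∀ x ∈ ball c r, ContDiffAt ℝ 2 f x)
    (hm : ∀ x ∈ ball c r, ∀ h : E, m * ‖h‖ ^ 2 ≤ -s * fderiv ℝ (fderiv ℝ f) x h h)
    (hx : x ∈ ball c r) (hy : y ∈ ball c r) :
    s * f y ≤ s * f x + s * fderiv ℝ f x (y - x) - m / 2 * ‖y - x‖ ^ 2 := by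
  set v := y - x with hv
  have hmem : ∀ t ∈ Icc (0 : ℝ) 1, x + t • v ∈ ball c r := fun t ht =>
    (convex_ball c r).add_smul_sub_mem hx hy ht
  have hline : ∀ t : ℝ, HasDerivAt (fun t : ℝ => x + t • v) v t := fun t => by
    simpa using ((hasDerivAt_id t).smul_const v).const_add x
  have hg : ∀ t ∈ Icc (0 : ℝ) 1, HasDerivAt (fun t : ℝ => s * f (x + t • v))
      (s * fderiv ℝ f (x + t • v) v) t := fun t ht => by
    have h1 := ((hf _ (hmem t ht)).differentiableAt two_ne_zero).hasFDerivAt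
    exact (h1.comp_hasDerivAt t (hline t)).const_mul s
  have hg' : ∀ t ∈ Icc (0 : ℝ) 1, HasDerivAt (fun t : ℝ => s * fderiv ℝ f (x + t • v) v)
      (s * fderiv ℝ (fderiv ℝ f) (x + t • v) v v) t := fun t ht => by
    have h1 : DifferentiableAt ℝ (fderiv ℝ f) (x + t • v) :=
      ((hf _ (hmem t ht)).fderiv_right (m := 1) (by norm_num)).differentiableAt one_ne_zero
    have h2 := h1.hasFDerivAt.comp_hasDerivAt t (hline t)
    exact (h2.clm_apply (hasDerivAt_const t v)).const_mul s |>.congr_deriv (by simp)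
  have hanti : AntitoneOn (fun t : ℝ => s * fderiv ℝ f (x + t • v) v + m * ‖v‖ ^ 2 * t)
      (Icc 0 1) := by
    have hd : ∀ t ∈ Icc (0 : ℝ) 1, HasDerivAt
        (fun t : ℝ => s * fderiv ℝ f (x + t • v) v + m * ‖v‖ ^ 2 * t)
        (s * fderiv ℝ (fderiv ℝ f) (x + t • v) v v + m * ‖v‖ ^ 2 * 1) t := fun t ht =>
      (hg' t ht).add ((hasDerivAt_id t).const_mul _)
    refine antitoneOn_of_deriv_nonpos (convex_Icc 0 1)
      (fun t ht => (hd t ht).continuousAt.continuousWithinAt) ?_ ?_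
    · intro t ht
      rw [interior_Icc] at ht
      exact (hd t (Ioo_subset_Icc_self ht)).differentiableAt.differentiableWithinAt
    · intro t ht
      rw [interior_Icc] at ht
      rw [(hd t (Ioo_subset_Icc_self ht)).deriv]
      linarith [hm _ (hmem t (Ioo_subset_Icc_self ht)) v]
  have := le_parabola_of_hasDerivAt (c := -(m * ‖v‖ ^ 2)) hg fun t ht => by
    have := hanti (left_mem_Icc.2 zero_le_one) (Ioo_subset_Icc_self ht) ht.1.le
    simp only [mul_zero, add_zero] at this
    linarith
  simp only [one_smul, zero_smul, add_zero, hv, add_sub_cancel] at this ⊢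
  linarith

section Perturbation

variable {E Y : Type*} [NormedAddCommGroup E] [NormedSpace ℝ E] [NormedAddCommGroup Y]
  [InnerProductSpace ℝ Y]

lemma abs_inner_bilin_sub_le (A B : E →L[ℝ] E →L[ℝ] Y) (g g₀ : Y) (h : E) :
    |⟪A h h, g⟫_ℝ - ⟪B h h, g₀⟫_ℝ| ≤ (‖A - B‖ * ‖g‖ + ‖B‖ * ‖g - g₀‖) * ‖h‖ ^ 2 := by
  have hdiff : ⟪A h h, g⟫_ℝ - ⟪B h h, g₀⟫_ℝ = ⟪(A - B) h h, g⟫_ℝ + ⟪B h h, g - g₀⟫_ℝ := by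
    simp only [sub_apply, inner_sub_left, inner_sub_right]; ring
  have hb1 : |⟪(A - B) h h, g⟫_ℝ| ≤ ‖A - B‖ * ‖h‖ * ‖h‖ * ‖g‖ :=
    (abs_real_inner_le_norm _ _).trans
      (mul_le_mul_of_nonneg_right ((A - B).le_opNorm₂ h h) (norm_nonneg g))
  have hb2 : |⟪B h h, g - g₀⟫_ℝ| ≤ ‖B‖ * ‖h‖ * ‖h‖ * ‖g - g₀‖ :=
    (abs_real_inner_le_norm _ _).trans
      (mul_le_mul_of_nonneg_right (B.le_opNorm₂ h h) (norm_nonneg _))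
  rw [hdiff]
  refine (abs_add_le _ _).trans ((add_le_add hb1 hb2).trans_eq ?_)
  ring

lemma eventually_perturbation_lt {E G Y : Type*} [NormedAddCommGroup E]
    [NormedAddCommGroup G] [NormedAddCommGroup Y] {D : E → G} {c : E} (hD : ContinuousAt D c)
    (g₀ : Y) {ε : ℝ} (hε : 0 < ε) :
    ∀ᶠ z : E × Y in 𝓝 (c, g₀), ‖D z.1 - D c‖ * ‖z.2‖ + ‖D c‖ * ‖z.2 - g₀‖ < ε := by
  have h1 : Tendsto (fun z : E × Y => D z.1) (𝓝 (c, g₀)) (𝓝 (D c)) :=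
    hD.tendsto.comp continuousAt_fst
  have h2 : Tendsto (fun z : E × Y => z.2) (𝓝 (c, g₀)) (𝓝 g₀) := continuousAt_snd
  have h3 := ((tendsto_iff_norm_sub_tendsto_zero.1 h1).mul h2.norm).add
    ((h2.sub_const g₀).norm.const_mul ‖D c‖)
  refine h3.eventually_lt_const ?_
  simpa using hε

lemma eventually_abs_inner_sub_lt {E Y : Type*} [NormedAddCommGroup E] [NormedAddCommGroup Y]
    [InnerProductSpace ℝ Y] {κ : E → Y} {c : E} (hκ : ContinuousAt κ c)
    (g₀ : Y) {ε : ℝ} (hε : 0 < ε) :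
    ∀ᶠ z : E × Y in 𝓝 (c, g₀), |⟪κ z.1, z.2⟫_ℝ - ⟪κ c, g₀⟫_ℝ| < ε := by
  have h1 : Tendsto (fun z : E × Y => κ z.1) (𝓝 (c, g₀)) (𝓝 (κ c)) :=
    hκ.tendsto.comp continuousAt_fst
  have h2 : Tendsto (fun z : E × Y => z.2) (𝓝 (c, g₀)) (𝓝 g₀) := continuousAt_snd
  have h3 := ((h1.inner h2 (𝕜 := ℝ)).sub_const ⟪κ c, g₀⟫_ℝ).abs
  refine h3.eventually_lt_const ?_
  simpa using hε

end Perturbation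

lemma abs_eq_sign_mul (t : ℝ) : |t| = Real.sign t * t := by rw [mul_comm, mul_sign_eq_abs]

namespace SparseProblem

variable {d : ℕ} {Y : Type*} [NormedAddCommGroup Y] [InnerProductSpace ℝ Y] [CompleteSpace Y]
  {P : SparseProblem d Y} {ubar : P.Sparse} {γ θ R' σ' : ℝ}

lemma mem_nbhd {r : ℝ} {x : EuclideanSpace ℝ (Fin d)} :
    x ∈ P.nbhd ubar r ↔ ∃ c ∈ ubar.support, x ∈ ball (c : EuclideanSpace ℝ (Fin d)) r := by
  simp [nbhd]

lemma isOpen_nbhd (r : ℝ) : IsOpen (P.nbhd ubar r) :=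
  isOpen_biUnion fun _ _ => isOpen_ball

lemma Nondegenerate.mem_Ω (hP : P.Nondegenerate ubar γ θ R' σ') {x : EuclideanSpace ℝ (Fin d)}
    (hx : x ∈ P.nbhd ubar R') : x ∈ P.Ω := interior_subset (hP.nbhd_subset hx)

lemma Nondegenerate.contDiffAt_κ (hP : P.Nondegenerate ubar γ θ R' σ')
    {x : EuclideanSpace ℝ (Fin d)} (hx : x ∈ P.nbhd ubar R') : ContDiffAt ℝ 2 P.κ x :=
  hP.contDiff_κ.1.contDiffAt ((isOpen_nbhd R').mem_nhds hx)

lemma Nondegenerate.contDiffAt_p (hP : P.Nondegenerate ubar γ θ R' σ') (u : P.Meas)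
    {x : EuclideanSpace ℝ (Fin d)} (hx : x ∈ P.nbhd ubar R') : ContDiffAt ℝ 2 (P.p u) x :=
  ((hP.contDiffAt_κ hx).inner ℝ contDiffAt_const).neg

lemma Nondegenerate.fderiv_fderiv_p (hP : P.Nondegenerate ubar γ θ R' σ') (u : P.Meas)
    {x : EuclideanSpace ℝ (Fin d)} (hx : x ∈ P.nbhd ubar R') (h k : EuclideanSpace ℝ (Fin d)) :
    fderiv ℝ (fderiv ℝ (P.p u)) x h k =
      -⟪fderiv ℝ (fderiv ℝ P.κ) x h k, gradient P.F (P.K u)⟫_ℝ := by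
  set ℓ : Y →L[ℝ] ℝ := -(innerSL ℝ (gradient P.F (P.K u))) with hℓ
  have hp : P.p u = fun y => ℓ (P.κ y) := by
    ext y; simp [p, hℓ, real_inner_comm, -inner_gradient_left, -inner_gradient_right]
  have h1 : fderiv ℝ (P.p u) =ᶠ[𝓝 x] fun y => ℓ.comp (fderiv ℝ P.κ y) := by
    filter_upwards [(isOpen_nbhd R').mem_nhds hx] with y hy
    rw [hp]
    exact ℓ.hasFDerivAt.comp y
      ((hP.contDiffAt_κ hy).differentiableAt two_ne_zero).hasFDerivAt |>.fderiv
  have h2 : DifferentiableAt ℝ (fderiv ℝ P.κ) x :=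
    ((hP.contDiffAt_κ hx).fderiv_right (m := 1) (by norm_num)).differentiableAt one_ne_zero
  rw [h1.fderiv_eq]
  have h3 := (((ContinuousLinearMap.compL ℝ (EuclideanSpace ℝ (Fin d)) Y ℝ) ℓ).hasFDerivAt.comp x
    h2.hasFDerivAt).fderiv
  have h4 : fderiv ℝ (fun y => ℓ.comp (fderiv ℝ P.κ y)) x = _ := h3
  rw [h4]
  simp [hℓ, real_inner_comm, -inner_gradient_left, -inner_gradient_right]

/-- Near the support points, all dual variables with `K u` near `K ubar` have the sign of the
optimal one and half of its curvature. -/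
lemma Nondegenerate.exists_curvature (hP : P.Nondegenerate ubar γ θ R' σ') {c : P.Ω}
    (hc : c ∈ ubar.support) :
    ∃ ε : ℝ, 0 < ε ∧ ∀ x ∈ ball (c : EuclideanSpace ℝ (Fin d)) ε, ∀ u : P.Meas,
      ‖P.K u - P.K (P.toMeas ubar)‖ < ε →
      Real.sign (P.p u x) = Real.sign (P.p (P.toMeas ubar) c) ∧
      ∀ h : EuclideanSpace ℝ (Fin d),
        θ / 2 * ‖h‖ ^ 2 ≤ -(Real.sign (P.p u x)) * fderiv ℝ (fderiv ℝ (P.p u)) x h h := by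
  obtain ⟨L, hL0, hL⟩ := P.lipschitz_gradient_F
  set g0 := gradient P.F (P.K (P.toMeas ubar)) with hg0
  have hcn : (c : EuclideanSpace ℝ (Fin d)) ∈ P.nbhd ubar R' :=
    mem_nbhd.2 ⟨c, hc, mem_ball_self hP.R'_pos⟩
  set D := fderiv ℝ (fderiv ℝ P.κ) with hD
  have hDc : ContinuousAt D c :=
    (((hP.contDiffAt_κ hcn).fderiv_right (m := 1) (by norm_num)).fderiv_right (m := 0)
      (by norm_num)).continuousAt
  have hκc : ContinuousAt P.κ c := (hP.contDiffAt_κ hcn).continuousAt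
  have hθ := hP.θ_pos
  have hQ := eventually_perturbation_lt (E := EuclideanSpace ℝ (Fin d))
    (G := EuclideanSpace ℝ (Fin d) →L[ℝ] EuclideanSpace ℝ (Fin d) →L[ℝ] Y) hDc g0 (half_pos hθ)
  have hS := eventually_abs_inner_sub_lt hκc g0 P.α_pos
  obtain ⟨ε, hε, hball⟩ := Metric.eventually_nhds_iff.1 (hQ.and hS)
  refine ⟨min (min ε R') (ε / L), lt_min (lt_min hε hP.R'_pos) (by positivity),
    fun x hx u hu => ?_⟩
  have hxε : dist x c < ε := (mem_ball.1 hx).trans_le ((min_le_left _ _).trans (min_le_left _ _))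
  have hxR : x ∈ P.nbhd ubar R' := mem_nbhd.2 ⟨c, hc,
    (mem_ball.1 hx).trans_le ((min_le_left _ _).trans (min_le_right _ _))⟩
  have hgε : dist (gradient P.F (P.K u)) g0 < ε := by
    rw [dist_eq_norm]
    refine (hL _ _).trans_lt ?_
    have := hu.trans_le (min_le_right _ _)
    rwa [lt_div_iff₀ hL0, mul_comm] at this
  obtain ⟨hQx, hSx⟩ := hball (y := (x, gradient P.F (P.K u)))
    (by rw [Prod.dist_eq]; exact max_lt hxε hgε)
  have hα := hP.abs_p_support hc
  have hsign : Real.sign (P.p u x) = Real.sign (P.p (P.toMeas ubar) c) := by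
    have hSx' : |P.p u x - P.p (P.toMeas ubar) c| < P.α := by
      rw [← abs_neg] at hSx
      convert hSx using 2
      simp only [p, g0]; ring
    rw [abs_lt] at hSx'
    rcases le_total 0 (P.p (P.toMeas ubar) c) with h | h
    · rw [abs_of_nonneg h] at hα
      rw [Real.sign_of_pos (by linarith), Real.sign_of_pos (by linarith [P.α_pos])]
    · rw [abs_of_nonpos h] at hα
      rw [Real.sign_of_neg (by linarith), Real.sign_of_neg (by linarith [P.α_pos])]
  refine ⟨hsign, fun h => ?_⟩
  have hcurv := hP.curvature c hc h
  rw [hsign]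
  rw [hP.fderiv_fderiv_p _ hcn, ← hD, ← hg0] at hcurv
  rw [hP.fderiv_fderiv_p _ hxR, ← hD]
  set g := gradient P.F (P.K u)
  set s := Real.sign (P.p (P.toMeas ubar) c)
  have hs : |s| ≤ 1 := by
    rcases Real.sign_apply_eq (P.p (P.toMeas ubar) c) with h | h | h <;> simp [s, h]
  have hb3 : |⟪D x h h, g⟫_ℝ - ⟪D c h h, g0⟫_ℝ| ≤ θ / 2 * ‖h‖ ^ 2 :=
    (abs_inner_bilin_sub_le (D x) (D c) g g0 h).trans
      (mul_le_mul_of_nonneg_right hQx.le (sq_nonneg _))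
  have hb4 : |s * (⟪D x h h, g⟫_ℝ - ⟪D c h h, g0⟫_ℝ)| ≤ θ / 2 * ‖h‖ ^ 2 := by
    rw [abs_mul]
    exact (mul_le_of_le_one_left (abs_nonneg _) hs).trans hb3
  have := (abs_le.1 hb4).1
  nlinarith

lemma Nondegenerate.notMem_nbhd_of_sphere (hP : P.Nondegenerate ubar γ θ R' σ') {R : ℝ}
    (hR0 : 0 < R) (hR : R < R') {c : P.Ω} (hc : c ∈ ubar.support) {x : EuclideanSpace ℝ (Fin d)}
    (h1 : R ≤ dist x c) (h2 : dist x c < 2 * R') : x ∉ P.nbhd ubar R := by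
  intro h
  obtain ⟨c', hc', hx⟩ := mem_nbhd.1 h
  by_cases hcc : c = c'
  · subst hcc
    exact absurd (mem_ball.1 hx) (not_lt.2 h1)
  · exact Set.disjoint_left.1 (hP.disjoint_balls c hc c' hc' hcc) (mem_ball.2 h2)
      (ball_subset_ball (by linarith) hx)

/-- Away from its maximizers the optimal dual variable stays strictly below `α`, by compactness. -/
lemma Nondegenerate.exists_σ (hP : P.Nondegenerate ubar γ θ R' σ') (h0 : ubar ≠ 0) {R : ℝ}
    (hR0 : 0 < R) :
    ∃ σ : ℝ, 0 < σ ∧ σ ≤ σ' ∧ ∀ x ∈ P.Ω, x ∉ P.nbhd ubar R →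
      |P.p (P.toMeas ubar) x| ≤ P.α - σ := by
  set S : Set P.Ω := {x | (x : EuclideanSpace ℝ (Fin d)) ∉ P.nbhd ubar R} with hS
  have hSc : IsCompact S :=
    ((isOpen_nbhd R).isClosed_compl.preimage continuous_subtype_val).isCompact
  rcases S.eq_empty_or_nonempty with he | hne
  · exact ⟨σ', hP.σ'_pos, le_rfl, fun x hx hxn =>
      absurd (show (⟨x, hx⟩ : P.Ω) ∈ S from hxn) (by simp [he])⟩
  · obtain ⟨z, hz, hmax⟩ := hSc.exists_isMaxOn hne
      ((P.pC (P.toMeas ubar)).continuous.abs.continuousOn)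
    have hzs : z ∉ ubar.support := fun h => hz (mem_nbhd.2 ⟨z, h, mem_ball_self hR0⟩)
    have hlt := hP.abs_p_lt h0 hzs
    refine ⟨min σ' (P.α - |P.p (P.toMeas ubar) z|), lt_min hP.σ'_pos (by linarith),
      min_le_left _ _, fun x hx hxn => ?_⟩
    have h1 : |P.p (P.toMeas ubar) x| ≤ |P.p (P.toMeas ubar) z| :=
      hmax (show (⟨x, hx⟩ : P.Ω) ∈ S from hxn)
    have h2 := min_le_right σ' (P.α - |P.p (P.toMeas ubar) z|)
    linarith

/-- All sufficiently small radii are admissible, even with the curvature constant `2 * θ` in place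
of `θ`; the stronger constant is what the contraction estimate uses close to the support points. -/
lemma Nondegenerate.exists_admissibleRadius (hP : P.Nondegenerate ubar γ θ R' σ')
    (h0 : ubar ≠ 0) :
    ∃ Rt : ℝ, 0 < Rt ∧ Rt ≤ R' ∧ ∀ R : ℝ, 0 < R → R < Rt →
      ∃ σ : ℝ, 0 < σ ∧ σ ≤ σ' ∧ P.AdmissibleRadius ubar (2 * θ) R σ := by
  have hθ := hP.θ_pos
  have hex : ∃ ε : ℝ, 0 < ε ∧ ∀ c ∈ ubar.support,
      ∀ x ∈ ball (c : EuclideanSpace ℝ (Fin d)) ε, ∀ u : P.Meas,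
      ‖P.K u - P.K (P.toMeas ubar)‖ < ε →
      Real.sign (P.p u x) = Real.sign (P.p (P.toMeas ubar) c) ∧
      ∀ h : EuclideanSpace ℝ (Fin d),
        θ / 2 * ‖h‖ ^ 2 ≤ -(Real.sign (P.p u x)) * fderiv ℝ (fderiv ℝ (P.p u)) x h h := by
    have : ∀ᶠ ε in 𝓝[>] (0 : ℝ), ∀ c ∈ ubar.support,
        ∀ x ∈ ball (c : EuclideanSpace ℝ (Fin d)) ε, ∀ u : P.Meas,
        ‖P.K u - P.K (P.toMeas ubar)‖ < ε →
        Real.sign (P.p u x) = Real.sign (P.p (P.toMeas ubar) c) ∧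
        ∀ h : EuclideanSpace ℝ (Fin d),
          θ / 2 * ‖h‖ ^ 2 ≤ -(Real.sign (P.p u x)) * fderiv ℝ (fderiv ℝ (P.p u)) x h h := by
      rw [Finset.eventually_all]
      intro c hc
      obtain ⟨ε, hε, h⟩ := hP.exists_curvature hc
      filter_upwards [Ioc_mem_nhdsGT hε] with ε' hε' x hx u hu
      exact h x (ball_subset_ball hε'.2 hx) u (hu.trans_le hε'.2)
    obtain ⟨ε, h1, h2⟩ := (this.and self_mem_nhdsWithin).exists
    exact ⟨ε, h2, h1⟩
  obtain ⟨ε, hε, hcurv⟩ := hex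
  refine ⟨min ε R', lt_min hε hP.R'_pos, min_le_right _ _, fun R hR0 hR => ?_⟩
  have hRε : R < ε := hR.trans_le (min_le_left _ _)
  have hRR' : R < R' := hR.trans_le (min_le_right _ _)
  obtain ⟨σ, hσ0, hσ1, hσ⟩ := hP.exists_σ h0 hR0
  obtain ⟨Δ₁, hΔ₁, hK⟩ := hP.exists_norm_K_sub_lt h0 hε
  obtain ⟨Δ₂, hΔ₂, hp⟩ := hP.exists_abs_p_sub_lt h0 (ε := σ / 4) (by positivity)
  have hoff : ∀ u : P.Meas, P.res u ≤ Δ₂ → ∀ x ∈ P.Ω, x ∉ P.nbhd ubar R →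
      |P.p u x| ≤ P.α - 3 * σ / 4 := by
    intro u hu x hx hxn
    have h1 := hσ x hx hxn
    have h2 := hp u hu x hx
    have h3 := abs_sub_abs_le_abs_sub (P.p u x) (P.p (P.toMeas ubar) x)
    linarith
  refine ⟨σ, hσ0, hσ1, min Δ₁ Δ₂, lt_min hΔ₁ hΔ₂, fun u hu => ⟨fun c hc => ?_, fun x hx => ?_⟩⟩
  · have hu1 := hK u (hu.trans (min_le_left _ _))
    have hu2 := hu.trans (min_le_right _ _)
    have hcur : ∀ x ∈ ball (c : EuclideanSpace ℝ (Fin d)) R, _ := fun x hx =>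
      hcurv c hc x (ball_subset_ball hRε.le hx) u hu1
    have hΩ' : ∀ x ∈ closedBall (c : EuclideanSpace ℝ (Fin d)) R, x ∈ P.nbhd ubar R' :=
      fun x hx => mem_nbhd.2 ⟨c, hc, closedBall_subset_ball hRR' hx⟩
    set s := Real.sign (P.p (P.toMeas ubar) c) with hs
    have hs1 : s = -1 ∨ s = 1 := Real.sign_apply_eq_of_ne_zero _
      (abs_pos.1 (by rw [hP.abs_p_support hc]; exact P.α_pos))
    have habs : ∀ x ∈ ball (c : EuclideanSpace ℝ (Fin d)) R, |P.p u x| = s * P.p u x :=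
      fun x hx => by rw [abs_eq_sign_mul, (hcur x hx).1]
    have htaylor : ∀ x ∈ ball (c : EuclideanSpace ℝ (Fin d)) R,
        ∀ y ∈ ball (c : EuclideanSpace ℝ (Fin d)) R,
        |P.p u y| ≤ |P.p u x| + s * fderiv ℝ (P.p u) x (y - x) - θ / 2 / 2 * ‖y - x‖ ^ 2 := by
      intro x hx y hy
      rw [habs x hx, habs y hy]
      refine mul_le_taylor_of_hessian_le
        (fun z hz => hP.contDiffAt_p u (hΩ' z (ball_subset_closedBall hz))) (fun z hz h => ?_) hx hy
      have := (hcur z hz).2 h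
      rwa [(hcur z hz).1] at this
    -- local maximizers are critical points of `p_u`, and by `htaylor` there is only one
    have hcrit : ∀ x ∈ ball (c : EuclideanSpace ℝ (Fin d)) R,
        IsLocalMax (fun x => |P.p u x|) x → fderiv ℝ (P.p u) x = 0 := by
      intro x hx hmax
      have heq : (fun x => |P.p u x|) =ᶠ[𝓝 x] fun x => s * P.p u x := by
        filter_upwards [isOpen_ball.mem_nhds hx] with y hy using habs y hy
      have h1 : IsLocalMax (fun x => s * P.p u x) x := hmax.congr heq
      have h2 := h1.fderiv_eq_zero
      rw [fderiv_const_mul ((hP.contDiffAt_p u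
        (hΩ' x (ball_subset_closedBall hx))).differentiableAt two_ne_zero)] at h2
      rcases smul_eq_zero.1 h2 with h | h
      · rcases hs1 with h' | h' <;> simp [h'] at h
      · exact h
    obtain ⟨xh, hxh, hmax⟩ := (isCompact_closedBall (c : EuclideanSpace ℝ (Fin d)) R).exists_isMaxOn
      ⟨c, mem_closedBall_self hR0.le⟩ (f := fun x => |P.p u x|)
      (fun x hx => (hP.contDiffAt_p u (hΩ' x hx)).continuousAt.abs.continuousWithinAt)
    -- on the sphere `|p_u|` is smaller than at the centre
    have hxhb : xh ∈ ball (c : EuclideanSpace ℝ (Fin d)) R := by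
      by_contra hnot
      have hxhn := hP.notMem_nbhd_of_sphere hR0 hRR' hc (x := xh)
        (by simpa using hnot) (by have := mem_closedBall.1 hxh; linarith [hP.R'_pos])
      have h1 := hoff u hu2 xh (hP.mem_Ω (hΩ' xh hxh)) hxhn
      have h2 : |P.p u c| ≤ |P.p u xh| := hmax (mem_closedBall_self hR0.le)
      have h3 := hp u hu2 c c.2
      have h4 := abs_sub_abs_le_abs_sub (P.p (P.toMeas ubar) c) (P.p u c)
      rw [abs_sub_comm, hP.abs_p_support hc] at h4
      linarith
    have hlocmax : IsLocalMax (fun x => |P.p u x|) xh := by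
      filter_upwards [isOpen_ball.mem_nhds hxhb] with y hy
      exact hmax (ball_subset_closedBall hy)
    have hD0 := hcrit xh hxhb hlocmax
    refine ⟨fun x hx => ⟨(hcur x hx).1, (hcur x hx).1.trans (hP.sign_p h0 hc)⟩,
      ⟨xh, hxhb, hlocmax, fun x hx hx' => ?_, fun x hx => ?_, fun x hx => ?_⟩,
      fun x hx h => ?_⟩
    · have h1 := htaylor xh hxhb x hx
      have h2 := htaylor x hx xh hxhb
      rw [hD0] at h1
      rw [hcrit x hx hx', ← neg_sub x xh, norm_neg] at h2
      simp only [zero_apply, mul_zero, add_zero] at h1 h2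
      have h3 : θ * ‖x - xh‖ ^ 2 ≤ 0 := by linarith
      have h4 : ‖x - xh‖ ^ 2 ≤ 0 := by
        by_contra! h4
        exact absurd h3 (not_le.2 (by positivity))
      exact sub_eq_zero.1 (norm_eq_zero.1 (pow_eq_zero_iff two_ne_zero |>.1
        (le_antisymm h4 (sq_nonneg _))))
    · have h1 := htaylor x hx xh hxhb
      rw [← inner_gradient_left] at h1
      have h2 : s * ⟪gradient (P.p u) x, xh - x⟫_ℝ ≤ ‖gradient (P.p u) x‖ * ‖xh - x‖ := by
        refine le_trans ?_ (abs_real_inner_le_norm (gradient (P.p u) x) (xh - x))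
        rcases hs1 with h' | h' <;> rw [h']
        · rw [neg_one_mul]; exact neg_le_abs _
        · rw [one_mul]; exact le_abs_self _
      have h3 : ‖xh - x‖ ≤ 2 * R := by
        rw [← dist_eq_norm]
        have := dist_triangle_right xh x c
        have := mem_ball.1 hx
        have := mem_ball.1 hxhb
        linarith
      have h4 := mul_le_mul_of_nonneg_left h3 (norm_nonneg (gradient (P.p u) x))
      have h5 : 0 ≤ θ / 2 / 2 * ‖xh - x‖ ^ 2 := by positivity
      linarith
    · have h1 := htaylor xh hxhb x hx
      rw [hD0, ← neg_sub xh x, norm_neg] at h1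
      simp only [zero_apply, mul_zero, add_zero] at h1
      linarith
    · have := (hcur x hx).2 h
      linarith
  · have := hoff u (hu.trans (min_le_right _ _)) x hx.1 (fun h => hx.2 (subset_closure h))
    linarith

lemma AdmissibleRadius.of_two_mul {R σ : ℝ} (hθ : 0 < θ)
    (h : P.AdmissibleRadius ubar (2 * θ) R σ) : P.AdmissibleRadius ubar θ R σ := by
  obtain ⟨Δ, hΔ, h⟩ := h
  refine ⟨Δ, hΔ, fun u hu => ⟨fun c hc => ?_, (h u hu).2⟩⟩
  obtain ⟨h1, ⟨xh, hxh, h2, h3, h4, h5⟩, h6⟩ := (h u hu).1 c hc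
  refine ⟨h1, ⟨xh, hxh, h2, h3, h4, fun x hx => (h5 x hx).trans' ?_⟩,
    fun x hx k => (h6 x hx k).trans' ?_⟩ <;> gcongr <;> linarith

end SparseProblem

/-! ### Sparse measures of small residual -/

namespace SparseProblem

variable {d : ℕ} {Y : Type*} [NormedAddCommGroup Y] [InnerProductSpace ℝ Y] [CompleteSpace Y]
  {P : SparseProblem d Y} {ubar : P.Sparse} {γ θ R' σ' : ℝ}

lemma norm_toMeas_of_subset {u : P.Sparse} {s : Finset P.Ω} (h : u.support ⊆ s) :
    ‖P.toMeas u‖ = ∑ x ∈ s, |u x| := by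
  rw [norm_toMeas]
  exact Finset.sum_subset h fun x _ hx => by simp [Finsupp.notMem_support_iff.1 hx]

lemma toMeas_apply_pC_of_subset {u : P.Sparse} {s : Finset P.Ω} (h : u.support ⊆ s)
    (v : P.Meas) : P.toMeas u (P.pC v) = ∑ x ∈ s, u x * P.p v x := by
  rw [toMeas_apply_pC]
  exact Finset.sum_subset h fun x _ hx => by simp [Finsupp.notMem_support_iff.1 hx]

/-- The properties that admissibility grants to a single measure, with the bound away from the
support points extended from the complement of the closure to the complement of `Ω_R`. -/
structure Regular (P : SparseProblem d Y) (ubar : P.Sparse) (θ R σ : ℝ) (u : P.Meas) : Prop where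
  sign_eq : ∀ c ∈ ubar.support, ∀ x ∈ ball (c : EuclideanSpace ℝ (Fin d)) R,
    Real.sign (P.p u x) = Real.sign (ubar c)
  exists_max : ∀ c ∈ ubar.support, ∃ xh ∈ ball (c : EuclideanSpace ℝ (Fin d)) R,
    IsLocalMax (fun x => |P.p u x|) xh ∧
    (∀ x ∈ ball (c : EuclideanSpace ℝ (Fin d)) R, IsLocalMax (fun x => |P.p u x|) x → x = xh) ∧
    (∀ x ∈ ball (c : EuclideanSpace ℝ (Fin d)) R,
      |P.p u xh| - |P.p u x| ≤ 2 * R * ‖gradient (P.p u) x‖) ∧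
    (∀ x ∈ ball (c : EuclideanSpace ℝ (Fin d)) R,
      θ / 8 * ‖xh - x‖ ^ 2 ≤ |P.p u xh| - |P.p u x|)
  off : ∀ x ∈ P.Ω, x ∉ P.nbhd ubar R → |P.p u x| ≤ P.α - σ / 2

lemma closure_nbhd_subset {r : ℝ} {x : EuclideanSpace ℝ (Fin d)}
    (hx : x ∈ closure (P.nbhd ubar r)) :
    ∃ c ∈ ubar.support, x ∈ closedBall (c : EuclideanSpace ℝ (Fin d)) r := by
  rw [nbhd, Finset.closure_biUnion] at hx
  simp only [mem_iUnion] at hx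
  obtain ⟨c, hc, hx⟩ := hx
  exact ⟨c, hc, closure_ball_subset_closedBall hx⟩

lemma Nondegenerate.center_unique (hP : P.Nondegenerate ubar γ θ R' σ') {c c' : P.Ω}
    (hc : c ∈ ubar.support) (hc' : c' ∈ ubar.support) {x : EuclideanSpace ℝ (Fin d)}
    (hx : x ∈ ball (c : EuclideanSpace ℝ (Fin d)) (2 * R'))
    (hx' : x ∈ ball (c' : EuclideanSpace ℝ (Fin d)) (2 * R')) : c = c' := by
  by_contra hne
  exact Set.disjoint_left.1 (hP.disjoint_balls c hc c' hc' hne) hx hx'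

lemma AdmissibleRadius.exists_regular (hP : P.Nondegenerate ubar γ θ R' σ') {θ₁ R σ : ℝ}
    (hR0 : 0 < R) (hR : R < R') (h : P.AdmissibleRadius ubar θ₁ R σ) :
    ∃ Δ : ℝ, 0 < Δ ∧ ∀ u : P.Meas, P.res u ≤ Δ → P.Regular ubar θ₁ R σ u := by
  obtain ⟨Δ, hΔ, h⟩ := h
  refine ⟨Δ, hΔ, fun u hu => ⟨fun c hc x hx => (((h u hu).1 c hc).1 x hx).2,
    fun c hc => ((h u hu).1 c hc).2.1, fun x hx hxn => ?_⟩⟩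
  by_cases hcl : x ∈ closure (P.nbhd ubar R)
  swap
  · exact (h u hu).2 x ⟨hx, hcl⟩
  obtain ⟨c, hc, hxc⟩ := closure_nbhd_subset hcl
  have hdist : dist x c = R := le_antisymm (mem_closedBall.1 hxc)
    (not_lt.1 fun hlt => hxn (mem_nbhd.2 ⟨c, hc, hlt⟩))
  -- a boundary point is the limit of points further out on the same ray
  set y : ℝ → EuclideanSpace ℝ (Fin d) := fun t => c + t • (x - c) with hy
  have hy1 : y 1 = x := by simp [hy]
  have hyc : Continuous y := by fun_prop
  have hdy : ∀ t : ℝ, 0 ≤ t → dist (y t) c = t * R := fun t ht => by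
    simp [hy, dist_eq_norm, norm_smul, abs_of_nonneg ht, ← hdist]
  have hbound : ∀ t ∈ Ioo 1 (R' / R), |P.p u (y t)| ≤ P.α - σ / 2 := by
    intro t ht
    have ht2 : t * R < R' := (lt_div_iff₀ hR0).1 ht.2
    have hd := hdy t (zero_le_one.trans ht.1.le)
    have hmem : y t ∈ ball (c : EuclideanSpace ℝ (Fin d)) R' := by rw [mem_ball, hd]; exact ht2
    refine (h u hu).2 (y t) ⟨hP.mem_Ω (mem_nbhd.2 ⟨c, hc, hmem⟩), fun hclt => ?_⟩
    obtain ⟨c', hc', hx'⟩ := closure_nbhd_subset hclt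
    have hcc := hP.center_unique hc hc' (ball_subset_ball (by linarith) hmem)
      (closedBall_subset_ball (by linarith) hx')
    subst hcc
    rw [mem_closedBall, hd] at hx'
    nlinarith [ht.1]
  have hcont : ContinuousAt (fun t => |P.p u (y t)|) 1 := by
    have h1 : ContinuousAt (P.p u) (y 1) := by
      rw [hy1]
      exact (hP.contDiffAt_p u (mem_nbhd.2 ⟨c, hc, by rw [mem_ball, hdist]; exact hR⟩)).continuousAt
    exact (ContinuousAt.comp (f := y) h1 hyc.continuousAt).abs
  have hlim : Tendsto (fun t => |P.p u (y t)|) (𝓝[>] 1) (𝓝 |P.p u x|) := by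
    have := hcont.tendsto.mono_left (nhdsWithin_le_nhds (s := Ioi 1))
    simpa only [hy1] using this
  refine le_of_tendsto hlim ?_
  filter_upwards [Ioo_mem_nhdsGT ((one_lt_div hR0).2 hR)] with t ht using hbound t ht

/-- All atoms of `u` lie within distance `R` of a support point of `ubar` and carry the sign of the
corresponding coefficient of `ubar`. -/
def Clustered (P : SparseProblem d Y) (ubar : P.Sparse) (R : ℝ) (u : P.Sparse) : Prop :=
  ∀ z ∈ u.support, ∃ c ∈ ubar.support, (z : EuclideanSpace ℝ (Fin d)) ∈
    ball (c : EuclideanSpace ℝ (Fin d)) R ∧ Real.sign (u z) = Real.sign (ubar c)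

/-- Atoms at which `u x * p̄ x` misses `α * |u x|` by a fraction `τ` of the mass are charged to the
residual. -/
lemma Nondegenerate.sum_mass_le_res (hP : P.Nondegenerate ubar γ θ R' σ') (h0 : ubar ≠ 0)
    (u : P.Sparse) {s : Finset P.Ω} (hs : s ⊆ u.support) {τ : ℝ}
    (h : ∀ x ∈ s, u x * P.p (P.toMeas ubar) x ≤ (P.α - τ) * |u x|) :
    τ * ∑ x ∈ s, |u x| ≤ P.res (P.toMeas u) := by
  refine le_trans ?_ (hP.sum_defect_le_res u)
  refine le_trans ?_ (Finset.sum_le_sum_of_subset_of_nonneg hs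
    fun x _ _ => hP.defect_nonneg h0 x (u x))
  rw [Finset.mul_sum]
  refine Finset.sum_le_sum fun x hx => ?_
  linarith [h x hx]

/-- For small residuals the drop step is accepted, and its result is clustered. -/
lemma Nondegenerate.exists_clustered_dropStep (hP : P.Nondegenerate ubar γ θ R' σ')
    (h0 : ubar ≠ 0) (q : LPDAPParams) (hR0 : 0 < q.R) (hR : q.R < R') (hσ0 : 0 < q.σ)
    (hσ : q.σ ≤ σ') (hadm : P.AdmissibleRadius ubar θ q.R q.σ) :
    ∃ δ : ℝ, 0 < δ ∧ ∀ u : P.Sparse, P.res (P.toMeas u) ≤ δ →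
      P.Clustered ubar q.R (P.dropStep q u) := by
  classical
  obtain ⟨Δ₁, hΔ₁, hreg⟩ := hadm.exists_regular hP hR0 hR
  obtain ⟨Δ₂, hΔ₂, hclose⟩ := hP.exists_abs_p_sub_lt h0 (ε := q.σ / 8) (by positivity)
  obtain ⟨L, hL0, hL⟩ := P.lipschitz_gradient_F
  obtain ⟨C, hC0, hC⟩ := P.exists_norm_κ_le
  refine ⟨min (min Δ₁ Δ₂) (q.σ ^ 2 / (16 * (C * (L * C)))),
    lt_min (lt_min hΔ₁ hΔ₂) (by positivity), fun u hu => ?_⟩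
  have hu1 := hu.trans ((min_le_left _ _).trans (min_le_left _ _))
  have hu2 := hu.trans ((min_le_left _ _).trans (min_le_right _ _))
  have hu3 := hu.trans (min_le_right _ _)
  set ud := P.dropMeasure q u with hud
  have hudx : ∀ x, ud x = if x ∈ P.dropSet q u then 0 else u x := fun x => by
    simp only [hud, dropMeasure, Finsupp.filter_apply]
    split_ifs <;> simp_all
  have hsub : ud.support ⊆ u.support := fun x hx => by
    rw [Finsupp.mem_support_iff] at hx ⊢
    intro h; apply hx; rw [hudx, h]; simp
  set s := u.support.filter (· ∈ P.dropSet q u) with hs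
  have hdrop : ∀ x ∈ s, u x * P.p (P.toMeas u) x ≤ (P.α - q.σ / 2) * |u x| := by
    intro x hx
    obtain ⟨hxs, hx⟩ := (Finset.mem_filter.1 hx).2
    rcases hx with hx | hx
    · have hneg : u x * P.p (P.toMeas u) x ≤ 0 := by
        by_contra! hpos
        apply hx
        rcases pos_and_pos_or_neg_and_neg_of_mul_pos hpos with ⟨ha, hb⟩ | ⟨ha, hb⟩
        · rw [Real.sign_of_pos ha, Real.sign_of_pos hb]
        · rw [Real.sign_of_neg ha, Real.sign_of_neg hb]
      have := hP.σ'_lt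
      exact hneg.trans (mul_nonneg (by linarith) (abs_nonneg _))
    · refine (le_abs_self _).trans ?_
      rw [abs_mul, mul_comm]
      exact mul_le_mul_of_nonneg_right hx (abs_nonneg _)
  have hcmp : ∀ (p₁ p₂ ε : ℝ) (x : P.Ω), |p₁ - p₂| ≤ ε → u x * p₁ ≤ u x * p₂ + ε * |u x| := by
    intro p₁ p₂ ε x h
    have h1 := le_abs_self (u x * (p₁ - p₂))
    rw [abs_mul] at h1
    nlinarith [abs_nonneg (u x)]
  have hmass : q.σ / 4 * ∑ x ∈ s, |u x| ≤ P.res (P.toMeas u) := by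
    refine hP.sum_mass_le_res h0 u (Finset.filter_subset _ _) fun x hx => ?_
    have h1 := hdrop x hx
    have h2 := hcmp _ _ _ x ((abs_sub_comm _ _).trans_le (hclose _ hu2 x x.2).le)
    nlinarith [abs_nonneg (u x)]
  have hdiff : ∀ x ∈ u.support, u x - ud x = if x ∈ P.dropSet q u then u x else 0 := by
    intro x _
    rw [hudx]; split_ifs <;> simp
  have hnorm : ‖P.toMeas (u - ud)‖ = ∑ x ∈ s, |u x| := by
    rw [norm_toMeas_of_subset (s := u.support), hs, Finset.sum_filter]
    · refine Finset.sum_congr rfl fun x hx => ?_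
      rw [Finsupp.sub_apply, hdiff x hx]; split_ifs <;> simp
    · refine Finsupp.support_sub.trans (Finset.union_subset subset_rfl hsub)
  have hKdiff : ‖P.K (P.toMeas ud) - P.K (P.toMeas u)‖ ≤ C * ∑ x ∈ s, |u x| := by
    rw [norm_sub_rev, ← K_sub, ← map_sub, ← hnorm]
    exact P.norm_K_le hC0.le hC _
  have hp : ∀ x : P.Ω, |P.p (P.toMeas ud) x - P.p (P.toMeas u) x| ≤ q.σ / 4 := by
    intro x
    refine (P.abs_p_sub_p_le hL (hC x x.2) _ _).trans ?_
    have h1 : C * (L * ‖P.K (P.toMeas ud) - P.K (P.toMeas u)‖) ≤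
        C * (L * (C * ∑ x ∈ s, |u x|)) := by gcongr
    have h2 := hmass.trans hu3
    rw [le_div_iff₀ (by positivity)] at h2
    have h3 : q.σ * (C * (L * (C * ∑ x ∈ s, |u x|))) ≤ q.σ * (q.σ / 4) := by linarith
    exact h1.trans (le_of_mul_le_mul_left h3 hσ0)
  -- by convexity it suffices to test the gap at the dual variable of the reduced measure, where
  -- the removed atoms still violate complementarity
  have hJ : P.J (P.toMeas ud) ≤ P.J (P.toMeas u) := by
    have h1 := P.J_sub_le_gap (P.toMeas ud) (P.toMeas u)
    have h2 : P.gap (P.toMeas ud) (P.toMeas u) =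
        ∑ x ∈ s, (u x * P.p (P.toMeas ud) x - P.α * |u x|) := by
      rw [gap, sub_apply, toMeas_apply_pC, toMeas_apply_pC_of_subset hsub,
        norm_toMeas_of_subset hsub, norm_toMeas, Finset.mul_sum, Finset.mul_sum,
        ← Finset.sum_sub_distrib, ← Finset.sum_add_distrib, ← Finset.sum_sub_distrib, hs,
        Finset.sum_filter]
      refine Finset.sum_congr rfl fun x _ => ?_
      rw [hudx]; split_ifs <;> simp
    have h3 : ∑ x ∈ s, (u x * P.p (P.toMeas ud) x - P.α * |u x|) ≤ 0 := by
      refine Finset.sum_nonpos fun x hx => ?_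
      have h4 := hdrop x hx
      have h5 := hcmp _ _ _ x (hp x)
      nlinarith [abs_nonneg (u x)]
    linarith
  have heq : P.dropStep q u = ud := if_pos hJ
  rw [heq]
  intro z hz
  have hzu := hsub hz
  have hzd : z ∉ P.dropSet q u := fun h => by
    rw [Finsupp.mem_support_iff, hudx, if_pos h] at hz
    exact hz rfl
  have hz2 : ¬ (Real.sign (P.p (P.toMeas u) z) ≠ Real.sign (u z) ∨
    |P.p (P.toMeas u) z| ≤ P.α - q.σ / 2) := fun h => hzd ⟨hzu, h⟩
  push Not at hz2
  have hzn : (z : EuclideanSpace ℝ (Fin d)) ∈ P.nbhd ubar q.R := by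
    by_contra hn
    exact absurd ((hreg _ hu1).off z z.2 hn) (not_le.2 hz2.2)
  obtain ⟨c, hc, hzc⟩ := mem_nbhd.1 hzn
  refine ⟨c, hc, hzc, ?_⟩
  rw [hudx, if_neg hzd, ← hz2.1]
  exact (hreg _ hu1).sign_eq c hc z hzc

end SparseProblem

/-! ### Clusters and their masses -/

namespace SparseProblem

variable {d : ℕ} {Y : Type*} [NormedAddCommGroup Y] [InnerProductSpace ℝ Y] [CompleteSpace Y]
  {P : SparseProblem d Y} {ubar : P.Sparse} {γ θ R' σ' : ℝ}

open Classical in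
/-- The support point of `ubar` within distance `r` of `z`; points without one are mapped to
themselves. -/
noncomputable def center (P : SparseProblem d Y) (ubar : P.Sparse) (r : ℝ) (z : P.Ω) : P.Ω :=
  if h : ∃ c ∈ ubar.support, (z : EuclideanSpace ℝ (Fin d)) ∈
    ball (c : EuclideanSpace ℝ (Fin d)) r then h.choose else z

lemma Nondegenerate.center_eq (hP : P.Nondegenerate ubar γ θ R' σ') {c z : P.Ω}
    (hc : c ∈ ubar.support) (hz : (z : EuclideanSpace ℝ (Fin d)) ∈
      ball (c : EuclideanSpace ℝ (Fin d)) R') : P.center ubar R' z = c := by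
  have h : ∃ c ∈ ubar.support, (z : EuclideanSpace ℝ (Fin d)) ∈
    ball (c : EuclideanSpace ℝ (Fin d)) R' := ⟨c, hc, hz⟩
  rw [center, dif_pos h]
  have hR' := hP.R'_pos
  have hsub : ∀ x : EuclideanSpace ℝ (Fin d), ball x R' ⊆ ball x (2 * R') := fun x =>
    ball_subset_ball (by linarith)
  exact hP.center_unique h.choose_spec.1 hc (hsub _ h.choose_spec.2) (hsub _ hz)

lemma Nondegenerate.clustered_center (hP : P.Nondegenerate ubar γ θ R' σ') {R : ℝ} (hR : R ≤ R')
    {u : P.Sparse} (hu : P.Clustered ubar R u) {z : P.Ω} (hz : z ∈ u.support) :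
    P.center ubar R' z ∈ ubar.support ∧ (z : EuclideanSpace ℝ (Fin d)) ∈
      ball (P.center ubar R' z : EuclideanSpace ℝ (Fin d)) R ∧
      Real.sign (u z) = Real.sign (ubar (P.center ubar R' z)) := by
  obtain ⟨c, hc, hzc, hs⟩ := hu z hz
  rw [hP.center_eq hc (ball_subset_ball hR hzc)]
  exact ⟨hc, hzc, hs⟩

open Classical in
/-- The mass of `u` in the cluster around `c`. -/
noncomputable def clusterMass (P : SparseProblem d Y) (ubar : P.Sparse) (r : ℝ) (u : P.Sparse)
    (c : P.Ω) : ℝ := ∑ z ∈ u.support.filter (fun z => P.center ubar r z = c), u z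

lemma Nondegenerate.sum_smul_center (hP : P.Nondegenerate ubar γ θ R' σ') {R : ℝ} (hR : R ≤ R')
    {u : P.Sparse} (hu : P.Clustered ubar R u) :
    ∑ z ∈ u.support, u z • P.κ (P.center ubar R' z) =
      ∑ c ∈ ubar.support, P.clusterMass ubar R' u c • P.κ c := by
  classical
  rw [← Finset.sum_fiberwise_of_maps_to (t := ubar.support) (g := P.center ubar R')
    fun z hz => (hP.clustered_center hR hu hz).1]
  refine Finset.sum_congr rfl fun c _ => ?_
  rw [clusterMass, Finset.sum_smul]
  refine Finset.sum_congr (by congr) fun z hz => ?_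
  rw [(Finset.mem_filter.1 hz).2]

open Classical in
/-- Outside any neighbourhood of the support points the mass of `u` is controlled linearly by the
residual. -/
lemma Nondegenerate.exists_far_mass_le (hP : P.Nondegenerate ubar γ θ R' σ') (h0 : ubar ≠ 0)
    {ρ : ℝ} (hρ : 0 < ρ) :
    ∃ τ : ℝ, 0 < τ ∧ ∀ u : P.Sparse,
      τ * ∑ z ∈ u.support.filter
        (fun z : P.Ω => (z : EuclideanSpace ℝ (Fin d)) ∉ P.nbhd ubar ρ), |u z| ≤
        P.res (P.toMeas u) := by
  obtain ⟨τ, hτ, -, h⟩ := hP.exists_σ h0 hρ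
  refine ⟨τ, hτ, fun u => hP.sum_mass_le_res h0 u (Finset.filter_subset _ _) fun x hx => ?_⟩
  refine (le_abs_self _).trans ?_
  rw [abs_mul, mul_comm]
  exact mul_le_mul_of_nonneg_right (h x x.2 (Finset.mem_filter.1 hx).2) (abs_nonneg _)

/-- For small residuals, moving all atoms to the centres of their clusters hardly changes `K u`:
most of the mass is close to the centres already. -/
lemma Nondegenerate.exists_lumping_close (hP : P.Nondegenerate ubar γ θ R' σ') (h0 : ubar ≠ 0)
    {M : ℝ} (hM : 0 < M) {ε : ℝ} (hε : 0 < ε) :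
    ∃ δ : ℝ, 0 < δ ∧ ∀ u : P.Sparse, P.res (P.toMeas u) ≤ δ → ‖P.toMeas u‖ ≤ M →
      ‖P.K (P.toMeas u) - ∑ z ∈ u.support, u z • P.κ (P.center ubar R' z)‖ ≤ ε := by
  classical
  obtain ⟨C, hC0, hC⟩ := P.exists_norm_κ_le
  have hex : ∃ ρ : ℝ, 0 < ρ ∧ ρ ≤ R' ∧ ∀ c ∈ ubar.support,
      ∀ x ∈ ball (c : EuclideanSpace ℝ (Fin d)) ρ, ‖P.κ x - P.κ c‖ ≤ ε / (2 * M) := by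
    have : ∀ᶠ ρ in 𝓝[>] (0 : ℝ), ∀ c ∈ ubar.support,
        ∀ x ∈ ball (c : EuclideanSpace ℝ (Fin d)) ρ, ‖P.κ x - P.κ c‖ ≤ ε / (2 * M) := by
      rw [Finset.eventually_all]
      intro c hc
      have hcont := (hP.contDiffAt_κ (x := c)
        (mem_nbhd.2 ⟨c, hc, mem_ball_self hP.R'_pos⟩)).continuousAt
      obtain ⟨ρ, hρ, h⟩ := Metric.continuousAt_iff.1 hcont (ε / (2 * M)) (by positivity)
      filter_upwards [Ioc_mem_nhdsGT hρ] with ρ' hρ' x hx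
      rw [← dist_eq_norm]
      exact (h (lt_of_lt_of_le hx hρ'.2)).le
    obtain ⟨ρ, h1, h2⟩ := (this.and (Ioc_mem_nhdsGT hP.R'_pos)).exists
    exact ⟨ρ, h2.1, h2.2, h1⟩
  obtain ⟨ρ, hρ0, hρR, hρ⟩ := hex
  obtain ⟨τ, hτ, hfar⟩ := hP.exists_far_mass_le h0 hρ0
  refine ⟨ε * τ / (4 * C), by positivity, fun u hu huM => ?_⟩
  have hK : P.K (P.toMeas u) = ∑ z ∈ u.support, u z • P.κ z := P.K_toMeas u
  rw [hK, ← Finset.sum_sub_distrib]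
  have hterm : ∀ z ∈ u.support, ‖u z • P.κ z - u z • P.κ (P.center ubar R' z)‖ ≤
      ε / (2 * M) * |u z| +
        if (z : EuclideanSpace ℝ (Fin d)) ∉ P.nbhd ubar ρ then 2 * C * |u z| else 0 := by
    intro z hz
    rw [← smul_sub, norm_smul, Real.norm_eq_abs, mul_comm]
    split_ifs with h
    · obtain ⟨c, hc, hzc⟩ := mem_nbhd.1 h
      rw [hP.center_eq hc (ball_subset_ball hρR hzc), add_zero]
      exact mul_le_mul_of_nonneg_right (hρ c hc z hzc) (abs_nonneg _)
    · have h1 : ‖P.κ z - P.κ (P.center ubar R' z)‖ ≤ 2 * C := by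
        have := norm_sub_le (P.κ z) (P.κ (P.center ubar R' z))
        linarith [hC z z.2, hC (P.center ubar R' z) (P.center ubar R' z).2]
      have h2 : 0 ≤ ε / (2 * M) * |u z| := by positivity
      nlinarith [abs_nonneg (u z)]
  refine (norm_sum_le _ _).trans ((Finset.sum_le_sum hterm).trans ?_)
  rw [Finset.sum_add_distrib, ← Finset.mul_sum, ← norm_toMeas, ← Finset.sum_filter,
    ← Finset.mul_sum]
  have h1 : ε / (2 * M) * ‖P.toMeas u‖ ≤ ε / 2 := by
    calc ε / (2 * M) * ‖P.toMeas u‖ ≤ ε / (2 * M) * M := by gcongr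
      _ = ε / 2 := by field_simp
  have h2 := (hfar u).trans hu
  rw [le_div_iff₀ (by positivity)] at h2
  set S := ∑ z ∈ u.support.filter
    (fun z : P.Ω => (z : EuclideanSpace ℝ (Fin d)) ∉ P.nbhd ubar ρ), |u z|
  have h3 : τ * (2 * C * S) ≤ τ * (ε / 2) := by linarith
  have h4 := le_of_mul_le_mul_left h3 hτ
  linarith

lemma two_mul_muBar_le {c : P.Ω} (hc : c ∈ ubar.support) : 2 * P.muBar ubar ≤ |ubar c| := by
  have : ⨅ x : ubar.support, |ubar (x : P.Ω)| ≤ |ubar c| :=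
    ciInf_le ⟨0, by rintro _ ⟨x, rfl⟩; exact abs_nonneg _⟩ (⟨c, hc⟩ : ubar.support)
  rw [muBar]; linarith

lemma muBar_pos (h0 : ubar ≠ 0) : 0 < P.muBar ubar := by
  obtain ⟨x, hx⟩ := Finsupp.support_nonempty_iff.2 h0
  have : Nonempty ubar.support := ⟨⟨x, hx⟩⟩
  obtain ⟨y, hy⟩ := exists_eq_ciInf_of_finite (f := fun x : ubar.support => |ubar (x : P.Ω)|)
  rw [muBar, ← hy]
  have := abs_pos.2 (Finsupp.mem_support_iff.1 y.2)
  linarith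

/-- For small residuals each cluster carries at least half of the mass of the corresponding atom
of `ubar`; by linear independence the cluster masses are determined by `K u`. -/
lemma Nondegenerate.exists_muBar_le_clusterMass (hP : P.Nondegenerate ubar γ θ R' σ')
    (h0 : ubar ≠ 0) {R : ℝ} (hR : R ≤ R') {M : ℝ} (hM : 0 < M) :
    ∃ δ : ℝ, 0 < δ ∧ ∀ u : P.Sparse, P.res (P.toMeas u) ≤ δ → ‖P.toMeas u‖ ≤ M →
      P.Clustered ubar R u → ∀ c ∈ ubar.support, P.muBar ubar ≤ |P.clusterMass ubar R' u c| := by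
  set T := Fintype.linearCombination ℝ (fun x : ubar.support => P.κ (x : P.Ω)) with hT
  obtain ⟨A, hA0, hA⟩ := T.exists_antilipschitzWith
    (LinearMap.ker_eq_bot.2 hP.linearIndependent.fintypeLinearCombination_injective)
  have hA0' : (0 : ℝ) < A := hA0
  have hμ := muBar_pos h0
  obtain ⟨δ₁, hδ₁, h1⟩ := hP.exists_lumping_close h0 hM
    (ε := P.muBar ubar / (2 * A)) (by positivity)
  obtain ⟨δ₂, hδ₂, h2⟩ := hP.exists_norm_K_sub_lt h0
    (ε := P.muBar ubar / (2 * A)) (by positivity)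
  refine ⟨min δ₁ δ₂, lt_min hδ₁ hδ₂, fun u hu huM hcl c hc => ?_⟩
  have hu1 := h1 u (hu.trans (min_le_left _ _)) huM
  have hu2 := h2 (P.toMeas u) (hu.trans (min_le_right _ _))
  rw [hP.sum_smul_center hR hcl] at hu1
  set m : ubar.support → ℝ := fun c => P.clusterMass ubar R' u c
  set l : ubar.support → ℝ := fun c => ubar c
  have hm : T m = ∑ c ∈ ubar.support, P.clusterMass ubar R' u c • P.κ c := by
    rw [hT, Fintype.linearCombination_apply,
      Finset.sum_coe_sort ubar.support (fun c : P.Ω => P.clusterMass ubar R' u c • P.κ c)]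
  have hl : T l = P.K (P.toMeas ubar) := by
    rw [hT, Fintype.linearCombination_apply,
      Finset.sum_coe_sort ubar.support (fun c : P.Ω => ubar c • P.κ c), K_toMeas]
    rfl
  have h3 := hA.le_mul_dist m l
  rw [hm, hl, dist_eq_norm, dist_eq_norm] at h3
  have h4 : ‖∑ c ∈ ubar.support, P.clusterMass ubar R' u c • P.κ c - P.K (P.toMeas ubar)‖ ≤
      P.muBar ubar / A := by
    have h5 := norm_sub_le_norm_sub_add_norm_sub
      (∑ c ∈ ubar.support, P.clusterMass ubar R' u c • P.κ c) (P.K (P.toMeas u))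
      (P.K (P.toMeas ubar))
    rw [norm_sub_rev _ (P.K (P.toMeas u))] at h5
    have h6 : P.muBar ubar / A = P.muBar ubar / (2 * A) + P.muBar ubar / (2 * A) := by
      field_simp; norm_num
    linarith
  have h5 : ‖m - l‖ ≤ P.muBar ubar := by
    refine h3.trans ((mul_le_mul_of_nonneg_left h4 hA0'.le).trans_eq ?_)
    field_simp
  have h6 := (norm_le_pi_norm (m - l) ⟨c, hc⟩).trans h5
  have h7 : |P.clusterMass ubar R' u c - ubar c| ≤ P.muBar ubar := h6
  have h8 := abs_sub_abs_le_abs_sub (ubar c) (P.clusterMass ubar R' u c)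
  rw [abs_sub_comm] at h8
  have h9 := two_mul_muBar_le (P := P) hc
  linarith

end SparseProblem

/-! ### The local support improver -/

lemma gradient_eq_zero_of_isLocalMax_abs {E : Type*} [NormedAddCommGroup E]
    [InnerProductSpace ℝ E] [CompleteSpace E] {f : E → ℝ} {x : E} (hf : DifferentiableAt ℝ f x)
    (hx : f x ≠ 0) (hmax : IsLocalMax (fun y => |f y|) x) : gradient f x = 0 := by
  have h : fderiv ℝ f x = 0 := by
    rcases lt_or_gt_of_ne hx with h | h
    · have heq : (fun y => |f y|) =ᶠ[𝓝 x] fun y => -f y := by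
        filter_upwards [hf.continuousAt.eventually_lt continuousAt_const h] with y hy
        exact abs_of_neg hy
      have h1 : IsLocalMax (fun y => -f y) x := hmax.congr heq
      have h2 := h1.fderiv_eq_zero
      rwa [fderiv_fun_neg, neg_eq_zero] at h2
    · have heq : (fun y => |f y|) =ᶠ[𝓝 x] f := by
        filter_upwards [continuousAt_const.eventually_lt hf.continuousAt h] with y hy
        exact abs_of_pos hy
      exact (hmax.congr heq).fderiv_eq_zero
  rw [gradient, h, map_zero]

namespace SparseProblem

variable {d : ℕ} {Y : Type*} [NormedAddCommGroup Y] [InnerProductSpace ℝ Y] [CompleteSpace Y]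
  {P : SparseProblem d Y} {ubar : P.Sparse} {γ θ R' σ' : ℝ}

lemma Nondegenerate.eq_of_dist_lt (hP : P.Nondegenerate ubar γ θ R' σ') {c c' : P.Ω}
    (hc : c ∈ ubar.support) (hc' : c' ∈ ubar.support)
    (h : dist (c : EuclideanSpace ℝ (Fin d)) c' < 4 * R') : c = c' := by
  refine hP.center_unique hc hc' (x := midpoint ℝ (c : EuclideanSpace ℝ (Fin d)) c') ?_ ?_
  · rw [mem_ball, dist_midpoint_left, Real.norm_ofNat]; linarith
  · rw [mem_ball, dist_midpoint_right, Real.norm_ofNat]; linarith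

/-- The ball of radius `2 * R` around a point of a cluster meets the support in that cluster. -/
lemma Nondegenerate.dist_lt_iff_center (hP : P.Nondegenerate ubar γ θ R' σ') {R : ℝ}
    (hR : R < R') {u : P.Sparse} (hu : P.Clustered ubar R u) {c w z : P.Ω}
    (hc : c ∈ ubar.support) (hw : (w : EuclideanSpace ℝ (Fin d)) ∈
      ball (c : EuclideanSpace ℝ (Fin d)) R) (hz : z ∈ u.support) :
    dist z w < 2 * R ↔ P.center ubar R' z = c := by
  obtain ⟨hzc, hzb, -⟩ := hP.clustered_center hR.le hu hz
  rw [Subtype.dist_eq]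
  rw [mem_ball] at hw hzb
  constructor
  · intro h
    refine hP.eq_of_dist_lt hzc hc ?_
    have h1 := dist_triangle_left (P.center ubar R' z : EuclideanSpace ℝ (Fin d)) c z
    have h2 := dist_triangle (z : EuclideanSpace ℝ (Fin d)) w c
    linarith
  · intro h
    rw [h] at hzb
    have h2 := dist_triangle_right (z : EuclideanSpace ℝ (Fin d)) w c
    linarith

lemma Nondegenerate.nearMax_eq (hP : P.Nondegenerate ubar γ θ R' σ') (q : LPDAPParams)
    (hR : q.R < R') {u : P.Sparse} (hu : P.Clustered ubar q.R u) {c w : P.Ω}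
    (hc : c ∈ ubar.support) (hw : (w : EuclideanSpace ℝ (Fin d)) ∈
      ball (c : EuclideanSpace ℝ (Fin d)) q.R) :
    P.nearMax q u w = sSup ((fun z : P.Ω => |P.p (P.toMeas u) z|) ''
      {z | z ∈ u.support ∧ P.center ubar R' z = c}) := by
  rw [nearMax]
  congr 2
  ext z
  simp only [mem_ofPred_eq]
  exact and_congr_right fun hz => hP.dist_lt_iff_center hR hu hc hw hz

lemma Nondegenerate.ballMass_eq (hP : P.Nondegenerate ubar γ θ R' σ') (q : LPDAPParams)
    (hR : q.R < R') {u : P.Sparse} (hu : P.Clustered ubar q.R u) {c w : P.Ω}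
    (hc : c ∈ ubar.support) (hw : (w : EuclideanSpace ℝ (Fin d)) ∈
      ball (c : EuclideanSpace ℝ (Fin d)) q.R) :
    P.ballMass q u w = P.clusterMass ubar R' u c := by
  rw [ballMass, clusterMass]
  refine Finset.sum_congr (Finset.filter_congr fun z hz => ?_) fun _ _ => rfl
  exact hP.dist_lt_iff_center hR hu hc hw hz

lemma abs_p_le_nearMax (q : LPDAPParams) {u : P.Sparse} {w z : P.Ω} (hz : z ∈ u.support)
    (hzw : dist z w < 2 * q.R) : |P.p (P.toMeas u) z| ≤ P.nearMax q u w := by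
  refine le_csSup ⟨‖P.pC (P.toMeas u)‖, ?_⟩ ⟨z, ⟨hz, hzw⟩, rfl⟩
  rintro _ ⟨z, -, rfl⟩
  exact P.abs_p_le_norm_pC _ z

open Classical in
/-- If clusters can be told apart by `2 * R`-balls and each of them admits an improved point, the
loop picks exactly one improved point per cluster. -/
lemma LSILoop.exists_selection {q : LPDAPParams} {u : P.Sparse} {ctr : P.Ω → P.Ω}
    (hctr : ∀ x ∈ u.support, ∀ z ∈ u.support, dist z x < 2 * q.R ↔ ctr z = ctr x)
    (hfind : ∀ x ∈ u.support, ∃ y, P.IsLSIPoint q u x y) {A B : Finset P.Ω}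
    (h : P.LSILoop q u A B) (hA : A ⊆ u.support) :
    ∃ Z : P.Ω → P.Ω, B = (A.image ctr).image Z ∧
      ∀ c ∈ A.image ctr, ∃ x ∈ u.support, ctr x = c ∧ P.IsLSIPoint q u x (Z c) := by
  induction h with
  | done => exact ⟨id, by simp, by simp⟩
  | skip A B x hx hmax hy hB ih =>
    obtain ⟨y, hy'⟩ := hfind x (hA hx)
    exact absurd hy' (hy y)
  | found A B x y hx hmax hy hB ih =>
    have hsub : A.filter (fun z => ¬ dist z x < 2 * q.R) ⊆ u.support :=
      (Finset.filter_subset _ _).trans hA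
    obtain ⟨Z, hBZ, hZ⟩ := ih hsub
    have hnot : ctr x ∉ (A.filter (fun z => ¬ dist z x < 2 * q.R)).image ctr := by
      intro hmem
      obtain ⟨z, hz, hzx⟩ := Finset.mem_image.1 hmem
      obtain ⟨hzA, hzd⟩ := Finset.mem_filter.1 hz
      exact hzd ((hctr x (hA hx) z (hA hzA)).2 hzx)
    have himg : A.image ctr =
        insert (ctr x) ((A.filter (fun z => ¬ dist z x < 2 * q.R)).image ctr) := by
      ext c
      simp only [Finset.mem_image, Finset.mem_insert, Finset.mem_filter]
      constructor
      · rintro ⟨z, hz, rfl⟩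
        by_cases hzx : dist z x < 2 * q.R
        · exact Or.inl ((hctr x (hA hx) z (hA hz)).1 hzx)
        · exact Or.inr ⟨z, ⟨hz, hzx⟩, rfl⟩
      · rintro (rfl | ⟨z, ⟨hz, -⟩, rfl⟩)
        · exact ⟨x, hx, rfl⟩
        · exact ⟨z, hz, rfl⟩
    have hup : ∀ c ∈ (A.filter (fun z => ¬ dist z x < 2 * q.R)).image ctr,
        Function.update Z (ctr x) y c = Z c := fun c hc =>
      Function.update_of_ne (by rintro rfl; exact hnot hc) _ _
    refine ⟨Function.update Z (ctr x) y, ?_, ?_⟩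
    · rw [himg, Finset.image_insert, Function.update_self, hBZ]
      congr 1
      exact Finset.image_congr fun c hc => (hup c hc).symm
    · rw [himg]
      intro c hc
      rcases Finset.mem_insert.1 hc with rfl | hc
      · exact ⟨x, hA hx, rfl, by rwa [Function.update_self]⟩
      · obtain ⟨z, hz, hzc, hzy⟩ := hZ c hc
        exact ⟨z, hz, hzc, by rwa [hup c hc]⟩

lemma gap_eq (u v : P.Meas) :
    P.gap u v = (v (P.pC u) - P.α * ‖v‖) + (P.α * ‖u‖ - u (P.pC u)) := by
  rw [gap, sub_apply]; ring

/-- The maximal gap over the ball of radius `M`; the bound is attained. -/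
lemma gap_le {M : ℝ} {u v : P.Meas} (hv : ‖v‖ ≤ M) :
    P.gap u v ≤ M * max 0 (‖P.pC u‖ - P.α) + (P.α * ‖u‖ - u (P.pC u)) := by
  rw [gap_eq]
  have h1 := P.apply_le_norm_mul v (P.pC u)
  have h2 : ‖v‖ * (‖P.pC u‖ - P.α) ≤ M * max 0 (‖P.pC u‖ - P.α) :=
    (mul_le_mul_of_nonneg_left (le_max_right _ _) (norm_nonneg v)).trans
      (mul_le_mul_of_nonneg_right hv (le_max_left _ _))
  linarith

lemma gap_le_supportGap {M : ℝ} {u v : P.Sparse} (hv : v.support ⊆ u.support)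
    (hvM : ‖P.toMeas v‖ ≤ M) : P.gap (P.toMeas u) (P.toMeas v) ≤ P.supportGap M u := by
  refine le_csSup ⟨M * max 0 (‖P.pC (P.toMeas u)‖ - P.α) +
    (P.α * ‖P.toMeas u‖ - P.toMeas u (P.pC (P.toMeas u))), ?_⟩ ⟨v, hv, hvM, rfl⟩
  rintro _ ⟨v, -, hvM, rfl⟩
  exact gap_le hvM

lemma supportGap_nonneg {M : ℝ} {u : P.Sparse} (hu : ‖P.toMeas u‖ ≤ M) :
    0 ≤ P.supportGap M u := by
  have := gap_le_supportGap (P := P) subset_rfl hu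
  rw [gap_eq] at this
  linarith

lemma defect_le_supportGap {M : ℝ} (hM : 0 ≤ M) (u : P.Sparse) :
    P.α * ‖P.toMeas u‖ - P.toMeas u (P.pC (P.toMeas u)) ≤ P.supportGap M u := by
  have h := gap_le_supportGap (P := P) (u := u) (v := 0) (M := M) (by simp)
    (by rw [norm_toMeas]; simpa using hM)
  rw [gap_eq, norm_toMeas (u := 0)] at h
  simpa using h

/-- The gap over the support of `u`, tested with an atom of mass `M` at a support point. -/
lemma add_defect_le_supportGap {M : ℝ} (hM : 0 ≤ M) {u : P.Sparse} {z : P.Ω}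
    (hz : z ∈ u.support) :
    M * (|P.p (P.toMeas u) z| - P.α) +
      (P.α * ‖P.toMeas u‖ - P.toMeas u (P.pC (P.toMeas u))) ≤ P.supportGap M u := by
  classical
  set a := M * Real.sign (P.p (P.toMeas u) z) with ha
  have hsign : |Real.sign (P.p (P.toMeas u) z)| ≤ 1 := by
    rcases Real.sign_apply_eq (P.p (P.toMeas u) z) with h | h | h <;> simp [h]
  have haM : |a| ≤ M := by
    rw [ha, abs_mul, abs_of_nonneg hM]; exact mul_le_of_le_one_right hM hsign
  have hsupp : (Finsupp.single z a).support ⊆ {z} := Finsupp.support_single_subset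
  have hnorm : ‖P.toMeas (Finsupp.single z a)‖ = |a| := by
    rw [norm_toMeas_of_subset hsupp]; simp
  have h := gap_le_supportGap (P := P) (u := u) (M := M)
    (hsupp.trans (Finset.singleton_subset_iff.2 hz)) (hnorm.trans_le haM)
  rw [gap_eq, hnorm, toMeas_apply_pC_of_subset hsupp] at h
  simp only [Finset.sum_singleton, Finsupp.single_eq_same] at h
  have h1 : a * P.p (P.toMeas u) z = M * |P.p (P.toMeas u) z| := by
    rw [ha, mul_assoc, ← abs_eq_sign_mul]
  have h2 := mul_le_mul_of_nonneg_left haM P.α_pos.le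
  linarith

section Improve

variable {q : LPDAPParams} {u : P.Sparse}

/-- The local maximizer of `|p_u|` is an improved point for its cluster. -/
lemma Nondegenerate.exists_isLSIPoint (hP : P.Nondegenerate ubar γ θ R' σ')
    (hR0 : 0 < q.R) (hR : q.R < R') (hreg : P.Regular ubar θ q.R q.σ (P.toMeas u))
    (hp : ∀ c ∈ ubar.support, P.α - q.σ / 2 < |P.p (P.toMeas u) c|) (hσα : q.σ < P.α)
    (hM : ‖P.toMeas u‖ ≤ q.M) (hu : P.Clustered ubar q.R u) {x : P.Ω} (hx : x ∈ u.support) :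
    ∃ y, P.IsLSIPoint q u x y := by
  obtain ⟨hc, hxb, -⟩ := hP.clustered_center hR.le hu hx
  set c := P.center ubar R' x
  obtain ⟨xh, hxh, hmax, -, -, hgrow⟩ := hreg.exists_max c hc
  have hn : xh ∈ P.nbhd ubar R' := mem_nbhd.2 ⟨c, hc, ball_subset_ball hR.le hxh⟩
  have hle : ∀ z ∈ ball (c : EuclideanSpace ℝ (Fin d)) q.R,
      |P.p (P.toMeas u) z| ≤ |P.p (P.toMeas u) xh| := fun z hz => by
    have h1 := hgrow z hz
    have : 0 ≤ θ / 8 * ‖xh - z‖ ^ 2 := by have := hP.θ_pos; positivity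
    linarith
  have hbig : P.α - q.σ / 2 < |P.p (P.toMeas u) xh| :=
    (hp c hc).trans_le (hle c (mem_ball_self hR0))
  have hdiff := (hP.contDiffAt_p (P.toMeas u) hn).differentiableAt two_ne_zero
  have hgrad : gradient (P.p (P.toMeas u)) xh = 0 :=
    gradient_eq_zero_of_isLocalMax_abs hdiff
      (abs_pos.1 (lt_trans (by linarith [P.α_pos]) hbig)) hmax
  refine ⟨⟨xh, hP.mem_Ω hn⟩, ?_, hP.nbhd_subset hn, hdiff, hbig, ?_, ?_⟩
  · rw [Subtype.dist_eq]
    have := dist_triangle_right xh x c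
    have := mem_ball.1 hxh
    have := mem_ball.1 hxb
    simp only
    linarith
  · simp only [hgrad, norm_zero]
    exact supportGap_nonneg hM
  · simp only [hgrad, norm_zero, mul_zero, sub_nonneg]
    rw [hP.nearMax_eq q hR hu hc hxb]
    refine csSup_le ⟨_, ⟨x, ⟨hx, rfl⟩, rfl⟩⟩ ?_
    rintro _ ⟨z, ⟨hz, hzc⟩, rfl⟩
    have := (hP.clustered_center hR.le hu hz).2.1
    rw [hzc] at this
    exact hle z this

/-- Improved points belong to the cluster for which they were found: where `|p_u|` exceeds
`α - σ / 2`, some support point is within distance `R`. -/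
lemma Nondegenerate.isLSIPoint_mem_ball (hP : P.Nondegenerate ubar γ θ R' σ')
    (hR : q.R < R') (hreg : P.Regular ubar θ q.R q.σ (P.toMeas u)) {c x y : P.Ω}
    (hc : c ∈ ubar.support) (hx : (x : EuclideanSpace ℝ (Fin d)) ∈
      ball (c : EuclideanSpace ℝ (Fin d)) q.R) (hy : P.IsLSIPoint q u x y) :
    (y : EuclideanSpace ℝ (Fin d)) ∈ ball (c : EuclideanSpace ℝ (Fin d)) q.R := by
  have hyn : (y : EuclideanSpace ℝ (Fin d)) ∈ P.nbhd ubar q.R := by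
    by_contra hn
    exact absurd (hreg.off y y.2 hn) (not_le.2 hy.2.2.2.1)
  obtain ⟨c', hc', hyc⟩ := mem_nbhd.1 hyn
  have hcc : c' = c := by
    refine hP.eq_of_dist_lt hc' hc ?_
    have h1 := dist_triangle_left (c' : EuclideanSpace ℝ (Fin d)) c y
    have h2 := dist_triangle (y : EuclideanSpace ℝ (Fin d)) x c
    have h3 := hy.1
    rw [Subtype.dist_eq] at h3
    rw [mem_ball] at hx hyc
    linarith
  rwa [← hcc]

end Improve

end SparseProblem

/-! ### Contraction by the local support improver -/

/-- Weighted Cauchy-Schwarz inequality. -/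
lemma sum_mul_sqrt_le {ι : Type*} (s : Finset ι) {a b : ι → ℝ} (ha : ∀ i ∈ s, 0 ≤ a i)
    (hb : ∀ i ∈ s, 0 ≤ b i) :
    ∑ i ∈ s, a i * √(b i) ≤ √(∑ i ∈ s, a i) * √(∑ i ∈ s, a i * b i) := by
  have h := Real.sum_mul_le_sqrt_mul_sqrt s (fun i => √(a i)) (fun i => √(a i * b i))
  have h1 : ∀ i ∈ s, √(a i) * √(a i * b i) = a i * √(b i) := fun i hi => by
    rw [Real.sqrt_mul (ha i hi), ← mul_assoc, Real.mul_self_sqrt (ha i hi)]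
  have h2 : ∀ i ∈ s, √(a i) ^ 2 = a i := fun i hi => Real.sq_sqrt (ha i hi)
  have h3 : ∀ i ∈ s, √(a i * b i) ^ 2 = a i * b i := fun i hi =>
    Real.sq_sqrt (mul_nonneg (ha i hi) (hb i hi))
  rwa [Finset.sum_congr rfl h1, Finset.sum_congr rfl h2, Finset.sum_congr rfl h3] at h

namespace SparseProblem

variable {d : ℕ} {Y : Type*} [NormedAddCommGroup Y] [InnerProductSpace ℝ Y] [CompleteSpace Y]
  {P : SparseProblem d Y} {ubar : P.Sparse} {γ θ R' σ' : ℝ}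

section MapDomain

variable (u : P.Sparse) (f : P.Ω → P.Ω)

lemma toMeas_mapDomain_apply (g : C(P.Ω, ℝ)) :
    P.toMeas (u.mapDomain f) g = ∑ z ∈ u.support, u z * g (f z) := by
  rw [toMeas, Finsupp.linearCombination_mapDomain, Finsupp.linearCombination_apply, Finsupp.sum,
    _root_.sum_apply]
  rfl

lemma norm_toMeas_mapDomain_le : ‖P.toMeas (u.mapDomain f)‖ ≤ ‖P.toMeas u‖ := by
  rw [norm_toMeas (u := u)]
  refine ContinuousLinearMap.opNorm_le_bound _ (Finset.sum_nonneg fun _ _ => abs_nonneg _)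
    fun g => ?_
  rw [toMeas_mapDomain_apply, Real.norm_eq_abs, Finset.sum_mul]
  refine (Finset.abs_sum_le_sum_abs _ _).trans (Finset.sum_le_sum fun x _ => ?_)
  rw [abs_mul]
  exact mul_le_mul_of_nonneg_left (g.norm_coe_le_norm _) (abs_nonneg _)

lemma K_toMeas_mapDomain :
    P.K (P.toMeas (u.mapDomain f)) = ∑ z ∈ u.support, u z • P.κ (f z) := by
  rw [K_toMeas, Finsupp.sum_mapDomain_index (by simp) (by intros; rw [add_smul])]
  rfl

open Classical in
/-- Lumping each cluster into one point is a push-forward. -/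
lemma lumped_eq_mapDomain {q : LPDAPParams} {ctr Z : P.Ω → P.Ω}
    (hinj : Set.InjOn Z (u.support.image ctr))
    (hmass : ∀ c ∈ u.support.image ctr, P.ballMass q u (Z c) =
      ∑ z ∈ u.support.filter (fun z => ctr z = c), u z) :
    P.lumped q u ((u.support.image ctr).image Z) = u.mapDomain (Z ∘ ctr) := by
  rw [lumped, Finset.sum_image hinj, Finsupp.mapDomain, Finsupp.sum,
    ← Finset.sum_fiberwise_of_maps_to (t := u.support.image ctr) (g := ctr)
      fun z hz => Finset.mem_image_of_mem ctr hz]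
  refine Finset.sum_congr rfl fun c hc => ?_
  rw [hmass c hc, Finsupp.single_finsetSum]
  refine Finset.sum_congr rfl fun z hz => ?_
  rw [Function.comp_apply, (Finset.mem_filter.1 hz).2]

end MapDomain

lemma Nondegenerate.norm_κ_sub_le (hP : P.Nondegenerate ubar γ θ R' σ') {L CK CK' : ℝ}
    (hb : P.Bounds ubar R' L CK CK') {c : P.Ω} (hc : c ∈ ubar.support)
    {x y : EuclideanSpace ℝ (Fin d)} (hx : x ∈ ball (c : EuclideanSpace ℝ (Fin d)) R')
    (hy : y ∈ ball (c : EuclideanSpace ℝ (Fin d)) R') :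
    ‖P.κ y - P.κ x‖ ≤ CK' * ‖y - x‖ := by
  have hsub : ball (c : EuclideanSpace ℝ (Fin d)) R' ⊆ P.nbhd ubar R' := fun z hz =>
    mem_nbhd.2 ⟨c, hc, hz⟩
  exact (convex_ball _ _).norm_image_sub_le_of_norm_fderiv_le
    (fun z hz => (hP.contDiffAt_κ (hsub hz)).differentiableAt two_ne_zero)
    (fun z hz => hb.norm_fderiv_κ z (hsub hz)) hx hy

/-- Close to the support points the local maximizers supplied by admissibility enjoy quadratic
growth with twice the constant; atoms further away have mass of the order of the residual. -/
lemma Nondegenerate.exists_improved_growth (hP : P.Nondegenerate ubar γ θ R' σ') (h0 : ubar ≠ 0)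
    {R : ℝ} (hR0 : 0 < R) :
    ∃ ρ : ℝ, 0 < ρ ∧ ρ ≤ R' ∧ ∃ Δ : ℝ, 0 < Δ ∧ ∀ u : P.Meas, P.res u ≤ Δ →
      ∀ c ∈ ubar.support, ∀ xh : EuclideanSpace ℝ (Fin d),
      (∀ x ∈ ball (c : EuclideanSpace ℝ (Fin d)) R,
        IsLocalMax (fun x => |P.p u x|) x → x = xh) →
      ∀ x ∈ ball (c : EuclideanSpace ℝ (Fin d)) ρ,
        θ / 4 * ‖xh - x‖ ^ 2 ≤ |P.p u xh| - |P.p u x| := by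
  obtain ⟨Rt, hRt, hRtR, h⟩ := hP.exists_admissibleRadius h0
  set ρ := min Rt R / 2 with hρ
  have hm : 0 < min Rt R := lt_min hRt hR0
  have hρ0 : 0 < ρ := by positivity
  have hρRt : ρ < Rt := by have := min_le_left Rt R; linarith
  have hρR : ρ ≤ R := by have := min_le_right Rt R; linarith
  obtain ⟨σ₁, -, -, hadm⟩ := h ρ hρ0 hρRt
  obtain ⟨Δ, hΔ, hreg⟩ := hadm.exists_regular hP hρ0 (hρRt.trans_le hRtR)
  refine ⟨ρ, hρ0, (hρRt.trans_le hRtR).le, Δ, hΔ, fun u hu c hc xh huniq x hx => ?_⟩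
  obtain ⟨xh', hxh', hmax, -, -, hgrow⟩ := (hreg u hu).exists_max c hc
  have := huniq xh' (ball_subset_ball hρR hxh') hmax
  subst this
  have := hgrow x hx
  linarith

/-- The three contributions to the displacement, collected into the bracket of the constant
`C̃`; the only slack is `√8 ≤ 4` in the first one. -/
lemma Ctilde_sqrt_bound {M R θ B Φ : ℝ} (hM : 0 < M) (hR : 0 < R) (hθ : 0 < θ) (hΦ : 0 ≤ Φ) :
    M * √(8 * R * Φ / θ) + √M * √(4 * Φ / θ) + 2 * B * √Φ ≤
      2 * (2 * M * √(R / θ) + B + √(M / θ)) * √Φ := by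
  have h1 : √(8 * R * Φ / θ) ≤ 4 * √(R / θ) * √Φ := by
    rw [mul_assoc 4, ← Real.sqrt_mul (by positivity)]
    refine Real.sqrt_le_iff.2 ⟨by positivity, ?_⟩
    rw [mul_pow, Real.sq_sqrt (by positivity)]
    have : 0 ≤ R * Φ / θ := by positivity
    have h2 : 8 * R * Φ / θ = 8 * (R * Φ / θ) := by ring
    have h3 : R / θ * Φ = R * Φ / θ := by ring
    rw [h2, h3]; linarith
  have h2 : √M * √(4 * Φ / θ) = 2 * √(M / θ) * √Φ := by
    have h3 : (2 : ℝ) = √4 := by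
      rw [show (4 : ℝ) = 2 ^ 2 by norm_num, Real.sqrt_sq zero_le_two]
    rw [h3, ← Real.sqrt_mul hM.le, ← Real.sqrt_mul (by norm_num), ← Real.sqrt_mul (by positivity)]
    congr 1; ring
  rw [h2]
  nlinarith [mul_le_mul_of_nonneg_left h1 hM.le]

/-- Moving the mass of each cluster to a point of small gradient changes `K u` by at most
`C̃ √Φ`, where `Φ` bounds the residual, the gradients at these points and the defect of `u`. -/
lemma Nondegenerate.exists_lumping_bound (hP : P.Nondegenerate ubar γ θ R' σ') (h0 : ubar ≠ 0)
    (q : LPDAPParams) (hγ : q.γ = γ) (hθ : q.θ = θ) (hR0 : 0 < q.R) (hR : q.R < R')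
    (hb : P.Bounds ubar R' q.L q.CK q.CK') (hM : 0 < q.M) :
    ∃ δ : ℝ, 0 < δ ∧ ∀ u : P.Sparse, P.res (P.toMeas u) ≤ δ → ‖P.toMeas u‖ ≤ q.M →
      P.Clustered ubar q.R u → P.Regular ubar θ q.R q.σ (P.toMeas u) →
      ∀ (Φ : ℝ) (Z : P.Ω → P.Ω), P.res (P.toMeas u) ≤ Φ →
      ‖P.pC (P.toMeas u)‖ * ‖P.toMeas u‖ - P.toMeas u (P.pC (P.toMeas u)) ≤ Φ →
      (∀ c ∈ ubar.support, (Z c : EuclideanSpace ℝ (Fin d)) ∈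
        ball (c : EuclideanSpace ℝ (Fin d)) q.R) →
      (∀ c ∈ ubar.support, ‖gradient (P.p (P.toMeas u)) (Z c)‖ ≤ Φ / 2) →
      ‖P.K (P.toMeas (u.mapDomain (Z ∘ P.center ubar R'))) - P.K (P.toMeas u)‖ ≤
        q.Ctilde * √Φ := by
  classical
  obtain ⟨ρ, hρ0, hρR', Δ, hΔ, hgrow'⟩ := hP.exists_improved_growth h0 hR0
  obtain ⟨τ, hτ, hfar⟩ := hP.exists_far_mass_le h0 hρ0
  have hθ0 := hP.θ_pos
  have hγ0 := hP.γ_pos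
  have hC' := hb.CK'_pos
  have hL0 := hb.L_pos
  set B := 2 * q.M * q.CK' * q.L / (θ * √γ) with hB
  have hB0 : 0 < B := by positivity
  refine ⟨min Δ ((B * τ / q.R) ^ 2), lt_min hΔ (by positivity),
    fun u hu huM hcl hreg Φ Z hrΦ hΦ hZ hgrad => ?_⟩
  have hr0 := hP.res_nonneg (P.toMeas u)
  have hΦ0 : 0 ≤ Φ := hr0.trans hrΦ
  choose! xh hxh hmax huniq hlip hgrow using hreg.exists_max
  set ctr := P.center ubar R' with hctr
  have hcl' := fun z hz => hP.clustered_center hR.le hcl (z := z) hz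
  have hle : ∀ z ∈ u.support, |P.p (P.toMeas u) z| ≤ |P.p (P.toMeas u) (xh (ctr z))| := by
    intro z hz
    have h1 := hgrow _ (hcl' z hz).1 z (hcl' z hz).2.1
    have : 0 ≤ θ / 8 * ‖xh (ctr z) - z‖ ^ 2 := by positivity
    linarith
  -- distance from the chosen point to the local maximizer
  have hd1 : ∀ c ∈ ubar.support, ‖xh c - Z c‖ ≤ √(8 * q.R * Φ / θ) := by
    intro c hc
    refine Real.le_sqrt_of_sq_le ?_
    have h1 := hgrow c hc (Z c) (hZ c hc)
    have h2 := hlip c hc (Z c) (hZ c hc)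
    have h3 := mul_le_mul_of_nonneg_left (hgrad c hc) (by positivity : 0 ≤ 2 * q.R)
    rw [le_div_iff₀ hθ0]
    linarith
  -- distance from the atoms to the local maximizer
  have hd2 : ∀ z ∈ u.support, ‖xh (ctr z) - z‖ ≤
      √(4 / θ * (|P.p (P.toMeas u) (xh (ctr z))| - |P.p (P.toMeas u) z|)) +
        if (z : EuclideanSpace ℝ (Fin d)) ∉ P.nbhd ubar ρ then 2 * q.R else 0 := by
    intro z hz
    obtain ⟨hc, hzb, -⟩ := hcl' z hz
    split_ifs with hn
    · obtain ⟨c, hc', hzc⟩ := mem_nbhd.1 hn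
      have hcc : ctr z = c := hP.center_eq hc' (ball_subset_ball hρR' hzc)
      rw [add_zero]
      refine Real.le_sqrt_of_sq_le ?_
      have h1 := hgrow' (P.toMeas u) (hu.trans (min_le_left _ _)) c hc' (xh c) (huniq c hc') z hzc
      rw [hcc]
      have h2 : ‖xh c - z‖ ^ 2 = 4 / θ * (θ / 4 * ‖xh c - z‖ ^ 2) := by field_simp
      rw [h2]
      exact mul_le_mul_of_nonneg_left h1 (by positivity)
    · have h1 := Real.sqrt_nonneg
        (4 / θ * (|P.p (P.toMeas u) (xh (ctr z))| - |P.p (P.toMeas u) z|))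
      rw [← dist_eq_norm]
      have h2 := dist_triangle_right (xh (ctr z)) z (ctr z)
      have h3 := mem_ball.1 (hxh _ hc)
      have h4 := mem_ball.1 hzb
      linarith
  rw [K_toMeas_mapDomain]
  have hK : P.K (P.toMeas u) = ∑ z ∈ u.support, u z • P.κ z := P.K_toMeas u
  rw [hK, ← Finset.sum_sub_distrib]
  have hterm : ∀ z ∈ u.support, ‖u z • P.κ ((Z ∘ ctr) z) - u z • P.κ z‖ ≤
      q.CK' * (|u z| * √(8 * q.R * Φ / θ) +
      |u z| * √(4 / θ * (|P.p (P.toMeas u) (xh (ctr z))| - |P.p (P.toMeas u) z|)) +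
      if (z : EuclideanSpace ℝ (Fin d)) ∉ P.nbhd ubar ρ then 2 * q.R * |u z| else 0) := by
    intro z hz
    obtain ⟨hc, hzb, -⟩ := hcl' z hz
    rw [← smul_sub, norm_smul, Real.norm_eq_abs, Function.comp_apply]
    have h1 := hP.norm_κ_sub_le hb hc (ball_subset_ball hR.le hzb)
      (ball_subset_ball hR.le (hZ _ hc))
    have h2 : ‖(Z (ctr z) : EuclideanSpace ℝ (Fin d)) - z‖ ≤
        ‖xh (ctr z) - Z (ctr z)‖ + ‖xh (ctr z) - z‖ := by
      rw [norm_sub_rev (xh (ctr z)) (Z (ctr z) : EuclideanSpace ℝ (Fin d))]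
      exact norm_sub_le_norm_sub_add_norm_sub _ _ _
    have h3 := h2.trans (add_le_add (hd1 _ hc) (hd2 z hz))
    have h4 := mul_le_mul_of_nonneg_left (h1.trans (mul_le_mul_of_nonneg_left h3 hC'.le))
      (abs_nonneg (u z))
    refine h4.trans_eq ?_
    split_ifs <;> ring
  refine (norm_sum_le _ _).trans ((Finset.sum_le_sum hterm).trans ?_)
  rw [← Finset.mul_sum, Finset.sum_add_distrib, Finset.sum_add_distrib, ← Finset.sum_mul,
    ← norm_toMeas, ← Finset.sum_filter, ← Finset.mul_sum]
  -- the three contributions: moving the maximizers, moving the atoms, and the far atoms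
  have hS1 : ‖P.toMeas u‖ * √(8 * q.R * Φ / θ) ≤ q.M * √(8 * q.R * Φ / θ) := by gcongr
  have hS2 : ∑ z ∈ u.support,
      |u z| * √(4 / θ * (|P.p (P.toMeas u) (xh (ctr z))| - |P.p (P.toMeas u) z|)) ≤
      √q.M * √(4 * Φ / θ) := by
    refine (sum_mul_sqrt_le _ (fun _ _ => abs_nonneg _) fun z hz => mul_nonneg (by positivity)
      (sub_nonneg.2 (hle z hz))).trans ?_
    rw [← norm_toMeas]
    have h1 : ∑ z ∈ u.support,
        |u z| * (4 / θ * (|P.p (P.toMeas u) (xh (ctr z))| - |P.p (P.toMeas u) z|)) ≤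
        4 / θ * Φ := by
      have h2 : ∑ z ∈ u.support,
          |u z| * (4 / θ * (|P.p (P.toMeas u) (xh (ctr z))| - |P.p (P.toMeas u) z|)) ≤
          4 / θ * (‖P.pC (P.toMeas u)‖ * ‖P.toMeas u‖ - P.toMeas u (P.pC (P.toMeas u))) := by
        rw [norm_toMeas, toMeas_apply_pC, Finset.mul_sum, ← Finset.sum_sub_distrib,
          Finset.mul_sum]
        refine Finset.sum_le_sum fun z hz => ?_
        have h3 := P.abs_p_le_norm_pC (P.toMeas u)
          ⟨xh (ctr z), hP.mem_Ω (mem_nbhd.2 ⟨_, (hcl' z hz).1,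
            ball_subset_ball hR.le (hxh _ (hcl' z hz).1)⟩)⟩
        have h4 := le_abs_self (u z * P.p (P.toMeas u) z)
        rw [abs_mul] at h4
        have h5 := mul_le_mul_of_nonneg_left h3 (abs_nonneg (u z))
        have h6 : |u z| * (|P.p (P.toMeas u) (xh (ctr z))| - |P.p (P.toMeas u) z|) ≤
            ‖P.pC (P.toMeas u)‖ * |u z| - u z * P.p (P.toMeas u) z := by
          simp only at h5
          linarith
        have h7 := mul_le_mul_of_nonneg_left h6 (by positivity : 0 ≤ 4 / θ)
        linarith
      exact h2.trans (mul_le_mul_of_nonneg_left hΦ (by positivity))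
    have h8 : 4 * Φ / θ = 4 / θ * Φ := by ring
    rw [h8]
    gcongr
  have hS3 : 2 * q.R * ∑ z ∈ u.support.filter
      (fun z : P.Ω => (z : EuclideanSpace ℝ (Fin d)) ∉ P.nbhd ubar ρ), |u z| ≤ 2 * B * √Φ := by
    have h1 := hfar u
    have h2 : P.res (P.toMeas u) ≤ B * τ / q.R * √Φ := by
      have h3 : √(P.res (P.toMeas u)) ≤ B * τ / q.R := by
        refine Real.sqrt_le_iff.2 ⟨by positivity, hu.trans (min_le_right _ _)⟩
      have h4 := Real.sqrt_le_sqrt hrΦ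
      calc P.res (P.toMeas u) = √(P.res (P.toMeas u)) * √(P.res (P.toMeas u)) :=
            (Real.mul_self_sqrt hr0).symm
        _ ≤ B * τ / q.R * √Φ := by gcongr
    have h5 := h1.trans h2
    set S := ∑ z ∈ u.support.filter
      (fun z : P.Ω => (z : EuclideanSpace ℝ (Fin d)) ∉ P.nbhd ubar ρ), |u z|
    have h6 : B * τ / q.R * √Φ = τ * (B * √Φ / q.R) := by ring
    rw [h6] at h5
    have h7 := le_of_mul_le_mul_left h5 hτ
    rw [le_div_iff₀ hR0] at h7
    linarith
  have hfinal := Ctilde_sqrt_bound (B := B) hM hR0 hθ0 hΦ0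
  have hCt : q.Ctilde * √Φ =
      q.CK' * (2 * (2 * q.M * √(q.R / θ) + B + √(q.M / θ)) * √Φ) := by
    rw [LPDAPParams.Ctilde, hγ, hθ]; ring
  rw [hCt]
  exact mul_le_mul_of_nonneg_left (by linarith) hC'.le

lemma exists_abs_p_eq_norm_pC (u : P.Meas) (x₀ : P.Ω) :
    ∃ x : P.Ω, |P.p u x| = ‖P.pC u‖ := by
  obtain ⟨x, -, hx⟩ := isCompact_univ.exists_isMaxOn ⟨x₀, mem_univ x₀⟩
    ((P.pC u).continuous.abs.continuousOn)
  refine ⟨x, le_antisymm (P.abs_p_le_norm_pC u x) ?_⟩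
  exact (ContinuousMap.norm_le _ (abs_nonneg _)).2 fun y => hx (mem_univ y)

lemma Ctilde_pos {q : LPDAPParams} (hC' : 0 < q.CK') (hM : 0 < q.M) (hθ : 0 < q.θ)
    (hγ : 0 < q.γ) (hL : 0 < q.L) : 0 < q.Ctilde := by
  rw [LPDAPParams.Ctilde]; positivity

/-- The quadratic model of one local support improvement with step length
`min 1 (μ̂ / (4 M L C̃²))`. -/
lemma step_decrease {r r' Φ G D2 m μ M L Ct η ζ : ℝ} (hM : 0 < M) (hL : 0 < L) (hCt : 0 < Ct)
    (hμ : 0 < μ) (hμm : μ ≤ m) (hη : η = min 1 (m / (4 * M * L * Ct ^ 2))) (hΦ : r ≤ Φ)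
    (hr : 0 ≤ r)
    (hG : m * (Φ / (4 * M)) ≤ G) (hD2 : D2 ≤ Ct ^ 2 * Φ)
    (h : r' ≤ r - η * G + η ^ 2 * (L / 2) * D2)
    (hζ : ζ = 1 - μ / (8 * M) * min 1 (μ / (4 * M * L * Ct ^ 2))) : r' ≤ ζ * r := by
  have hm : 0 < m := hμ.trans_le hμm
  have hΦ0 : 0 ≤ Φ := hr.trans hΦ
  have hη0 : 0 < η := by rw [hη]; positivity
  have h1 : η * (4 * M * L * Ct ^ 2) ≤ m := by
    rw [← le_div_iff₀ (by positivity), hη]; exact min_le_right _ _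
  have h2 : min 1 (μ / (4 * M * L * Ct ^ 2)) ≤ η := by
    rw [hη]; gcongr
  have h3 : η ^ 2 * (L / 2) * D2 ≤ η * m * Φ / (8 * M) := by
    have h4 : η ^ 2 * (L / 2) * D2 ≤ η ^ 2 * (L / 2) * (Ct ^ 2 * Φ) := by gcongr
    have h5 : η ^ 2 * (L / 2) * (Ct ^ 2 * Φ) = η * (η * (4 * M * L * Ct ^ 2)) * Φ / (8 * M) := by
      field_simp; ring
    rw [h5] at h4
    refine h4.trans ?_
    gcongr
  have h6 : η * (m * (Φ / (4 * M))) ≤ η * G := by gcongr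
  have h7 : η * (m * (Φ / (4 * M))) = 2 * (η * m * Φ / (8 * M)) := by field_simp; ring
  have h8 : r' ≤ r - η * m * Φ / (8 * M) := by linarith
  have h9 : μ / (8 * M) * min 1 (μ / (4 * M * L * Ct ^ 2)) * r ≤ η * m * Φ / (8 * M) := by
    calc μ / (8 * M) * min 1 (μ / (4 * M * L * Ct ^ 2)) * r ≤ m / (8 * M) * η * Φ := by gcongr
      _ = η * m * Φ / (8 * M) := by ring
  rw [hζ]; linarith

/-- One local support improvement contracts the residual by `ζ`, once the residual is small, the
measure is clustered, and the gap over its own support is at most half of the global gap. -/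
lemma Nondegenerate.exists_lsi_contraction (hP : P.Nondegenerate ubar γ θ R' σ') (h0 : ubar ≠ 0)
    (q : LPDAPParams) (hγ : q.γ = γ) (hθ : q.θ = θ) (hR0 : 0 < q.R) (hR : q.R < R')
    (hσ0 : 0 < q.σ) (hσ : q.σ ≤ σ') (hadm : P.AdmissibleRadius ubar θ q.R q.σ)
    (hb : P.Bounds ubar R' q.L q.CK q.CK') (hM : 0 < q.M) (hubarM : ‖P.toMeas ubar‖ ≤ q.M) :
    ∃ δ : ℝ, 0 < δ ∧ ∀ u : P.Sparse, P.res (P.toMeas u) ≤ δ → ‖P.toMeas u‖ ≤ q.M →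
      P.Clustered ubar q.R u → ∀ v : P.Meas, ‖v‖ ≤ q.M → 0 < P.gap (P.toMeas u) v →
      P.supportGap q.M u ≤ P.gap (P.toMeas u) v / 2 → ∀ ut : P.Sparse, P.IsLSIStep q u ut →
      P.res (P.toMeas ut) ≤ q.zeta (P.muBar ubar) * P.res (P.toMeas u) := by
  classical
  obtain ⟨δ₁, hδ₁, hregular⟩ := hadm.exists_regular hP hR0 hR
  obtain ⟨δ₂, hδ₂, hmass⟩ := hP.exists_muBar_le_clusterMass h0 hR.le hM
  obtain ⟨δ₃, hδ₃, hlump⟩ := hP.exists_lumping_bound h0 q hγ hθ hR0 hR hb hM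
  obtain ⟨δ₄, hδ₄, hclose⟩ := hP.exists_abs_p_sub_lt h0 (ε := q.σ / 2) (by positivity)
  refine ⟨min (min δ₁ δ₂) (min δ₃ δ₄), by positivity,
    fun u hu huM hcl v hvM hG0 hgap ut hut => ?_⟩
  have hreg := hregular _ (hu.trans ((min_le_left _ _).trans (min_le_left _ _)))
  have hmassu := hmass u (hu.trans ((min_le_left _ _).trans (min_le_right _ _))) huM hcl
  have hlumpu := hlump u (hu.trans ((min_le_right _ _).trans (min_le_left _ _))) huM hcl hreg
  have hcloseu := hclose _ (hu.trans ((min_le_right _ _).trans (min_le_right _ _)))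
  have hμ := muBar_pos (P := P) h0
  have hθ0 := hP.θ_pos
  have hσα : q.σ < P.α := hσ.trans_lt hP.σ'_lt
  set ctr := P.center ubar R' with hctr
  have hcl' := fun z hz => hP.clustered_center hR.le hcl (z := z) hz
  set N := ‖P.pC (P.toMeas u)‖ with hN
  set S := P.α * ‖P.toMeas u‖ - P.toMeas u (P.pC (P.toMeas u)) with hS
  set G := P.gap (P.toMeas u) v with hG
  have hSG : S ≤ G / 2 := (defect_le_supportGap hM.le u).trans hgap
  have hGle : G ≤ q.M * max 0 (N - P.α) + S := gap_le hvM
  -- otherwise the gap would be at most the defect `S`, which is at most half of it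
  have hNα : P.α < N := by
    by_contra! h
    rw [max_eq_left (by linarith), mul_zero] at hGle
    linarith
  rw [max_eq_right (by linarith)] at hGle
  -- the maximal gap over the ball of radius `M`
  set Φ := q.M * (N - P.α) + S with hΦ
  have hresΦ : P.res (P.toMeas u) ≤ Φ := by
    have h1 := (hP.res_le_gap (P.toMeas u)).trans (gap_le hubarM)
    rwa [← hN, max_eq_right (by linarith)] at h1
  -- the local maximizers of `|p_u|` are above the threshold of the support improver
  have hpc : ∀ c ∈ ubar.support, P.α - q.σ / 2 < |P.p (P.toMeas u) c| := by
    intro c hc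
    have h1 := hcloseu c c.2
    have h2 := abs_sub_abs_le_abs_sub (P.p (P.toMeas ubar) c) (P.p (P.toMeas u) c)
    rw [hP.abs_p_support hc, abs_sub_comm] at h2
    linarith
  -- every cluster is occupied
  have himg : u.support.image ctr = ubar.support := by
    ext c
    simp only [Finset.mem_image]
    constructor
    · rintro ⟨z, hz, rfl⟩
      exact (hcl' z hz).1
    · intro hc
      by_contra! hno
      have h1 := hmassu c hc
      have h2 : P.clusterMass ubar R' u c = 0 := by
        rw [clusterMass, Finset.filter_false_of_mem (fun z hz => hno z hz), Finset.sum_empty]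
      rw [h2, abs_zero] at h1
      linarith
  obtain ⟨Bs, μhat, η, hloop, -, hμhat, hη, hut⟩ := hut
  obtain ⟨Z, hBZ, hZ⟩ := hloop.exists_selection (ctr := ctr)
    (fun x hx z hz => hP.dist_lt_iff_center hR hcl (hcl' x hx).1 (hcl' x hx).2.1 hz)
    (fun x hx => hP.exists_isLSIPoint hR0 hR hreg hpc hσα huM hcl hx) subset_rfl
  rw [himg] at hBZ hZ
  have hZb : ∀ c ∈ ubar.support, (Z c : EuclideanSpace ℝ (Fin d)) ∈
      ball (c : EuclideanSpace ℝ (Fin d)) q.R := by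
    intro c hc
    obtain ⟨x, hx, hxc, hxy⟩ := hZ c hc
    refine hP.isLSIPoint_mem_ball hR hreg hc ?_ hxy
    rw [← hxc]; exact (hcl' x hx).2.1
  have hgrad : ∀ c ∈ ubar.support, ‖gradient (P.p (P.toMeas u)) (Z c)‖ ≤ Φ / 2 := by
    intro c hc
    obtain ⟨x, hx, hxc, hxy⟩ := hZ c hc
    have := hxy.2.2.2.2.1
    linarith
  have hgain : ∀ c ∈ ubar.support, 2 * q.R * ‖gradient (P.p (P.toMeas u)) (Z c)‖ ≤
      |P.p (P.toMeas u) (Z c)| - P.nearMax q u (Z c) := by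
    intro c hc
    obtain ⟨x, hx, hxc, hxy⟩ := hZ c hc
    have h1 := hxy.2.2.2.2.2
    have hxb := (hcl' x hx).2.1
    rw [← hctr, hxc] at hxb
    rwa [hP.nearMax_eq q hR hcl hc hxb, ← hP.nearMax_eq q hR hcl hc (hZb c hc)] at h1
  have hnear : ∀ z ∈ u.support, |P.p (P.toMeas u) z| ≤ P.nearMax q u (Z (ctr z)) := by
    intro z hz
    exact abs_p_le_nearMax q hz ((hP.dist_lt_iff_center hR hcl (hcl' z hz).1
      (hZb _ (hcl' z hz).1) hz).2 rfl)
  have hinj : Set.InjOn Z (ubar.support : Set P.Ω) := by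
    intro c hc c' hc' h
    refine hP.center_unique hc hc' (x := Z c) (ball_subset_ball (by linarith) (hZb c hc)) ?_
    rw [h]; exact ball_subset_ball (by linarith) (hZb c' hc')
  -- the cluster containing a global maximizer of the dual variable has a large gain
  obtain ⟨x₀, hx₀⟩ := Finsupp.support_nonempty_iff.2 h0
  obtain ⟨xg, hxg⟩ := exists_abs_p_eq_norm_pC (P.toMeas u) x₀
  have hxgn : (xg : EuclideanSpace ℝ (Fin d)) ∈ P.nbhd ubar q.R := by
    by_contra hn
    have := hreg.off xg xg.2 hn
    linarith
  obtain ⟨c₀, hc₀, hxgc⟩ := mem_nbhd.1 hxgn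
  have hgain₀ : Φ / (4 * q.M) ≤ |P.p (P.toMeas u) (Z c₀)| - P.nearMax q u (Z c₀) := by
    obtain ⟨xh, hxh, -, -, hlip, hgrow⟩ := hreg.exists_max c₀ hc₀
    have h1 := hgrow xg hxgc
    have h2 : 0 ≤ θ / 8 * ‖xh - xg‖ ^ 2 := by positivity
    have h3 := hlip (Z c₀) (hZb c₀ hc₀)
    have h4 := hgain c₀ hc₀
    have h5 : P.nearMax q u (Z c₀) ≤ N - Φ / (2 * q.M) := by
      rw [hP.nearMax_eq q hR hcl hc₀ (hZb c₀ hc₀)]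
      have hne : c₀ ∈ u.support.image ctr := by rw [himg]; exact hc₀
      obtain ⟨z₀, hz₀, hz₀c⟩ := Finset.mem_image.1 hne
      refine csSup_le ⟨_, ⟨z₀, ⟨hz₀, hz₀c⟩, rfl⟩⟩ ?_
      rintro _ ⟨z, ⟨hz, -⟩, rfl⟩
      have h6 := (add_defect_le_supportGap hM.le hz).trans hgap
      rw [le_sub_iff_add_le, ← le_sub_iff_add_le', div_le_iff₀ (by positivity)]
      simp only
      linarith
    have h7 : Φ / (4 * q.M) = Φ / (2 * q.M) / 2 := by ring
    rw [h7]
    linarith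
  obtain ⟨yh, hyB, hyhmax, hμ'⟩ := hμhat (by
    rw [hBZ]; exact (Finset.image_nonempty.2 ⟨x₀, hx₀⟩))
  rw [hBZ] at hyB hyhmax
  obtain ⟨ch, hch, rfl⟩ := Finset.mem_image.1 hyB
  have hgainh : Φ / (4 * q.M) ≤ |P.p (P.toMeas u) (Z ch)| - P.nearMax q u (Z ch) :=
    hgain₀.trans (hyhmax _ (Finset.mem_image_of_mem Z hc₀))
  have hbm : ∀ c ∈ ubar.support, P.ballMass q u (Z c) = P.clusterMass ubar R' u c :=
    fun c hc => hP.ballMass_eq q hR hcl hc (hZb c hc)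
  rw [hbm ch hch] at hμ'
  have hlumped : P.lumped q u Bs = u.mapDomain (Z ∘ ctr) := by
    rw [hBZ, ← himg]
    refine lumped_eq_mapDomain u (by rw [himg]; exact hinj) fun c hc => ?_
    rw [himg] at hc
    rw [hbm c hc, clusterMass]
  rw [hlumped] at hut
  have hnormv := norm_toMeas_mapDomain_le u (Z ∘ ctr)
  have hsgn : ∀ z ∈ u.support, ∀ x ∈ ball (ctr z : EuclideanSpace ℝ (Fin d)) q.R,
      u z * P.p (P.toMeas u) x = |u z| * |P.p (P.toMeas u) x| := by
    intro z hz x hx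
    have h1 := hreg.sign_eq (ctr z) (hcl' z hz).1 x hx
    rw [← (hcl' z hz).2.2] at h1
    rw [← abs_mul]
    refine (abs_of_nonneg ?_).symm
    rcases lt_trichotomy (u z) 0 with h | h | h
    · rw [Real.sign_of_neg h] at h1
      refine mul_nonneg_of_nonpos_of_nonpos h.le ?_
      by_contra! hpos
      rw [Real.sign_of_pos hpos] at h1; norm_num at h1
    · rw [h, zero_mul]
    · rw [Real.sign_of_pos h] at h1
      refine mul_nonneg h.le ?_
      by_contra! hneg
      rw [Real.sign_of_neg hneg] at h1; norm_num at h1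
  have hgapv : μhat * (Φ / (4 * q.M)) ≤
      P.gap (P.toMeas u) (P.toMeas (u.mapDomain (Z ∘ ctr))) := by
    have h1 : ∑ z ∈ u.support,
        |u z| * (|P.p (P.toMeas u) (Z (ctr z))| - |P.p (P.toMeas u) z|) ≤
        P.gap (P.toMeas u) (P.toMeas (u.mapDomain (Z ∘ ctr))) := by
      have h2 : P.toMeas (u.mapDomain (Z ∘ ctr)) (P.pC (P.toMeas u)) -
          P.toMeas u (P.pC (P.toMeas u)) = ∑ z ∈ u.support,
        |u z| * (|P.p (P.toMeas u) (Z (ctr z))| - |P.p (P.toMeas u) z|) := by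
        rw [toMeas_mapDomain_apply, toMeas_apply_pC, ← Finset.sum_sub_distrib]
        refine Finset.sum_congr rfl fun z hz => ?_
        rw [mul_sub, ← hsgn z hz _ (hZb _ (hcl' z hz).1), ← hsgn z hz _ (hcl' z hz).2.1]
        rfl
      rw [gap, sub_apply, h2]
      have h3 := mul_le_mul_of_nonneg_left hnormv P.α_pos.le
      linarith
    refine le_trans ?_ h1
    have hnonneg : ∀ z ∈ u.support,
        0 ≤ |u z| * (|P.p (P.toMeas u) (Z (ctr z))| - |P.p (P.toMeas u) z|) := by
      intro z hz
      have h2 := hgain _ (hcl' z hz).1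
      have h3 := hnear z hz
      have h4 : 0 ≤ 2 * q.R * ‖gradient (P.p (P.toMeas u)) (Z (ctr z))‖ := by positivity
      exact mul_nonneg (abs_nonneg _) (by linarith)
    refine le_trans ?_ (Finset.sum_le_sum_of_subset_of_nonneg
      (Finset.filter_subset (fun z => ctr z = ch) u.support) fun z hz _ => hnonneg z hz)
    have hΦ0 : 0 ≤ Φ / (4 * q.M) := by
      have := hP.res_nonneg (P.toMeas u)
      exact div_nonneg (by linarith) (by positivity)
    have h5 : μhat ≤ ∑ z ∈ u.support.filter (fun z => ctr z = ch), |u z| := by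
      rw [hμ', clusterMass]
      exact Finset.abs_sum_le_sum_abs _ _
    refine (mul_le_mul_of_nonneg_right h5 hΦ0).trans ?_
    rw [Finset.sum_mul]
    refine Finset.sum_le_sum fun z hz => ?_
    obtain ⟨hz, hzc⟩ := Finset.mem_filter.1 hz
    have h6 := hnear z hz
    rw [hzc] at h6 ⊢
    exact mul_le_mul_of_nonneg_left (by linarith) (abs_nonneg _)
  have hKd := hlumpu Φ Z hresΦ (by nlinarith) hZb hgrad
  have hCt : 0 < q.Ctilde := Ctilde_pos hb.CK'_pos hM (hθ ▸ hθ0) (hγ ▸ hP.γ_pos) hb.L_pos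
  have hΦ0 : 0 ≤ Φ := (hP.res_nonneg _).trans hresΦ
  have hη' : η = min 1 (μhat / (4 * q.M * q.L * q.Ctilde ^ 2)) := by
    rw [hη, LPDAPParams.Ctilde]; congr 2; ring
  have hμm : P.muBar ubar ≤ μhat := by rw [hμ']; exact hmassu ch hch
  have hη0 : 0 ≤ η := by
    rw [hη']; have := hb.L_pos; have := hμ.trans_le hμm; positivity
  have hη1 : η ≤ 1 := by rw [hη']; exact min_le_left _ _
  have hJ := P.J_segment_le hb.lipschitz (P.toMeas u)
    (P.toMeas (u.mapDomain (Z ∘ ctr))) hη0 hη1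
  have hutM : P.toMeas ut =
      (1 - η) • P.toMeas u + η • P.toMeas (u.mapDomain (Z ∘ ctr)) := by
    rw [hut, map_add, map_smul, map_smul]
  rw [← hutM] at hJ
  refine step_decrease (Φ := Φ) hM hb.L_pos hCt hμ hμm hη' hresΦ (hP.res_nonneg _) hgapv
    (D2 := ‖P.K (P.toMeas (u.mapDomain (Z ∘ ctr))) - P.K (P.toMeas u)‖ ^ 2) ?_ ?_ rfl
  · have := pow_le_pow_left₀ (norm_nonneg _) hKd 2
    rwa [mul_pow, Real.sq_sqrt hΦ0] at this
  · rw [hP.res_eq, hP.res_eq]; linarith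

end SparseProblem

/-! ### The rate implied by the recursion of the algorithm -/

/-- A scalar recursion with two kinds of steps. A step raising `s` halves the tolerance `Ψ`, which
bounds the next value; a step raising `k` decreases the value, and contracts it by `ζ` once the
value is small and the predicate `cl` holds. Since the value is bounded both by a multiple of
`ζ ^ k` and of `2 ^ (-s)`, it is bounded by a multiple of `ζ ^ ((k + s) / 2)`; the exponent
`(k + s) / 3` absorbs the constant. -/
lemma rate_of_recursion {k s : ℕ → ℕ} {r rm Ψ : ℕ → ℝ} {cl : ℕ → Prop} {C δ ζ : ℝ}
    (hC : 0 < C) (hδ : 0 < δ) (hζ0 : 1 / 2 ≤ ζ) (hζ1 : ζ < 1) (hk0 : k 0 = 1) (hs0 : s 0 = 0)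
    (hr : ∀ n, 0 ≤ r n) (hrm : ∀ n, r n ≤ rm n)
    (hstep : ∀ n,
      (k (n + 1) = k n ∧ s (n + 1) = s n + 1 ∧ rm (n + 1) = rm n ∧ Ψ (n + 1) = Ψ n / 2 ∧
        r (n + 1) ≤ 9 * Ψ (n + 1) ∧ (cl n → cl (n + 1))) ∨
      (k (n + 1) = k n + 1 ∧ s (n + 1) = s n ∧ Ψ (n + 1) = Ψ n ∧
        rm (n + 1) ≤ r n - 1 / 4 * min 1 (r n / (2 * C)) * r n ∧ (r n ≤ δ → cl (n + 1)) ∧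
        (cl n → rm n ≤ δ → rm (n + 1) ≤ ζ * r n))) :
    ∃ n₀ : ℕ, ∀ n, n₀ ≤ k n + s n → r n ≤ ζ ^ (((k n + s n : ℕ) : ℝ) / 3) := by
  have hζ : 0 < ζ := by linarith
  have hrm0 : ∀ n, 0 ≤ rm n := fun n => (hr n).trans (hrm n)
  have hdec : ∀ n, 0 ≤ 1 / 4 * min 1 (r n / (2 * C)) * r n := fun n => by
    have := hr n; positivity
  have hanti1 : ∀ n, rm (n + 1) ≤ rm n := fun n => by
    rcases hstep n with h | h
    · exact h.2.2.1.le
    · linarith [h.2.2.2.1, hdec n, hrm n]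
  have hanti : Antitone rm := antitone_nat_of_succ_le hanti1
  have hkmono : Monotone k := monotone_nat_of_le_succ fun n => by
    rcases hstep n with h | h <;> omega
  -- the bound in terms of `s`
  have hΨ : ∀ n, Ψ n = Ψ 0 * (1 / 2) ^ s n := fun n => by
    induction n with
    | zero => simp [hs0]
    | succ n ih =>
      rcases hstep n with h | h
      · rw [h.2.2.2.1, h.2.1, ih]; ring
      · rw [h.2.2.1, h.2.1, ih]
  have hsbound : ∀ n, s n = 0 ∨ r n ≤ 9 * Ψ n := fun n => by
    induction n with
    | zero => exact Or.inl hs0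
    | succ n ih =>
      rcases hstep n with h | h
      · exact Or.inr h.2.2.2.2.1
      · rcases ih with ih | ih
        · exact Or.inl (h.2.1.trans ih)
        · right; rw [h.2.2.1]; linarith [h.2.2.2.1, hdec n, hrm (n + 1)]
  -- the bound in terms of `k`
  have hkbound : ∃ c : ℝ, ∀ n, r n ≤ c * ζ ^ k n := by
    by_cases hbdd : ∃ K, ∀ n, k n ≤ K
    · obtain ⟨K, hK⟩ := hbdd
      refine ⟨rm 0 / ζ ^ K, fun n => ?_⟩
      have h1 : ζ ^ K ≤ ζ ^ k n := pow_le_pow_of_le_one hζ.le hζ1.le (hK n)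
      calc r n ≤ rm 0 := (hrm n).trans (hanti (Nat.zero_le n))
        _ = rm 0 / ζ ^ K * ζ ^ K := by field_simp
        _ ≤ rm 0 / ζ ^ K * ζ ^ k n :=
          mul_le_mul_of_nonneg_left h1 (div_nonneg (hrm0 0) (by positivity))
    push Not at hbdd
    have hsmall : ∃ N, rm N ≤ δ := by
      by_contra! hlarge
      set e := 1 / 4 * min 1 (δ / (2 * C)) * δ with he
      have he0 : 0 < e := by positivity
      have hlin : ∀ n, rm n ≤ rm 0 - e * ((k n : ℝ) - 1) := fun n => by
        induction n with
        | zero => simp [hk0]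
        | succ n ih =>
          rcases hstep n with h | h
          · rw [h.2.2.1, h.1]; exact ih
          · have h1 : δ ≤ r n := by linarith [hlarge (n + 1), h.2.2.2.1, hdec n]
            have h2 : e ≤ 1 / 4 * min 1 (r n / (2 * C)) * r n := by
              have := hr n
              rw [he]; gcongr
            rw [h.1]; push_cast
            linarith [h.2.2.2.1, hrm n]
      obtain ⟨K, hK⟩ := exists_nat_gt (rm 0 / e + 1)
      obtain ⟨n, hn⟩ := hbdd K
      have h1 := hlin n
      have h2 : rm 0 / e < (k n : ℝ) - 1 := by
        have : (K : ℝ) < k n := by exact_mod_cast hn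
        linarith
      rw [div_lt_iff₀ he0] at h2
      linarith [hrm0 n]
    obtain ⟨N, hN⟩ := hsmall
    have hcl : ∀ n, N ≤ n → k n = k N ∨ cl n := fun n hn => by
      induction n, hn using Nat.le_induction with
      | base => exact Or.inl rfl
      | succ n hn ih =>
        rcases hstep n with h | h
        · rcases ih with ih | ih
          · exact Or.inl (h.1.trans ih)
          · exact Or.inr (h.2.2.2.2.2 ih)
        · exact Or.inr (h.2.2.2.2.1 ((hrm n).trans ((hanti hn).trans hN)))
    obtain ⟨n₁, hn₁⟩ := hbdd (k N)
    have hNn₁ : N ≤ n₁ := by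
      by_contra! h
      exact absurd (hkmono h.le) (not_le.2 hn₁)
    have hcontr : ∀ n, n₁ ≤ n → rm n * ζ ^ k n₁ ≤ rm 0 * ζ ^ k n := fun n hn => by
      induction n, hn using Nat.le_induction with
      | base => exact mul_le_mul_of_nonneg_right (hanti (Nat.zero_le _)) (by positivity)
      | succ n hn ih =>
        rcases hstep n with h | h
        · rw [h.2.2.1, h.1]; exact ih
        · have hcn : cl n := (hcl n (hNn₁.trans hn)).resolve_left
            (by have := hkmono hn; omega)
          have h1 := h.2.2.2.2.2 hcn ((hanti (hNn₁.trans hn)).trans hN)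
          have h2 : rm (n + 1) ≤ ζ * rm n :=
            h1.trans (mul_le_mul_of_nonneg_left (hrm n) hζ.le)
          rw [h.1, pow_succ]
          calc rm (n + 1) * ζ ^ k n₁ ≤ ζ * rm n * ζ ^ k n₁ := by gcongr
            _ = ζ * (rm n * ζ ^ k n₁) := by ring
            _ ≤ ζ * (rm 0 * ζ ^ k n) := by gcongr
            _ = rm 0 * (ζ ^ k n * ζ) := by ring
    refine ⟨rm 0 / ζ ^ k n₁, fun n => ?_⟩
    rw [div_mul_eq_mul_div, le_div_iff₀ (by positivity)]
    rcases le_total n₁ n with hn | hn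
    · exact (mul_le_mul_of_nonneg_right (hrm n) (by positivity)).trans (hcontr n hn)
    · have h1 : ζ ^ k n₁ ≤ ζ ^ k n := pow_le_pow_of_le_one hζ.le hζ1.le (hkmono hn)
      exact mul_le_mul ((hrm n).trans (hanti (Nat.zero_le n))) h1 (by positivity) (hrm0 0)
  obtain ⟨c₁, hc₁⟩ := hkbound
  set c := max c₁ (max (rm 0) (9 * Ψ 0)) with hc
  have hc0 : 0 ≤ c := (hrm0 0).trans ((le_max_left _ _).trans (le_max_right _ _))
  have hk' : ∀ n, r n ≤ c * ζ ^ k n := fun n =>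
    (hc₁ n).trans (mul_le_mul_of_nonneg_right (le_max_left _ _) (by positivity))
  have hs' : ∀ n, r n ≤ c * ζ ^ s n := fun n => by
    rcases hsbound n with h | h
    · rw [h, pow_zero, mul_one]
      exact ((hrm n).trans (hanti (Nat.zero_le n))).trans
        ((le_max_left _ _).trans (le_max_right _ _))
    · rw [hΨ n, ← mul_assoc] at h
      refine h.trans ((mul_le_mul_of_nonneg_right (b := 9 * Ψ 0) (c := c)
        ((le_max_right _ _).trans (le_max_right _ _)) (by positivity)).trans ?_)
      exact mul_le_mul_of_nonneg_left (pow_le_pow_left₀ (by norm_num) hζ0 _) hc0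
  have hhalf : ∀ n, r n ≤ c * ζ ^ (((k n + s n : ℕ) : ℝ) / 2) := fun n => by
    have hcase : ∀ m : ℕ, ((k n + s n : ℕ) : ℝ) / 2 ≤ m → r n ≤ c * ζ ^ m →
        r n ≤ c * ζ ^ (((k n + s n : ℕ) : ℝ) / 2) := fun m hm h => by
      refine h.trans (mul_le_mul_of_nonneg_left ?_ hc0)
      rw [← Real.rpow_natCast]
      exact Real.rpow_le_rpow_of_exponent_ge hζ hζ1.le hm
    rcases le_total (s n) (k n) with h | h
    · refine hcase (k n) ?_ (hk' n)
      have : (s n : ℝ) ≤ k n := by exact_mod_cast h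
      push_cast; linarith
    · refine hcase (s n) ?_ (hs' n)
      have : (k n : ℝ) ≤ s n := by exact_mod_cast h
      push_cast; linarith
  -- the surplus in the exponent absorbs the constant
  have hlim : Tendsto (fun m : ℕ => c * ζ ^ ((m : ℝ) / 6)) atTop (𝓝 (c * 0)) := by
    refine Tendsto.const_mul c ?_
    refine (tendsto_rpow_atTop_of_base_lt_one ζ (by linarith) hζ1).comp ?_
    exact tendsto_natCast_atTop_atTop.atTop_div_const (by norm_num)
  rw [mul_zero] at hlim
  obtain ⟨n₀, hn₀⟩ := eventually_atTop.1 (hlim.eventually_lt_const zero_lt_one)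
  refine ⟨n₀, fun n hn => (hhalf n).trans ?_⟩
  have h1 := (hn₀ _ hn).le
  have h2 : ((k n + s n : ℕ) : ℝ) / 2 = ((k n + s n : ℕ) : ℝ) / 6 + ((k n + s n : ℕ) : ℝ) / 3 := by
    ring
  rw [h2, Real.rpow_add hζ, ← mul_assoc]
  exact mul_le_of_le_one_left (Real.rpow_nonneg hζ.le _) h1

/-! ### The coefficient step and the conditional gradient step -/

namespace SparseProblem

variable {d : ℕ} {Y : Type*} [NormedAddCommGroup Y] [InnerProductSpace ℝ Y] [CompleteSpace Y]
  {P : SparseProblem d Y} {ubar : P.Sparse} {γ θ R' σ' : ℝ}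

section CoefficientStep

variable {u w v : P.Sparse}

open Classical in
lemma signed_apply (u w : P.Sparse) (z : P.Ω) : P.signed u w z = Real.sign (u z) * w z := by
  rw [signed, Finsupp.finsetSum_apply]
  by_cases hz : z ∈ u.support
  · rw [Finset.sum_eq_single z (fun b _ hb => Finsupp.single_eq_of_ne (Ne.symm hb))
      (fun h => absurd hz h), Finsupp.single_eq_same]
  · rw [Finset.sum_eq_zero, Finsupp.notMem_support_iff.1 hz, Real.sign_zero, zero_mul]
    intro b hb
    exact Finsupp.single_eq_of_ne (fun h => hz (h ▸ hb))

lemma support_signed_subset (u w : P.Sparse) : (P.signed u w).support ⊆ u.support := by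
  intro z hz
  rw [Finsupp.mem_support_iff, signed_apply] at hz
  rw [Finsupp.mem_support_iff]
  rintro h
  rw [h, Real.sign_zero, zero_mul] at hz
  exact hz rfl

lemma abs_sign_of_ne_zero {t : ℝ} (h : t ≠ 0) : |Real.sign t| = 1 := by
  rcases Real.sign_apply_eq_of_ne_zero t h with h | h <;> simp [h]

lemma norm_toMeas_signed (hw : w.support ⊆ u.support) :
    ‖P.toMeas (P.signed u w)‖ = ‖P.toMeas w‖ := by
  rw [norm_toMeas_of_subset (support_signed_subset u w), norm_toMeas_of_subset hw]
  refine Finset.sum_congr rfl fun z hz => ?_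
  rw [signed_apply, abs_mul, abs_sign_of_ne_zero (Finsupp.mem_support_iff.1 hz), one_mul]

lemma coefK_eq (u w : P.Sparse) : P.coefK u w = P.K (P.toMeas (P.signed u w)) := by
  rw [K_toMeas, coefK, Finsupp.sum]
  have h : ∑ x ∈ (P.signed u w).support, P.signed u w x • P.κ x =
      ∑ x ∈ u.support, P.signed u w x • P.κ x :=
    Finset.sum_subset (support_signed_subset u w) fun x _ hx => by
      rw [Finsupp.notMem_support_iff.1 hx, zero_smul]
  rw [h]
  exact Finset.sum_congr rfl fun x _ => by rw [signed_apply]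

lemma coefJ_eq (hw : w.support ⊆ u.support) :
    P.coefJ u w = P.J (P.toMeas (P.signed u w)) := by
  rw [coefJ, J, coefK_eq, norm_toMeas_signed hw]

lemma coefJ_abs (u : P.Sparse) :
    P.coefJ u (u.mapRange (fun t : ℝ => |t|) abs_zero) = P.J (P.toMeas u) := by
  rw [coefJ_eq (Finsupp.support_mapRange)]
  congr 2
  ext z
  rw [signed_apply, Finsupp.mapRange_apply]
  rcases lt_trichotomy (u z) 0 with h | h | h
  · rw [Real.sign_of_neg h, abs_of_neg h]; ring
  · rw [h, Real.sign_zero, zero_mul]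
  · rw [Real.sign_of_pos h, abs_of_pos h, one_mul]

/-- The sign-constrained gap is the gap of the corresponding signed measures. -/
lemma coefGapFun_eq (hw : w.support ⊆ u.support) (hv : v.support ⊆ u.support) :
    P.coefGapFun u w v = P.gap (P.toMeas (P.signed u w)) (P.toMeas (P.signed u v)) := by
  rw [coefGapFun, gap, sub_apply, norm_toMeas_signed hw, norm_toMeas_signed hv,
    toMeas_apply_pC_of_subset (support_signed_subset u w),
    toMeas_apply_pC_of_subset (support_signed_subset u v), ← Finset.sum_sub_distrib]
  have h : ∑ z ∈ u.support, P.coefP u w z * (v z - w z) = ∑ z ∈ u.support,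
      (P.signed u v z * P.p (P.toMeas (P.signed u w)) z -
        P.signed u w z * P.p (P.toMeas (P.signed u w)) z) :=
    Finset.sum_congr rfl fun z _ => by
      rw [signed_apply, signed_apply, coefP, coefK_eq, p]
      ring
  rw [h]

lemma gap_signed_le_coefGap {q : LPDAPParams} (hw : w.support ⊆ u.support) (hv : P.IsPosOn u v)
    (hvM : ‖P.toMeas v‖ ≤ q.M) :
    P.gap (P.toMeas (P.signed u w)) (P.toMeas (P.signed u v)) ≤ P.coefGap q u w := by
  rw [← coefGapFun_eq hw hv.1]
  refine le_csSup ⟨q.M * max 0 (‖P.pC (P.toMeas (P.signed u w))‖ - P.α) +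
    (P.α * ‖P.toMeas (P.signed u w)‖ -
      P.toMeas (P.signed u w) (P.pC (P.toMeas (P.signed u w)))), ?_⟩ ⟨v, hv, hvM, rfl⟩
  rintro _ ⟨v, hv, hvM, rfl⟩
  rw [coefGapFun_eq hw hv.1]
  exact gap_le (by rwa [norm_toMeas_signed hv.1])

/-- If the dual variable has the signs of `u` on the support of `u`, the gap over all measures on
the support is attained at the sign-constrained ones. -/
lemma supportGap_signed_le_coefGap {q : LPDAPParams} (hM : 0 ≤ q.M) (hw : w.support ⊆ u.support)
    (hs : ∀ z ∈ u.support, Real.sign (P.p (P.toMeas (P.signed u w)) z) = Real.sign (u z)) :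
    P.supportGap q.M (P.signed u w) ≤ P.coefGap q u w := by
  refine csSup_le ⟨_, 0, by simp, by rw [norm_toMeas]; simpa using hM, rfl⟩ ?_
  rintro _ ⟨v, hv, hvM, rfl⟩
  set a : P.Sparse := v.mapRange (fun t : ℝ => |t|) abs_zero with ha
  have hvu : v.support ⊆ u.support := hv.trans (support_signed_subset u w)
  have hau : a.support ⊆ u.support := Finsupp.support_mapRange.trans hvu
  have hnorm : ‖P.toMeas a‖ = ‖P.toMeas v‖ := by
    rw [norm_toMeas_of_subset hau, norm_toMeas_of_subset hvu]
    exact Finset.sum_congr rfl fun z _ => by rw [ha, Finsupp.mapRange_apply, abs_abs]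
  refine le_trans ?_ (gap_signed_le_coefGap hw ⟨hau, fun x => abs_nonneg (v x)⟩
    (hnorm.trans_le hvM))
  rw [gap_eq, gap_eq, norm_toMeas_signed hau, hnorm,
    toMeas_apply_pC_of_subset (support_signed_subset u a), toMeas_apply_pC_of_subset hvu]
  have h : ∑ z ∈ u.support, v z * P.p (P.toMeas (P.signed u w)) z ≤
      ∑ z ∈ u.support, P.signed u a z * P.p (P.toMeas (P.signed u w)) z :=
    Finset.sum_le_sum fun z hz => by
      rw [signed_apply, ← hs z hz, ha, Finsupp.mapRange_apply, mul_right_comm, ← abs_eq_sign_mul,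
        ← abs_mul, mul_comm]
      exact le_abs_self _
  linarith

lemma sign_signed (hw : P.IsPosOn u w) {z : P.Ω} (hz : z ∈ (P.signed u w).support) :
    Real.sign (P.signed u w z) = Real.sign (u z) := by
  rw [Finsupp.mem_support_iff, signed_apply] at hz
  rw [signed_apply]
  have hwz : 0 < w z := lt_of_le_of_ne (hw.2 z) fun h => hz (by rw [← h, mul_zero])
  rcases lt_trichotomy (u z) 0 with h | h | h
  · rw [Real.sign_of_neg h, Real.sign_of_neg (by linarith)]
  · rw [h, Real.sign_zero, zero_mul, Real.sign_zero]
  · rw [Real.sign_of_pos h, one_mul, Real.sign_of_pos hwz]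

lemma Clustered.signed {R : ℝ} (hu : P.Clustered ubar R u) (hw : P.IsPosOn u w) :
    P.Clustered ubar R (P.signed u w) := by
  intro z hz
  obtain ⟨c, hc, hzc, hs⟩ := hu z (support_signed_subset u w hz)
  exact ⟨c, hc, hzc, (sign_signed hw hz).trans hs⟩

lemma IsCoefficientStep.J_le {q : LPDAPParams} {Ψ : ℝ} {uplus : P.Sparse}
    (h : P.IsCoefficientStep q u Ψ uplus w) : P.J (P.toMeas uplus) ≤ P.J (P.toMeas u) := by
  obtain ⟨h1, h2, -, rfl⟩ := h
  rwa [coefJ_eq h1.1, coefJ_abs] at h2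

end CoefficientStep

lemma J_dropStep_le (q : LPDAPParams) (u : P.Sparse) :
    P.J (P.toMeas (P.dropStep q u)) ≤ P.J (P.toMeas u) := by
  rw [dropStep]
  split_ifs with h
  · exact h
  · exact le_rfl

section LGCG

variable {q : LPDAPParams}

lemma norm_vDir_le (hM : 0 ≤ q.M) (u : P.Sparse) (x : P.Ω) : ‖P.toMeas (P.vDir q u x)‖ ≤ q.M := by
  rw [vDir, norm_toMeas_of_subset Finsupp.support_single_subset]
  simp only [Finset.sum_singleton, Finsupp.single_eq_same]
  rw [abs_mul, abs_of_nonneg hM]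
  refine mul_le_of_le_one_right hM ?_
  rcases Real.sign_apply_eq (P.p (P.toMeas u) x) with h | h | h <;> simp [h]

lemma toMeas_vDir_apply (u : P.Sparse) (x : P.Ω) :
    P.toMeas (P.vDir q u x) (P.pC (P.toMeas u)) = q.M * |P.p (P.toMeas u) x| := by
  rw [vDir, toMeas_apply_pC_of_subset Finsupp.support_single_subset]
  simp only [Finset.sum_singleton, Finsupp.single_eq_same]
  rw [mul_assoc, ← abs_eq_sign_mul]

/-- An exact direction maximizes the gap over the ball of radius `M`. -/
lemma IsExact.gap_le_gap (hM : 0 ≤ q.M) {u v : P.Sparse} (h : P.IsExact q u v) {v' : P.Meas}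
    (hv' : ‖v'‖ ≤ q.M) :
    P.gap (P.toMeas u) v' ≤ P.gap (P.toMeas u) (P.toMeas v) := by
  refine (gap_le hv').trans ?_
  rcases h with ⟨hlt, rfl⟩ | ⟨hle, xh, hmax, rfl⟩
  · rw [max_eq_left (by linarith), gap_eq, norm_toMeas (u := 0)]
    simp
  · rw [max_eq_right (by linarith), gap_eq, toMeas_vDir_apply]
    have h1 : ‖P.pC (P.toMeas u)‖ = |P.p (P.toMeas u) xh| :=
      le_antisymm ((ContinuousMap.norm_le _ (abs_nonneg _)).2 fun y => hmax y)
        (P.abs_p_le_norm_pC _ xh)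
    have h2 := mul_le_mul_of_nonneg_left (norm_vDir_le hM u xh) P.α_pos.le
    rw [h1]
    linarith

/-- The estimates delivered by one lazified conditional gradient step. -/
lemma Nondegenerate.lgcg_estimates (hP : P.Nondegenerate ubar γ θ R' σ')
    (hb : P.Bounds ubar R' q.L q.CK q.CK') (hM : 0 < q.M) (hubarM : ‖P.toMeas ubar‖ ≤ q.M)
    {u uhat v : P.Sparse} {ε εnext : ℝ} (huM : ‖P.toMeas u‖ ≤ q.M)
    (hε : 0 < ε) (hres : P.res (P.toMeas u) ≤ 2 * q.M * ε) (hne : εnext ≠ 0)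
    (h : P.IsLGCGStep q u ε q.C uhat v εnext) :
    ‖P.toMeas v‖ ≤ q.M ∧ 0 < P.gap (P.toMeas u) (P.toMeas v) ∧
      P.res (P.toMeas u) ≤ 2 * P.gap (P.toMeas u) (P.toMeas v) ∧ 0 < εnext ∧
      P.res (P.toMeas u) ≤ 2 * q.M * εnext ∧
      P.res (P.toMeas uhat) ≤ P.res (P.toMeas u) -
        1 / 4 * min 1 (P.res (P.toMeas u) / (2 * q.C)) * P.res (P.toMeas u) := by
  have hL := hb.L_pos
  have hCK := hb.CK_pos
  have hC : 0 < q.C := by rw [LPDAPParams.C]; positivity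
  have hr0 := hP.res_nonneg (P.toMeas u)
  obtain ⟨η, huhat, hcase⟩ := h
  have key : ‖P.toMeas v‖ ≤ q.M ∧ ∃ t, 0 < t ∧ t ≤ P.gap (P.toMeas u) (P.toMeas v) ∧
      P.res (P.toMeas u) ≤ 2 * t ∧ η = min 1 (t / q.C) ∧ 0 < εnext ∧
      P.res (P.toMeas u) ≤ 2 * q.M * εnext := by
    rcases hcase with ⟨⟨hv, hgap⟩, hη, hεn⟩ | ⟨-, hex, hη, hεn⟩
    · refine ⟨?_, q.M * ε, by positivity, hgap, by linarith, hη, hεn ▸ hε, hεn ▸ hres⟩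
      rcases hv with rfl | ⟨x, rfl⟩
      · rw [norm_toMeas]; simpa using hM.le
      · exact norm_vDir_le hM.le u x
    · have h1 := (hP.res_le_gap (P.toMeas u)).trans (hex.gap_le_gap hM.le hubarM)
      have hg0 : P.gap (P.toMeas u) (P.toMeas v) ≠ 0 := fun h => hne (by rw [hεn, h, zero_div])
      have hg : 0 < P.gap (P.toMeas u) (P.toMeas v) := lt_of_le_of_ne (hr0.trans h1) hg0.symm
      refine ⟨?_, _, hg, le_rfl, by linarith, hη, by rw [hεn]; positivity, ?_⟩
      · rcases hex with ⟨-, rfl⟩ | ⟨-, xh, -, rfl⟩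
        · rw [norm_toMeas]; simpa using hM.le
        · exact norm_vDir_le hM.le u xh
      · rw [hεn]
        calc P.res (P.toMeas u) ≤ P.gap (P.toMeas u) (P.toMeas v) := h1
          _ = 2 * q.M * (P.gap (P.toMeas u) (P.toMeas v) / (2 * q.M)) := by field_simp
  obtain ⟨hvM, t, ht0, htg, hrt, hη, hεn0, hεn⟩ := key
  refine ⟨hvM, ht0.trans_le htg, by linarith, hεn0, hεn, ?_⟩
  have hη0 : 0 < η := by rw [hη]; positivity
  have hη1 : η ≤ 1 := by rw [hη]; exact min_le_left _ _
  have hηt : η * q.C ≤ t := by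
    rw [← le_div_iff₀ hC, hη]; exact min_le_right _ _
  have hJ := P.J_segment_le hb.lipschitz (P.toMeas u) (P.toMeas v) hη0.le hη1
  have huhatM : P.toMeas uhat = (1 - η) • P.toMeas u + η • P.toMeas v := by
    rw [huhat, map_add, map_smul, map_smul]
  rw [← huhatM] at hJ
  have hK : ‖P.K (P.toMeas v) - P.K (P.toMeas u)‖ ≤ q.CK * (2 * q.M) := by
    have h1 := P.norm_K_le hCK.le hb.norm_κ (P.toMeas v)
    have h2 := P.norm_K_le hCK.le hb.norm_κ (P.toMeas u)
    have h3 := norm_sub_le (P.K (P.toMeas v)) (P.K (P.toMeas u))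
    have h4 := mul_le_mul_of_nonneg_left hvM hCK.le
    have h5 := mul_le_mul_of_nonneg_left huM hCK.le
    linarith
  have hquad : η ^ 2 * (q.L / 2) * ‖P.K (P.toMeas v) - P.K (P.toMeas u)‖ ^ 2 ≤ η * t / 2 := by
    calc η ^ 2 * (q.L / 2) * ‖P.K (P.toMeas v) - P.K (P.toMeas u)‖ ^ 2
        ≤ η ^ 2 * (q.L / 2) * (q.CK * (2 * q.M)) ^ 2 := by gcongr
      _ = η * (η * q.C) / 2 := by rw [LPDAPParams.C]; ring
      _ ≤ η * t / 2 := by gcongr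
  have hlin : η * t ≤ η * P.gap (P.toMeas u) (P.toMeas v) := by gcongr
  have hmin : min 1 (P.res (P.toMeas u) / (2 * q.C)) ≤ η := by
    rw [hη]
    refine min_le_min le_rfl ?_
    rw [div_le_div_iff₀ (by positivity) hC]
    nlinarith
  have hprod : min 1 (P.res (P.toMeas u) / (2 * q.C)) * P.res (P.toMeas u) ≤ η * (2 * t) :=
    mul_le_mul hmin hrt hr0 hη0.le
  rw [hP.res_eq (P.toMeas uhat)]
  rw [hP.res_eq (P.toMeas u)] at hprod ⊢
  linarith

end LGCG

end SparseProblem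

/-! ### Runs of the algorithm -/

namespace SparseProblem

variable {d : ℕ} {Y : Type*} [NormedAddCommGroup Y] [InnerProductSpace ℝ Y] [CompleteSpace Y]
  {P : SparseProblem d Y} {ubar : P.Sparse} {γ θ R' σ' : ℝ} {q : LPDAPParams}

/-- Since `2 μ̄ ≤ M`, the contraction factor is close to one. -/
lemma Nondegenerate.zeta_mem_Ico (hP : P.Nondegenerate ubar γ θ R' σ') (h0 : ubar ≠ 0)
    (hγ : q.γ = γ) (hθ : q.θ = θ) (hb : P.Bounds ubar R' q.L q.CK q.CK') (hM : 0 < q.M)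
    (hubarM : ‖P.toMeas ubar‖ ≤ q.M) : q.zeta (P.muBar ubar) ∈ Ico (1 / 2) 1 := by
  have hCt : 0 < q.Ctilde :=
    Ctilde_pos hb.CK'_pos hM (hθ ▸ hP.θ_pos) (hγ ▸ hP.γ_pos) hb.L_pos
  have hL := hb.L_pos
  have hμ := muBar_pos h0
  have hμM : P.muBar ubar ≤ q.M := by
    obtain ⟨c, hc⟩ := Finsupp.support_nonempty_iff.2 h0
    have h1 := two_mul_muBar_le hc
    have h2 : |ubar c| ≤ ‖P.toMeas ubar‖ := by
      rw [norm_toMeas_of_subset subset_rfl]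
      exact Finset.single_le_sum (f := fun x => |ubar x|) (fun x _ => abs_nonneg _) hc
    linarith
  set m := min 1 (P.muBar ubar / (4 * q.M * q.L * q.Ctilde ^ 2)) with hm
  have hm0 : 0 < m := by positivity
  have hm1 : m ≤ 1 := min_le_left _ _
  have h8 : P.muBar ubar / (8 * q.M) ≤ 1 / 8 := by
    rw [div_le_div_iff₀ (by positivity) (by norm_num)]
    linarith
  have h9 : P.muBar ubar / (8 * q.M) * m ≤ 1 / 8 * 1 := by gcongr
  have h10 : 0 < P.muBar ubar / (8 * q.M) * m := by positivity
  rw [LPDAPParams.zeta, ← hm]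
  constructor <;> linarith

lemma Nondegenerate.res_le_res (hP : P.Nondegenerate ubar γ θ R' σ') {u v : P.Meas} :
    P.res u ≤ P.res v ↔ P.J u ≤ P.J v := by
  rw [hP.res_eq, hP.res_eq, sub_le_sub_iff_right]

variable {u₀ : P.Sparse} {ε₁ Ψ₁ : ℝ} {T : ℕ → P.Stage}

lemma IsLPDAPRun.J_u_le (hT : P.IsLPDAPRun q u₀ ε₁ Ψ₁ T) (n : ℕ) :
    P.J (P.toMeas (T n).u) ≤ P.J (P.toMeas (T n).uminus) :=
  (hT.coefficient n).J_le

/-- Along a run the objective stays below its initial value, and `ε_k` controls the residual. -/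
lemma IsLPDAPRun.invariant (hP : P.Nondegenerate ubar γ θ R' σ')
    (hb : P.Bounds ubar R' q.L q.CK q.CK') (hM : 0 < q.M)
    (hbdd : ∀ v : P.Meas, P.J v ≤ P.J (P.toMeas u₀) → ‖v‖ ≤ q.M) (hε₁ : 0 < ε₁)
    (hres : P.res (P.toMeas u₀) ≤ 2 * q.M * ε₁) (hT : P.IsLPDAPRun q u₀ ε₁ Ψ₁ T) (n : ℕ) :
    P.J (P.toMeas (T n).uminus) ≤ P.J (P.toMeas u₀) ∧ 0 < (T n).ε ∧
      P.res (P.toMeas (T n).uminus) ≤ 2 * q.M * (T n).ε := by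
  induction n with
  | zero =>
    rw [hT.uminus_zero, hT.ε_zero]
    have h := J_dropStep_le q u₀
    exact ⟨h, hε₁, (hP.res_le_res.2 h).trans hres⟩
  | succ n ih =>
    obtain ⟨hJ, hε, hr⟩ := ih
    rcases lt_or_ge (P.gap (P.toMeas (T n).u) (P.toMeas (T n).v) / 2)
      (P.coefGap q (T n).uminus (T n).w) with h | h
    · obtain ⟨-, -, hu, he, -⟩ := hT.recompute n h
      rw [hu, he]
      exact ⟨hJ, hε, hr⟩
    · obtain ⟨-, -, he, -, uplus, -, -, hhat, hu⟩ := hT.advance n h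
      have hJu := hT.J_u_le n
      obtain ⟨-, -, -, hεn, hrn, hdec⟩ := hP.lgcg_estimates hb hM
        (hbdd _ (hP.isMin _)) (hbdd _ (hJu.trans hJ)) hε ((hP.res_le_res.2 hJu).trans hr)
        (hT.not_terminated n) (hT.lgcg n)
      have hd : 0 ≤ 1 / 4 * min 1 (P.res (P.toMeas (T n).u) / (2 * q.C)) *
          P.res (P.toMeas (T n).u) := by
        have h1 := hP.res_nonneg (P.toMeas (T n).u)
        have : 0 ≤ q.C := by
          have := hb.L_pos
          rw [LPDAPParams.C]; positivity
        positivity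
      have hle : P.J (P.toMeas (T (n + 1)).uminus) ≤ P.J (P.toMeas (T n).u) := by
        rw [hu]
        refine (J_dropStep_le q uplus).trans (hhat.trans (hP.res_le_res.1 ?_))
        linarith
      rw [he]
      exact ⟨hle.trans (hJu.trans hJ), hεn, (hP.res_le_res.2 hle).trans hrn⟩

/-- After a recompute step the residual is bounded by a multiple of the halved tolerance: the gap
was at most twice the accuracy of the previous coefficient step, and the objective gained since
then is bounded by that of the new one. -/
lemma IsLPDAPRun.res_recompute_le (hP : P.Nondegenerate ubar γ θ R' σ')
    (hT : P.IsLPDAPRun q u₀ ε₁ Ψ₁ T) {n : ℕ} (hM : ‖P.toMeas (T n).u‖ ≤ q.M)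
    (hgap : P.res (P.toMeas (T n).u) ≤ 2 * P.gap (P.toMeas (T n).u) (P.toMeas (T n).v))
    (h : P.gap (P.toMeas (T n).u) (P.toMeas (T n).v) / 2 <
      P.coefGap q (T n).uminus (T n).w) :
    P.res (P.toMeas (T (n + 1)).u) ≤ 9 * (T (n + 1)).Ψ := by
  obtain ⟨-, -, hu, -, hΨ⟩ := hT.recompute n h
  obtain ⟨hw, -, hΦ, hun⟩ := hT.coefficient n
  obtain ⟨hw', -, hΦ', hun'⟩ := hT.coefficient (n + 1)
  rw [hu] at hw' hΦ' hun'
  have h1 := P.J_sub_le_gap (P.toMeas (T (n + 1)).u) (P.toMeas (T n).u)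
  have h2 : P.gap (P.toMeas (T (n + 1)).u) (P.toMeas (T n).u) ≤
      P.coefGap q (T n).uminus (T (n + 1)).w := by
    rw [hun, hun']
    refine gap_signed_le_coefGap hw'.1 hw ?_
    rw [← norm_toMeas_signed hw.1, ← hun]
    exact hM
  have h3 := hP.res_eq (P.toMeas (T (n + 1)).u)
  have h4 := hP.res_eq (P.toMeas (T n).u)
  linarith

/-- The residuals along a run satisfy the recursion of `rate_of_recursion`, where `cl` says that
`u_{k-}` is clustered. -/
theorem Nondegenerate.exists_rate (hP : P.Nondegenerate ubar γ θ R' σ') (h0 : ubar ≠ 0)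
    (hγ : q.γ = γ) (hθ : q.θ = θ) (hR0 : 0 < q.R) (hR : q.R < R') (hσ0 : 0 < q.σ)
    (hσ : q.σ ≤ σ') (hadm : P.AdmissibleRadius ubar θ q.R q.σ)
    (hb : P.Bounds ubar R' q.L q.CK q.CK') (hM : 0 < q.M)
    (hbdd : ∀ v : P.Meas, P.J v ≤ P.J (P.toMeas u₀) → ‖v‖ ≤ q.M) (hε₁ : 0 < ε₁)
    (hres : P.res (P.toMeas u₀) ≤ 2 * q.M * ε₁) (hT : P.IsLPDAPRun q u₀ ε₁ Ψ₁ T) :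
    ∃ n₀ : ℕ, ∀ n : ℕ, n₀ ≤ (T n).k + (T n).s →
      P.res (P.toMeas (T n).u) ≤
        q.zeta (P.muBar ubar) ^ ((((T n).k + (T n).s : ℕ) : ℝ) / 3) := by
  have hubarM : ‖P.toMeas ubar‖ ≤ q.M := hbdd _ (hP.isMin _)
  obtain ⟨hζ0, hζ1⟩ := hP.zeta_mem_Ico h0 hγ hθ hb hM hubarM
  obtain ⟨δ₁, hδ₁, hdrop⟩ := hP.exists_clustered_dropStep h0 q hR0 hR hσ0 hσ hadm
  obtain ⟨δ₂, hδ₂, hlsi⟩ :=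
    hP.exists_lsi_contraction h0 q hγ hθ hR0 hR hσ0 hσ hadm hb hM hubarM
  obtain ⟨δ₃, hδ₃, hreg⟩ := hadm.exists_regular hP hR0 hR
  have hC : 0 < q.C := by
    have := hb.L_pos
    have := hb.CK_pos
    rw [LPDAPParams.C]; positivity
  refine rate_of_recursion (k := fun n => (T n).k) (s := fun n => (T n).s)
    (r := fun n => P.res (P.toMeas (T n).u)) (rm := fun n => P.res (P.toMeas (T n).uminus))
    (Ψ := fun n => (T n).Ψ) (cl := fun n => P.Clustered ubar q.R (T n).uminus)
    hC (δ := min δ₁ (min δ₂ δ₃)) (by positivity) hζ0 hζ1 hT.k_zero hT.s_zero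
    (fun n => hP.res_nonneg _) (fun n => hP.res_le_res.2 (hT.J_u_le n)) fun n => ?_
  obtain ⟨hJ, hε, hr⟩ := hT.invariant hP hb hM hbdd hε₁ hres n
  have hJu := hT.J_u_le n
  have huM : ‖P.toMeas (T n).u‖ ≤ q.M := hbdd _ (hJu.trans hJ)
  have hresu := hP.res_le_res.2 hJu
  obtain ⟨hvM, hgap0, hrgap, -, -, hdec⟩ := hP.lgcg_estimates hb hM hubarM huM hε
    (hresu.trans hr) (hT.not_terminated n) (hT.lgcg n)
  rcases lt_or_ge (P.gap (P.toMeas (T n).u) (P.toMeas (T n).v) / 2)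
    (P.coefGap q (T n).uminus (T n).w) with h | h
  · left
    have h9 := hT.res_recompute_le hP huM hrgap h
    obtain ⟨hk, hs, hu, -, hΨ⟩ := hT.recompute n h
    exact ⟨hk, hs, by simp only [hu], hΨ, h9, fun hcl => by rwa [hu]⟩
  · right
    obtain ⟨hk, hs, -, hΨ, uplus, -, htilde, hhat, hu⟩ := hT.advance n h
    have hplus := hP.res_le_res.2 hhat
    have hminus : P.res (P.toMeas (T (n + 1)).uminus) ≤ P.res (P.toMeas uplus) := by
      rw [hu]; exact hP.res_le_res.2 (J_dropStep_le q uplus)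
    refine ⟨hk, hs, hΨ, hminus.trans (hplus.trans hdec), fun hδ => ?_, fun hcl hδ => ?_⟩
    · have hd : 0 ≤ 1 / 4 * min 1 (P.res (P.toMeas (T n).u) / (2 * q.C)) *
          P.res (P.toMeas (T n).u) := by
        have h1 := hP.res_nonneg (P.toMeas (T n).u)
        positivity
      rw [hu]
      refine hdrop _ ?_
      linarith [min_le_left δ₁ (min δ₂ δ₃)]
    · have hδu := hresu.trans hδ
      obtain ⟨hw, -, -, hun⟩ := hT.coefficient n
      have hclu : P.Clustered ubar q.R (T n).u := by rw [hun]; exact hcl.signed hw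
      -- for small residuals the dual variable has the signs of the clusters, so that the
      -- sign constraint of the coefficient step does not affect the gap
      have hsupp : P.supportGap q.M (T n).u ≤ P.coefGap q (T n).uminus (T n).w := by
        have hregu := hreg (P.toMeas (T n).u)
          (hδu.trans ((min_le_right _ _).trans (min_le_right _ _)))
        rw [hun] at hregu ⊢
        refine supportGap_signed_le_coefGap hM.le hw.1 fun z hz => ?_
        obtain ⟨c, hc, hzc, hs⟩ := hcl z hz
        rw [hs]
        exact hregu.sign_eq c hc z hzc
      exact hminus.trans ((hP.res_le_res.2 htilde).trans
        (hlsi _ (hδu.trans ((min_le_right _ _).trans (min_le_left _ _))) huM hclu _ hvM hgap0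
          (hsupp.trans h) _ (hT.lsi n)))

end SparseProblem

theorem mainTheorem4 {d : ℕ} (hd : 1 ≤ d) {Y : Type*} [NormedAddCommGroup Y]
    [InnerProductSpace ℝ Y] [CompleteSpace Y] (P : SparseProblem d Y)
    (ubar : P.Sparse) (hubar : ubar ≠ 0) (γ θ R' σ' : ℝ)
    (hP : P.Nondegenerate ubar γ θ R' σ') :
    (∃ Rtilde : ℝ, 0 < Rtilde ∧ Rtilde ≤ R' ∧ ∀ R : ℝ, 0 < R → R < Rtilde →
      ∃ σ : ℝ, 0 < σ ∧ σ ≤ σ' ∧ P.AdmissibleRadius ubar θ R σ) ∧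
    ∀ q : LPDAPParams, q.γ = γ → q.θ = θ →
      0 < q.R → q.R < R' → 0 < q.σ → q.σ ≤ σ' → P.AdmissibleRadius ubar θ q.R q.σ →
      P.Bounds ubar R' q.L q.CK q.CK' →
      ∀ (u₀ : P.Sparse) (ε₁ Ψ₁ : ℝ),
        0 < q.M → (∀ v : P.Meas, P.J v ≤ P.J (P.toMeas u₀) → ‖v‖ ≤ q.M) →
        0 < ε₁ → P.res (P.toMeas u₀) ≤ 2 * q.M * ε₁ → 0 < Ψ₁ →
        (0 < q.zeta (P.muBar ubar) ∧ q.zeta (P.muBar ubar) < 1) ∧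
        ∀ T : ℕ → P.Stage, P.IsLPDAPRun q u₀ ε₁ Ψ₁ T →
          ∃ n₀ : ℕ, ∀ n : ℕ, n₀ ≤ (T n).k + (T n).s →
            P.res (P.toMeas (T n).u) ≤
              q.zeta (P.muBar ubar) ^ ((((T n).k + (T n).s : ℕ) : ℝ) / 3) := by
  refine ⟨?_, fun q hγ hθ hR0 hR hσ0 hσ hadm hb u₀ ε₁ Ψ₁ hM hbdd hε₁ hres _ => ?_⟩
  · obtain ⟨Rt, hRt0, hRt, h⟩ := hP.exists_admissibleRadius hubar
    refine ⟨Rt, hRt0, hRt, fun R hR0 hR => ?_⟩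
    obtain ⟨σ, hσ0, hσ, hadm⟩ := h R hR0 hR
    exact ⟨σ, hσ0, hσ, hadm.of_two_mul hP.θ_pos⟩
  · obtain ⟨hζ0, hζ1⟩ := hP.zeta_mem_Ico hubar hγ hθ hb hM (hbdd _ (hP.isMin _))
    exact ⟨⟨by linarith, hζ1⟩, fun T hT =>
      hP.exists_rate hubar hγ hθ hR0 hR hσ0 hσ hadm hb hM hbdd hε₁ hres hT⟩
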